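/- **Weights.** A weight is a labelling by $\circ,\times,\vee,\wedge$ of the vertices of a number line (a set of consecutive integers) such that, outside some finite set of vertices, no two vertices are labelled $\vee\,\wedge$ in this order from left to right. Write $\lambda\sim\mu$ if $\mu$ arises from $\lambda$ by a finite permutation of labels $\vee,\wedge$ (fixing all $\circ$ and $\times$); a block $\Lambda$ is a $\sim$-class. A cup diagram consists of finitely many cups and of rays below the number line, pairwise disjoint; cap diagrams are their mirror images $c^*$. A cup diagram $a$ glued under a weight $\lambda$ is oriented if free vertices are labelled $\circ$ or $\times$, each cup has one end labelled $\vee$ and one labelled $\wedge$, rays are labelled $\vee$ or $\wedge$, and no two rays are labelled $\vee\,\wedge$ in this order; $\lambda b$ is oriented if $b^*\lambda$ is. A cup or cap is clockwise if its left end is labelled $\wedge$, and $\deg(a\lambda)$, $\deg(\lambda b)$ are the numbers of clockwise cups, caps. Let $\underline\lambda$ be the unique cup diagram such that $\underline\lambda\lambda$ is oriented of degree $0$ (join neighbouring pairs $\vee\,\wedge$ repeatedly, then draw rays), and $\overline\lambda=(\underline\lambda)^*$. Write $\lambda\subset\mu$ if $\lambda\sim\mu$ and $\underline\lambda\mu$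 is oriented. Let $\operatorname{def}(\Lambda)\in\{0,1,\dots,\infty\}$ be the supremum over $\lambda\in\Lambda$ of the number of cups of $\underline\lambda$. **The algebra $K_\Lambda$.** $K_\Lambda$ is the complex vector space with basis the oriented circle diagrams $(a\lambda b)$, $\lambda\in\Lambda$ (that is, $a\lambda$ and $\lambda b$ are oriented), graded by $\deg(a\lambda b)=\deg(a\lambda)+\deg(\lambda b)$. Put $e_\lambda=(\underline\lambda\lambda\overline\lambda)$. The product $(a\lambda b)(c\mu d)$ is $0$ if $b^*\ne c$. Suppose $b^*=c$. * If the diagrams have no rays, draw $a\lambda b$ below $c\mu d$, joining the corresponding vertices not on $b$, $c$ by vertical segments, and successively cut the symmetric cap–cup pairs in the middle (outer ones first), replacing each by two vertical segments. Reorient the circles involved by $1\otimes1\mapsto1$, $1\otimes x,\,x\otimes1\mapsto x$, $x\otimes x\mapsto0$ when two circles merge, and by $1\mapsto1\otimes x+x\otimes1$, $x\mapsto x\otimes x$ when one circle splits, where $1$ (resp. $x$) is a circle whose leftmost vertex is labelled $\vee$ (resp. $\wedge$). Finally identify the two number lines and add up the resulting basis vectors. * If $\Lambda$ has finitely many vertices,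 with $p$ labels $\wedge$ and $q$ labels $\vee$, first pass to closures: $\operatorname{cl}(\lambda)$ is $\lambda$ with $p$ new vertices $\vee$ added on the left and $q$ new vertices $\wedge$ on the right, and $\operatorname{cl}(\underline\alpha)=\underline{\operatorname{cl}(\alpha)}$, $\operatorname{cl}(\overline\beta)=\overline{\operatorname{cl}(\beta)}$. Multiply the closures as above, discard basis vectors whose weight is not in $\operatorname{cl}(\Lambda)$, and undo the closure. * In general, restrict both diagrams to a bounded interval of vertices that contains all their cups and caps, multiply there, and extend the result again by the removed vertices and rays. **Modules.** For a graded module $M$ let $M\langle j\rangle_i=M_{i-j}$. For $\lambda\in\Lambda$ let $L(\lambda)$ be the one-dimensional module in degree $0$ on which $e_\lambda$ acts as $1$ and all other basis vectors act as $0$. For $\mu\in\Lambda$ the cell module $V(\mu)$ has basis the oriented cup diagrams $(c\mu|$, in degree $\deg(c\mu)$; equivalently $(\underline\lambda\mu|$ with $\lambda\subset\mu$. The action is $(a\lambda b)(c\mu|=s_{a\lambda b}(\mu)\,(a\mu|$ if $b^*=c$ and $a\mu$ is oriented, and $0$ otherwise, where $s_{a\lambda b}(\mu)$ is the coefficient of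 $(a\mu d)$ in $(a\lambda b)(c\mu d)$, which does not depend on $d$ (one may take $d=\overline\mu$). **Theorem.** Let $\Lambda$ be a block and $\mu\in\Lambda$. The action of $K_\Lambda$ on $V(\mu)$ is compatible with the gradings. Let $N(j)$ be the span of all homogeneous components of $V(\mu)$ of degree $\ge j$. Then $V(\mu)=N(0)\supseteq N(1)\supseteq N(2)\supseteq\cdots$ is a filtration by graded $K_\Lambda$-submodules, and for each $j\ge0$ there is an isomorphism of graded $K_\Lambda$-modules $$N(j)/N(j+1)\;\cong\bigoplus_{\substack{\lambda\subset\mu\\ \deg(\underline\lambda\mu)=j}}L(\lambda)\langle j\rangle .$$ Consequently, for all $\lambda\in\Lambda$ and $j\in\mathbb Z$, the multiplicity of $L(\lambda)\langle j\rangle$ as a graded composition factor of $V(\mu)$ (the maximal number of subquotients isomorphic to it in a finite chain of graded submodules) is $1$ if $\lambda\subset\mu$ and $\deg(\underline\lambda\mu)=j$, and $0$ otherwise; that is, the $q$-decomposition number is $q^{\deg(\underline\lambda\mu)}$ if $\lambda\subset\mu$ and $0$ otherwise. Moreover, $N(j)=0$ for all sufficiently large $j$ if and only if $\operatorname{def}(\Lambda)<\infty$,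 and $V(\mu)$ is finite dimensional if and only if $\operatorname{def}(\Lambda)<\infty$. -/

import Mathlib

noncomputable section

namespace KhovanovArc

open scoped Classical DirectSum

/-! ## Weights and blocks -/

/-- The four labels of a vertex: `nought` (∘), `cross` (×), `down` (∨), `up` (∧). -/
inductive Label
  | nought
  | cross
  | down
  | up
  deriving DecidableEq

/-- A labelling of some of the integers; `none` means that the integer is not a vertex. -/
abbrev Labelling := ℤ → Option Label

/-- A weight: a labelling of the vertices of a number line (a set of consecutive integers) such
that outside some finite set of vertices there are no two vertices labelled `∨ ∧` in that order
from left to right. -/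
@[ext]
structure Weight where
  label : Labelling
  consecutive : {i | label i ≠ none}.OrdConnected
  almost_sorted : ∃ F : Set ℤ, F.Finite ∧ ∀ i j : ℤ, i ∉ F → j ∉ F → i < j →
    ¬ (label i = some .down ∧ label j = some .up)

/-- The set of vertices of the number line underlying a weight. -/
def Weight.line (w : Weight) : Set ℤ := {i | w.label i ≠ none}

/-- `w ∼ v`: the weight `v` is obtained from `w` by a (finite) permutation of the labels `∨`, `∧`,
doing nothing to the labels `∘`, `×`. -/
def Weight.Linked (w v : Weight) : Prop :=
  ∃ σ : Equiv.Perm ℤ, {i | σ i ≠ i}.Finite ∧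
    (∀ i, σ i ≠ i → w.label i = some .down ∨ w.label i = some .up) ∧
    ∀ i, v.label (σ i) = w.label i

/-- A block: a `∼`-equivalence class of weights. -/
structure Block where
  carrier : Set Weight
  is_class : ∃ w : Weight, carrier = {v | w.Linked v}

/-! ## Cup diagrams, cap diagrams and orientations -/

/-- A cup diagram on a number line: finitely many cups, recorded as pairs (left end, right end),
and rays, recorded by their vertices, no two of which meet. Since the mirror image in the number
line identifies cap diagrams with cup diagrams, the same type is used for cap diagrams, and the
mirror image `*` becomes the identity map. -/
@[ext]
structure ArcDiagram where
  line : Set ℤ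
  arcs : Finset (ℤ × ℤ)
  rays : Set ℤ
  consecutive : line.OrdConnected
  arc_lt : ∀ p ∈ arcs, p.1 < p.2
  arc_mem : ∀ p ∈ arcs, p.1 ∈ line ∧ p.2 ∈ line
  ray_mem : rays ⊆ line
  arc_arc : ∀ p ∈ arcs, ∀ q ∈ arcs, p ≠ q →
    p.2 < q.1 ∨ q.2 < p.1 ∨ (p.1 < q.1 ∧ q.2 < p.2) ∨ (q.1 < p.1 ∧ p.2 < q.2)
  arc_ray : ∀ p ∈ arcs, ∀ r ∈ rays, r < p.1 ∨ p.2 < r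

/-- The vertex `i` is an end of one of the arcs in `s`. -/
def IsEnd (s : Set (ℤ × ℤ)) (i : ℤ) : Prop := ∃ p ∈ s, i = p.1 ∨ i = p.2

/-- `a w` is an oriented cup diagram (equivalently, `w a` is an oriented cap diagram, for the
cap diagram mirror to `a`). -/
structure ArcDiagram.Oriented (a : ArcDiagram) (w : Weight) : Prop where
  line_eq : a.line = w.line
  free : ∀ i ∈ a.line, ¬ IsEnd a.arcs i → i ∉ a.rays →
    w.label i = some .nought ∨ w.label i = some .cross
  arcs : ∀ p ∈ a.arcs,
    (w.label p.1 = some .down ∧ w.label p.2 = some .up) ∨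
      (w.label p.1 = some .up ∧ w.label p.2 = some .down)
  rays : ∀ i ∈ a.rays, w.label i = some .down ∨ w.label i = some .up
  rays_sorted : ∀ i ∈ a.rays, ∀ j ∈ a.rays, i < j →
    ¬ (w.label i = some .down ∧ w.label j = some .up)

/-- The degree of an oriented cup (or cap) diagram: the number of clockwise cups (or caps), i.e.
of those whose left end is labelled `∧`. -/
def ArcDiagram.deg (a : ArcDiagram) (w : Weight) : ℕ :=
  (a.arcs.filter fun p => w.label p.1 = some .up).card

/-! ## The cup diagram of a weight -/

/-- `∨` counts `1`, `∧` counts `-1`, everything else counts `0`. -/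
def sgn : Option Label → ℤ
  | some .down => 1
  | some .up => -1
  | _ => 0

/-- `i` and `j` get joined when one repeatedly joins neighbouring pairs `∨ ∧`: they are labelled
`∨`, `∧` and this pair is the first balanced stretch starting at `i`. -/
def Joined (f : Labelling) (i j : ℤ) : Prop :=
  i < j ∧ f i = some .down ∧ f j = some .up ∧ ∑ m ∈ Finset.Icc i j, sgn (f m) = 0 ∧
    ∀ k, i ≤ k → k < j → 0 < ∑ m ∈ Finset.Icc i k, sgn (f m)

theorem sum_split (f : Labelling) {i k j : ℤ} (h : i ≤ k + 1) (h' : k ≤ j) :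
    ∑ m ∈ Finset.Icc i j, sgn (f m) =
      ∑ m ∈ Finset.Icc i k, sgn (f m) + ∑ m ∈ Finset.Icc (k + 1) j, sgn (f m) := by
  rw [← Finset.sum_union]
  · congr 1
    ext m
    simp only [Finset.mem_union, Finset.mem_Icc]
    omega
  · rw [Finset.disjoint_left]
    intro m
    simp only [Finset.mem_Icc]
    omega

theorem Joined.tail_neg {f : Labelling} {i j k : ℤ} (h : Joined f i j) (hik : i < k)
    (hkj : k ≤ j) : ∑ m ∈ Finset.Icc k j, sgn (f m) < 0 := by
  obtain ⟨_, _, _, h0, hp⟩ := h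
  have := hp (k - 1) (by omega) (by omega)
  rw [sum_split f (k := k - 1) (by omega) (by omega)] at h0
  simp only [sub_add_cancel] at h0
  linarith

theorem sgn_step (o : Option Label) : sgn o = 1 ∧ o = some .down ∨ sgn o = -1 ∧ o = some .up ∨
    sgn o = 0 ∧ o ≠ some .down ∧ o ≠ some .up := by
  rcases o with _ | (_ | _ | _ | _) <;> simp [sgn]

theorem sum_last (f : Labelling) {i j : ℤ} (h : i ≤ j) :
    ∑ m ∈ Finset.Icc i j, sgn (f m) = ∑ m ∈ Finset.Icc i (j - 1), sgn (f m) + sgn (f j) := by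
  rw [sum_split f (k := j - 1) (by omega) (by omega)]
  simp

theorem sum_first (f : Labelling) {i j : ℤ} (h : i ≤ j) :
    ∑ m ∈ Finset.Icc i j, sgn (f m) = sgn (f i) + ∑ m ∈ Finset.Icc (i + 1) j, sgn (f m) := by
  rw [sum_split f (k := i) (by omega) (by omega)]
  simp

/-- A `∨` after which some stretch has nonpositive sum is the left end of a cup. -/
theorem exists_joined_right {f : Labelling} {i j : ℤ} (hi : f i = some .down) (hij : i ≤ j)
    (hs : ∑ m ∈ Finset.Icc i j, sgn (f m) ≤ 0) : ∃ l, l ≤ j ∧ Joined f i l := by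
  obtain ⟨n, hn, hmin⟩ : ∃ n : ℕ, ∑ m ∈ Finset.Icc i (i + n), sgn (f m) ≤ 0 ∧
      ∀ k : ℕ, k < n → 0 < ∑ m ∈ Finset.Icc i (i + k), sgn (f m) := by
    have hex : ∃ n : ℕ, ∑ m ∈ Finset.Icc i (i + n), sgn (f m) ≤ 0 :=
      ⟨(j - i).toNat, by rwa [Int.toNat_of_nonneg (by omega), add_sub_cancel]⟩
    exact ⟨Nat.find hex, Nat.find_spec hex, fun k hk => not_le.1 (Nat.find_min hex hk)⟩
  have hpos : ∀ k, i ≤ k → k < i + n → 0 < ∑ m ∈ Finset.Icc i k, sgn (f m) := by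
    intro k h1 h2
    have := hmin (k - i).toNat (by omega)
    rwa [Int.toNat_of_nonneg (by omega), add_sub_cancel] at this
  have hn0 : n ≠ 0 := by
    rintro rfl
    simp [hi, sgn] at hn
  have hlast := sum_last f (i := i) (j := i + n) (by omega)
  have hprev := hpos (i + n - 1) (by omega) (by omega)
  have hle : i + n ≤ j := by
    by_contra hc
    exact absurd hs (not_le.2 (hpos j hij (by omega)))
  refine ⟨i + n, hle, by omega, hi, ?_, ?_, hpos⟩
  · rcases sgn_step (f (i + n)) with h | h | h
    · omega
    · exact h.2
    · omega
  · rcases sgn_step (f (i + n)) with h | h | h <;> omega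

/-- A `∧` before which some stretch has nonnegative sum is the right end of a cup. -/
theorem exists_joined_left {f : Labelling} {i j : ℤ} (hj : f j = some .up) (hij : i ≤ j)
    (hs : 0 ≤ ∑ m ∈ Finset.Icc i j, sgn (f m)) : ∃ l, i ≤ l ∧ Joined f l j := by
  obtain ⟨n, hn, hmin⟩ : ∃ n : ℕ, 0 ≤ ∑ m ∈ Finset.Icc (j - n) j, sgn (f m) ∧
      ∀ k : ℕ, k < n → ∑ m ∈ Finset.Icc (j - k) j, sgn (f m) < 0 := by
    have hex : ∃ n : ℕ, 0 ≤ ∑ m ∈ Finset.Icc (j - n) j, sgn (f m) :=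
      ⟨(j - i).toNat, by rwa [Int.toNat_of_nonneg (by omega), sub_sub_cancel]⟩
    exact ⟨Nat.find hex, Nat.find_spec hex, fun k hk => not_le.1 (Nat.find_min hex hk)⟩
  have hneg : ∀ k, k ≤ j → j - n < k → ∑ m ∈ Finset.Icc k j, sgn (f m) < 0 := by
    intro k h1 h2
    have := hmin (j - k).toNat (by omega)
    rwa [Int.toNat_of_nonneg (by omega), sub_sub_cancel] at this
  have hn0 : n ≠ 0 := by
    rintro rfl
    simp [hj, sgn] at hn
  have hfirst := sum_first f (i := j - n) (j := j) (by omega)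
  have hnext := hneg (j - n + 1) (by omega) (by omega)
  have hle : i ≤ j - n := by
    by_contra hc
    exact absurd hs (not_le.2 (hneg i hij (by omega)))
  have h0 : ∑ m ∈ Finset.Icc (j - n) j, sgn (f m) = 0 := by
    rcases sgn_step (f (j - n)) with h | h | h <;> omega
  refine ⟨j - n, hle, by omega, ?_, hj, h0, ?_⟩
  · rcases sgn_step (f (j - n)) with h | h | h
    · exact h.2
    · omega
    · omega
  · intro k h1 h2
    have := sum_split f (i := j - n) (k := k) (j := j) (by omega) (by omega)
    have := hneg (k + 1) (by omega) (by omega)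
    omega

theorem Joined.eq_or_apart {f : Labelling} {i j k l : ℤ} (h : Joined f i j) (h' : Joined f k l)
    (hik : i ≤ k) : (i = k ∧ j = l) ∨ j < k ∨ (i < k ∧ l < j) := by
  rcases hik.eq_or_lt with rfl | hlt
  · left
    refine ⟨rfl, ?_⟩
    rcases lt_trichotomy j l with hl | hl | hl
    · have := h'.2.2.2.2 j h.1.le hl
      have := h.2.2.2.1
      omega
    · exact hl
    · have := h.2.2.2.2 l h'.1.le hl
      have := h'.2.2.2.1
      omega
  · right
    by_contra! hc
    obtain ⟨h1, h2⟩ := hc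
    have h3 := h2 hlt
    have h4 := h.tail_neg hlt h1
    rcases h3.eq_or_lt with rfl | h5
    · have := h'.2.2.2.1
      omega
    · rcases h1.eq_or_lt with rfl | h6
      · have h7 := h.2.2.1
        have h8 := h'.2.1
        rw [h7] at h8
        simp at h8
      · have := h'.2.2.2.2 j h1 h5
        omega

/-- A vertex strictly inside a cup of a weight that is labelled `∨` or `∧` is an end of a cup. -/
theorem Joined.inside {f : Labelling} {i j k : ℤ} (h : Joined f i j) (hik : i ≤ k) (hkj : k ≤ j)
    (hk : f k = some .down ∨ f k = some .up) : ∃ l, Joined f k l ∨ Joined f l k := by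
  rcases hik.eq_or_lt with rfl | hlt
  · exact ⟨j, .inl h⟩
  rcases hkj.eq_or_lt with rfl | hlt'
  · exact ⟨i, .inr h⟩
  rcases hk with hk | hk
  · obtain ⟨l, _, hl⟩ := exists_joined_right hk hkj (h.tail_neg hlt hkj).le
    exact ⟨l, .inl hl⟩
  · obtain ⟨l, _, hl⟩ := exists_joined_left hk hik (h.2.2.2.2 k hik hlt').le
    exact ⟨l, .inr hl⟩

theorem Weight.finite_joined (w : Weight) : {p : ℤ × ℤ | Joined w.label p.1 p.2}.Finite := by
  obtain ⟨F, hF, hs⟩ := w.almost_sorted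
  have h1 : {p : ℤ × ℤ | Joined w.label p.1 p.2 ∧ p.1 ∈ F}.Finite := by
    refine Set.Finite.of_finite_image (f := Prod.fst) (hF.subset ?_) ?_
    · rintro _ ⟨p, hp, rfl⟩
      exact hp.2
    · rintro ⟨a, b⟩ ⟨hp, _⟩ ⟨c, d⟩ ⟨hq, _⟩ (rfl : a = c)
      rcases hp.eq_or_apart hq le_rfl with h | h | h
      · exact Prod.ext rfl h.2
      · exact absurd hp.1 (by simp only at h ⊢; omega)
      · exact absurd h.1 (lt_irrefl _)
  have h2 : {p : ℤ × ℤ | Joined w.label p.1 p.2 ∧ p.2 ∈ F}.Finite := by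
    refine Set.Finite.of_finite_image (f := Prod.snd) (hF.subset ?_) ?_
    · rintro _ ⟨p, hp, rfl⟩
      exact hp.2
    · rintro ⟨a, b⟩ ⟨hp, _⟩ ⟨c, d⟩ ⟨hq, _⟩ (rfl : b = d)
      have e1 := hp.1
      have e2 := hq.1
      simp only at hp hq e1 e2
      rcases le_total a c with h | h
      · rcases hp.eq_or_apart hq h with h | h | h
        · exact Prod.ext h.1 rfl
        · omega
        · omega
      · rcases hq.eq_or_apart hp h with h | h | h
        · exact Prod.ext h.1.symm rfl
        · omega
        · omega
  refine (h1.union h2).subset fun p hp => ?_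
  by_cases hm : p.1 ∈ F
  · exact .inl ⟨hp, hm⟩
  · by_cases hn : p.2 ∈ F
    · exact .inr ⟨hp, hn⟩
    · exact absurd ⟨hp.2.1, hp.2.2.1⟩ (hs _ _ hm hn hp.1)

/-- The cup diagram `w̲` of a weight `w` (and, by the mirror image, also the cap diagram `w̄`):
repeatedly join neighbouring pairs `∨ ∧` by cups, then draw rays at the remaining `∨`s and `∧`s. -/
def Weight.underline (w : Weight) : ArcDiagram where
  line := w.line
  arcs := w.finite_joined.toFinset
  rays := {i | (w.label i = some .down ∨ w.label i = some .up) ∧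
    ∀ j, ¬ Joined w.label i j ∧ ¬ Joined w.label j i}
  consecutive := w.consecutive
  arc_lt p hp := by
    rw [Set.Finite.mem_toFinset] at hp
    exact hp.1
  arc_mem p hp := by
    rw [Set.Finite.mem_toFinset] at hp
    have h1 := hp.2.1
    have h2 := hp.2.2.1
    constructor <;> simp [Weight.line, h1, h2]
  ray_mem i hi := by
    rcases hi.1 with h | h <;> simp [Weight.line, h]
  arc_arc p hp q hq hpq := by
    rw [Set.Finite.mem_toFinset] at hp hq
    rcases le_total p.1 q.1 with h | h
    · rcases hp.eq_or_apart hq h with h | h | h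
      · exact absurd (Prod.ext h.1 h.2) hpq
      · exact .inl h
      · exact .inr (.inr (.inl h))
    · rcases hq.eq_or_apart hp h with h | h | h
      · exact absurd (Prod.ext h.1.symm h.2.symm) hpq
      · exact .inr (.inl h)
      · exact .inr (.inr (.inr h))
  arc_ray p hp r hr := by
    rw [Set.Finite.mem_toFinset] at hp
    by_contra! hc
    obtain ⟨l, hl | hl⟩ := hp.inside hc.1 hc.2 hr.1
    · exact (hr.2 l).1 hl
    · exact (hr.2 l).2 hl

/-- `w̲ w` is an oriented cup diagram (and `w w̄` is an oriented cap diagram). -/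
theorem Weight.underline_oriented (w : Weight) : w.underline.Oriented w where
  line_eq := rfl
  free i hi he hr := by
    have hne : w.label i ≠ none := hi
    have key : ¬ (w.label i = some .down ∨ w.label i = some .up) := by
      intro hl
      refine hr ⟨hl, fun j => ⟨fun hj => he ⟨(i, j), ?_, .inl rfl⟩,
        fun hj => he ⟨(j, i), ?_, .inr rfl⟩⟩⟩
      · simpa [Weight.underline] using hj
      · simpa [Weight.underline] using hj
    rcases h : w.label i with _ | (_ | _ | _ | _) <;> simp_all
  arcs p hp := by
    rw [Weight.underline, Set.Finite.mem_toFinset] at hp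
    exact .inl ⟨hp.2.1, hp.2.2.1⟩
  rays i hi := hi.1
  rays_sorted i hi j hj hij := by
    rintro ⟨h1, h2⟩
    rcases le_total (∑ m ∈ Finset.Icc i j, sgn (w.label m)) 0 with h | h
    · obtain ⟨l, _, hl⟩ := exists_joined_right h1 hij.le h
      exact (hi.2 l).1 hl
    · obtain ⟨l, _, hl⟩ := exists_joined_left h2 hij.le h
      exact (hj.2 l).2 hl

/-- All cups of `w̲ w` are anti-clockwise. -/
theorem Weight.underline_deg (w : Weight) : w.underline.deg w = 0 := by
  rw [ArcDiagram.deg, Finset.card_eq_zero, Finset.filter_eq_empty_iff]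
  intro p hp
  rw [Weight.underline, Set.Finite.mem_toFinset] at hp
  simp [hp.2.1]

/-- `v ⊂ w`: the weights are in the same block and `v̲ w` is an oriented cup diagram. -/
def Weight.Sub (v w : Weight) : Prop := v.Linked w ∧ v.underline.Oriented w

/-- The defect of a block: the supremum of the numbers of cups of the diagrams `w̲`. -/
def Block.defect (Λ : Block) : ℕ∞ := ⨆ w ∈ Λ.carrier, (w.underline.arcs.card : ℕ∞)

/-! ## The graded vector space `K_Λ` -/

/-- Oriented circle diagrams `a w b` with `w ∈ Λ`. -/
@[ext]
structure CircleDiagram (Λ : Block) where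
  cup : ArcDiagram
  wt : Weight
  cap : ArcDiagram
  wt_mem : wt ∈ Λ.carrier
  cup_oriented : cup.Oriented wt
  cap_oriented : cap.Oriented wt

/-- The degree of an oriented circle diagram: the number of its clockwise cups and caps. -/
def CircleDiagram.deg {Λ : Block} (x : CircleDiagram Λ) : ℕ := x.cup.deg x.wt + x.cap.deg x.wt

/-- The vector space `K_Λ` with basis the oriented circle diagrams. -/
abbrev K (Λ : Block) : Type := CircleDiagram Λ →₀ ℂ

/-- The homogeneous component of degree `i` of `K_Λ`. -/
def K.piece (Λ : Block) (i : ℤ) : Submodule ℂ (K Λ) :=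
  Finsupp.supported ℂ ℂ {x | (x.deg : ℤ) = i}

/-! ## Surgery

Stacked diagrams have a bottom number line (vertices `(i, false)`) and a top number line
(vertices `(i, true)`), cups `a` below, caps `d` above, and a symmetric middle section: caps `m` on
the bottom line and cups `m` on the top line, all other vertices being joined by vertical segments.
An orientation is recorded by its set of vertices labelled `∧`. -/

/-- The stacked diagram, as a graph. Its circles are the connected components. -/
def stack (a m d : Set (ℤ × ℤ)) : SimpleGraph (ℤ × Bool) :=
  SimpleGraph.fromRel fun u v =>
    (u.2 = false ∧ v.2 = false ∧ (u.1, v.1) ∈ a ∪ m) ∨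
    (u.2 = true ∧ v.2 = true ∧ (u.1, v.1) ∈ d ∪ m) ∨
    (u.1 = v.1 ∧ ¬ IsEnd m u.1)

/-- `O` orients the stacked diagram: every cup and cap has exactly one end labelled `∧`, and
the two ends of a vertical segment have the same label. -/
def IsOrientation (a m d : Set (ℤ × ℤ)) (O : Finset (ℤ × Bool)) : Prop :=
  (∀ p ∈ a ∪ m, (p.1, false) ∈ O ↔ (p.2, false) ∉ O) ∧
  (∀ p ∈ d ∪ m, (p.1, true) ∈ O ↔ (p.2, true) ∉ O) ∧
  ∀ i, ¬ IsEnd m i → ((i, false) ∈ O ↔ (i, true) ∈ O)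

/-- The circle through `u` is clockwise (of type `x`): its leftmost vertex is labelled `∧`.
Otherwise it is anti-clockwise (of type `1`). -/
def Clockwise (G : SimpleGraph (ℤ × Bool)) (O : Finset (ℤ × Bool)) (u : ℤ × Bool) : Prop :=
  ∃ v, G.Reachable u v ∧ (∀ w, G.Reachable u w → v.1 ≤ w.1) ∧ v ∈ O

/-- `O'` is one of the orientations that the surgery at the cap-cup pair `p` produces from the
orientation `O`; the middle section is `p :: m` before and `m` after the surgery. The labels on the
circles not involved do not change; if two circles merge, the types change according to
`1 ⊗ 1 ↦ 1`, `1 ⊗ x ↦ x`, `x ⊗ 1 ↦ x`, `x ⊗ x ↦ 0`; if one circle splits, they change according to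
`1 ↦ 1 ⊗ x + x ⊗ 1`, `x ↦ x ⊗ x`. -/
def Surgery (a d : Set (ℤ × ℤ)) (p : ℤ × ℤ) (m : List (ℤ × ℤ)) (O O' : Finset (ℤ × Bool)) :
    Prop :=
  let G := stack a {q | q ∈ p :: m} d
  let G' := stack a {q | q ∈ m} d
  IsOrientation a {q | q ∈ m} d O' ∧
  (∀ u, ¬ G.Reachable (p.1, false) u → ¬ G.Reachable (p.1, true) u → (u ∈ O' ↔ u ∈ O)) ∧
  if G.Reachable (p.1, false) (p.1, true) then
    (¬ Clockwise G O (p.1, false) ∧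
        ((¬ Clockwise G' O' (p.1, false) ∧ Clockwise G' O' (p.2, false)) ∨
          (Clockwise G' O' (p.1, false) ∧ ¬ Clockwise G' O' (p.2, false)))) ∨
      (Clockwise G O (p.1, false) ∧ Clockwise G' O' (p.1, false) ∧ Clockwise G' O' (p.2, false))
  else
    (¬ Clockwise G O (p.1, false) ∧ ¬ Clockwise G O (p.1, true) ∧
        ¬ Clockwise G' O' (p.1, false)) ∨
      (¬ Clockwise G O (p.1, false) ∧ Clockwise G O (p.1, true) ∧ Clockwise G' O' (p.1, false)) ∨
      (Clockwise G O (p.1, false) ∧ ¬ Clockwise G O (p.1, true) ∧ Clockwise G' O' (p.1, false))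

/-- Iterated surgery at the cap-cup pairs in the given list; `P` is the set of vertices labelled
`∨` or `∧` on either of the number lines. The result is a formal sum of orientations. -/
def surgeries (P : Finset ℤ) (a d : Set (ℤ × ℤ)) :
    List (ℤ × ℤ) → Finset (ℤ × Bool) → (Finset (ℤ × Bool) →₀ ℂ)
  | [], O => Finsupp.single O 1
  | p :: m, O => ∑ O' ∈ (P ×ˢ Finset.univ).powerset with Surgery a d p m O O', surgeries P a d m O'

/-! ## Closures

Only the vertices in a finite interval `[l, r]` of the number line are kept, with `p` labels `∧` and
`q` labels `∨` there; then `p` new vertices `∨` are added on the left and `q` new vertices `∧` on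
the right. -/

/-- The number of vertices in `[l, r]` with the label `o`. -/
def count (f : Labelling) (l r : ℤ) (o : Label) : ℕ :=
  ((Finset.Icc l r).filter fun i => f i = some o).card

/-- The left end of the closed number line. -/
def closeLeft (l r : ℤ) (f : Labelling) : ℤ := l - count f l r .up

/-- The right end of the closed number line. -/
def closeRight (l r : ℤ) (f : Labelling) : ℤ := r + count f l r .down

/-- The closure of the restriction to `[l, r]` of a weight. -/
def close (l r : ℤ) (f : Labelling) : Labelling := fun i =>
  if l ≤ i ∧ i ≤ r then f i
  else if closeLeft l r f ≤ i ∧ i < l then some .down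
  else if r < i ∧ i ≤ closeRight l r f then some .up
  else none

/-- The vertices labelled `∨` or `∧` of the closure. -/
def closePoints (l r : ℤ) (f : Labelling) : Finset ℤ :=
  (Finset.Icc (closeLeft l r f) (closeRight l r f)).filter fun i =>
    close l r f i = some .down ∨ close l r f i = some .up

/-- The vertices labelled `∧` of the closure. -/
def closeUps (l r : ℤ) (f : Labelling) : Finset ℤ :=
  (Finset.Icc (closeLeft l r f) (closeRight l r f)).filter fun i => close l r f i = some .up

/-- If `a w` is an oriented cup diagram, the labels of the weight `v` with `v̲ = a`, `v ⊂ w`: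
all clockwise cups are reversed. -/
def ArcDiagram.reverse (a : ArcDiagram) (w : Weight) : Labelling := fun i =>
  if ∃ p ∈ a.arcs, i = p.1 then some .down
  else if ∃ p ∈ a.arcs, i = p.2 then some .up
  else w.label i

/-- The cups of the closure `cl(a) = underline(cl(v))`, where `a = v̲`, of the restriction of `a`
to `[l, r]`. -/
def closeArcs (l r : ℤ) (a : ArcDiagram) (w : Weight) : Finset (ℤ × ℤ) :=
  let f := a.reverse w
  (Finset.Icc (closeLeft l r f) (closeRight l r f) ×ˢ
    Finset.Icc (closeLeft l r f) (closeRight l r f)).filter fun p =>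
      Joined (close l r f) p.1 p.2

/-- The orientation of the stacked diagram with weight `w` at the bottom and `v` at the top. -/
def stackUps (l r : ℤ) (w v : Weight) : Finset (ℤ × Bool) :=
  closeUps l r w.label ×ˢ {false} ∪ closeUps l r v.label ×ˢ {true}

/-! ## Multiplication -/

/-- The vertices to which a product of `a w b` and `b v d` is truncated: all vertices in the
bounded case, otherwise the interval spanned by the ends of all cups and caps (any bounded
interval that contains these gives the same product). -/
def window {Λ : Block} (x y : CircleDiagram Λ) : Set ℤ :=
  if x.wt.line.Finite then x.wt.line
  else {i | IsEnd x.cup.arcs i ∨ IsEnd x.cap.arcs i ∨ IsEnd y.cap.arcs i}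

/-- The left end of the window. -/
def windowLeft {Λ : Block} (x y : CircleDiagram Λ) : ℤ := sInf (window x y)

/-- The right end of the window. -/
def windowRight {Λ : Block} (x y : CircleDiagram Λ) : ℤ := sSup (window x y)

/-- The result of the iterated surgery for the product of the basis vectors `x = (a w b)` and
`y = (b v d)`: truncate, close, draw `x` below `y` and do the surgeries, going through the caps of
the middle section in the order of their left ends (so that outer ones come before inner ones). -/
def productOrientations {Λ : Block} (x y : CircleDiagram Λ) : Finset (ℤ × Bool) →₀ ℂ :=
  let l := windowLeft x y
  let r := windowRight x y
  surgeries (closePoints l r x.wt.label) (closeArcs l r x.cup x.wt) (closeArcs l r y.cap y.wt)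
    ((((closeArcs l r x.cap x.wt).map toLex.toEmbedding).sort).map ofLex)
    (stackUps l r x.wt y.wt)

/-- `z = (a u d)` is the basis vector of `K_Λ` obtained from the orientation `O` by collapsing the
two number lines, removing the vertices added by the closure, and extending again. -/
def Opens {Λ : Block} (x y : CircleDiagram Λ) (O : Finset (ℤ × Bool)) (z : CircleDiagram Λ) :
    Prop :=
  z.cup = x.cup ∧ z.cap = y.cap ∧
  O = stackUps (windowLeft x y) (windowRight x y) z.wt z.wt ∧
  ∀ i, ¬ (windowLeft x y ≤ i ∧ i ≤ windowRight x y) → z.wt.label i = x.wt.label i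

/-- The product of two basis vectors of `K_Λ`. Orientations that do not come from an element of
`Λ` are discarded. -/
def mulBasis {Λ : Block} (x y : CircleDiagram Λ) : K Λ :=
  if x.cap = y.cup then
    (productOrientations x y).sum fun O c =>
      if h : ∃ z, Opens x y O z then Finsupp.single h.choose c else 0
  else 0

/-- The multiplication of the algebra `K_Λ`. -/
def K.mul (Λ : Block) : K Λ →ₗ[ℂ] K Λ →ₗ[ℂ] K Λ :=
  Finsupp.lift _ ℂ _ fun x => Finsupp.lift _ ℂ _ fun y => mulBasis x y

/-- The basis vector `e_w = (w̲ w w̄)`. -/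
def idem {Λ : Block} (w : Weight) (hw : w ∈ Λ.carrier) : CircleDiagram Λ where
  cup := w.underline
  wt := w
  cap := w.underline
  wt_mem := hw
  cup_oriented := w.underline_oriented
  cap_oriented := w.underline_oriented

/-! ## Graded representations of `K_Λ` -/

/-- The data underlying a graded `K_Λ`-module: a complex vector space, the linear map by which
elements of `K_Λ` act on it, and its homogeneous components. Only the explicit cell modules, the
modules `L(w)`, and shifts, direct sums and subquotients of these are used below. -/
structure Rep (Λ : Block) where
  carrier : Type
  [addCommGroup : AddCommGroup carrier]
  [module : Module ℂ carrier]
  act : K Λ →ₗ[ℂ] Module.End ℂ carrier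
  piece : ℤ → Submodule ℂ carrier

attribute [instance] Rep.addCommGroup Rep.module

/-- The vector space is the direct sum of its homogeneous components `M_j`, and `K_i M_j ⊆ M_{i+j}`
for the homogeneous components `K_i` of `K_Λ`. -/
def Rep.IsGraded {Λ : Block} (M : Rep Λ) : Prop :=
  DirectSum.IsInternal M.piece ∧
  ∀ i j, ∀ x ∈ K.piece Λ i, ∀ v ∈ M.piece j, M.act x v ∈ M.piece (i + j)

/-- `M⟨j⟩`, with homogeneous components `M⟨j⟩_i = M_{i-j}`. -/
def Rep.shift {Λ : Block} (M : Rep Λ) (j : ℤ) : Rep Λ where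
  carrier := M.carrier
  act := M.act
  piece i := M.piece (i - j)

/-- Isomorphism by a homogeneous map of degree `0`. -/
def Rep.Iso {Λ : Block} (M N : Rep Λ) : Prop :=
  ∃ φ : M.carrier ≃ₗ[ℂ] N.carrier,
    (∀ x v, φ (M.act x v) = N.act x (φ v)) ∧ ∀ i v, φ v ∈ N.piece i ↔ v ∈ M.piece i

/-- The direct sum, with componentwise action and grading. -/
def Rep.directSum {Λ : Block} {ι : Type} (M : ι → Rep Λ) : Rep Λ where
  carrier := ⨁ i, (M i).carrier
  act :=
    { toFun := fun x => DirectSum.lmap fun i => (M i).act x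
      map_add' := fun x y => by
        ext i v
        simp
      map_smul' := fun c x => by
        ext i v
        simp }
  piece k := ⨅ i, ((M i).piece k).comap (DirectSum.component ℂ ι (fun i => (M i).carrier) i)

/-- The subspace is stable under the action of `K_Λ`. -/
def Rep.Stable {Λ : Block} (M : Rep Λ) (A : Submodule ℂ M.carrier) : Prop :=
  ∀ x, ∀ v ∈ A, M.act x v ∈ A

/-- Graded submodules: stable subspaces spanned by homogeneous vectors. -/
def Rep.IsSubmodule {Λ : Block} (M : Rep Λ) (A : Submodule ℂ M.carrier) : Prop :=
  M.Stable A ∧ A = ⨆ i, A ⊓ M.piece i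

/-- The subquotient `A / B` (for `B ⊆ A`), with the induced action and grading. -/
def Rep.subquotient {Λ : Block} (M : Rep Λ) (A B : Submodule ℂ M.carrier) (hA : M.Stable A)
    (hB : M.Stable B) : Rep Λ where
  carrier := A ⧸ B.comap A.subtype
  act :=
    { toFun := fun x => (B.comap A.subtype).mapQ (B.comap A.subtype)
        ((M.act x).restrict (hA x)) fun v hv => hB x _ hv
      map_add' := fun x y => by
        ext v
        simp [LinearMap.restrict_apply]
        rfl
      map_smul' := fun c x => by
        ext v
        simp [LinearMap.restrict_apply]
        rfl }
  piece i := ((M.piece i).comap A.subtype).map (B.comap A.subtype).mkQ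

/-- The multiplicity of `L` as a graded composition factor of `M`: the largest number of
subquotients isomorphic to `L` in a finite chain of graded submodules of `M`. -/
def Rep.multiplicity {Λ : Block} (M L : Rep Λ) : ℕ∞ :=
  ⨆ (n : ℕ) (A : Fin (n + 1) → Submodule ℂ M.carrier) (_ : Monotone A)
    (h : ∀ k, M.IsSubmodule (A k)),
    Set.encard {k : Fin n |
      (M.subquotient (A k.succ) (A k.castSucc) (h _).1 (h _).1).Iso L}

/-- The one-dimensional module `L(w)`, in degree `0`: the basis vector `e_w` acts as `1`, all other
basis vectors act as `0`. -/
def simpleModule {Λ : Block} (w : Weight) (hw : w ∈ Λ.carrier) : Rep Λ where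
  carrier := ℂ
  act := (LinearMap.toSpanSingleton ℂ (Module.End ℂ ℂ) 1).comp (Finsupp.lapply (idem w hw))
  piece i := if i = 0 then ⊤ else ⊥

/-! ## Cell modules -/

/-- Oriented cup diagrams `c w`. -/
abbrev CupsOn (w : Weight) : Type := {c : ArcDiagram // c.Oriented w}

/-- The circle diagram `(c w w̄)`. -/
def CupsOn.capped {Λ : Block} {w : Weight} (hw : w ∈ Λ.carrier) (c : CupsOn w) :
    CircleDiagram Λ where
  cup := c.1
  wt := w
  cap := w.underline
  wt_mem := hw
  cup_oriented := c.2
  cap_oriented := w.underline_oriented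

/-- For `x = (a v b)` and oriented cup diagrams `b w` and `a w`, the scalar `s_x(w)`: the
coefficient of `(a w d)` in the product `(a v b) (b w d)`. It does not depend on the choice of the
cap diagram `d`, which here is `w̄`. -/
def scalar {Λ : Block} {w : Weight} (hw : w ∈ Λ.carrier) (x : CircleDiagram Λ) (c a : CupsOn w) :
    ℂ :=
  K.mul Λ (Finsupp.single x 1) (Finsupp.single (c.capped hw) 1) (a.capped hw)

/-- The cell module `V(w)`: it has basis the oriented cup diagrams `(c w|`, in degree `deg (c w)`,
and `(a v b) (c w| = s_{a v b}(w) (a w|` if `b = c` and `a w` is oriented, and `0` otherwise. -/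
def cellModule {Λ : Block} (w : Weight) (hw : w ∈ Λ.carrier) : Rep Λ where
  carrier := CupsOn w →₀ ℂ
  act := Finsupp.lift _ ℂ _ fun x => Finsupp.lift _ ℂ _ fun c =>
    if h : x.cap = c.1 ∧ x.cup.Oriented w then
      Finsupp.single ⟨x.cup, h.2⟩ (scalar hw x c ⟨x.cup, h.2⟩)
    else 0
  piece i := Finsupp.supported ℂ ℂ {c | (c.1.deg w : ℤ) = i}

/-- The subspace `N(j)` spanned by all homogeneous components of degree at least `j`. -/
def Rep.degreeFiltration {Λ : Block} (M : Rep Λ) (j : ℤ) : Submodule ℂ M.carrier :=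
  ⨆ i ≥ j, M.piece i

end KhovanovArc

end

/-! The theorem rests on two facts about products in $K_\Lambda$: they are homogeneous, and the
basis vectors of degree $0$ are exactly the $e_\lambda$, with $e_\lambda$ acting on $V(\mu)$ as the
projection onto the line of $(\underline\lambda\mu|$. Hence $K_\Lambda$ never lowers degrees, each
$N(j)$ is a submodule, and on $N(j)/N(j+1)$ only the $e_\lambda$ act. This layer is the direct sum
of the lines spanned by the $(\underline\lambda\mu|$ of degree $j$.

Homogeneity (`deg_of_mulBasis_ne_zero`) is proved with a turning number. Let every vertex of an
oriented stacked diagram contribute its sign ($1$ for ∧, $-1$ otherwise) times the horizontal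
directions of its two edges. Summed over arcs, this gives $4\cdot$(clockwise
arcs)$\;-\;2\cdot$(arcs) (`IsStack.sum_turn`). Summed over circles, each circle gives $4$ if it is
of type $x$ and $-4$ if it is of type $1$ (`IsStack.sum_turn_circle`, from the combinatorial theorem
`turning` on closed meanders). Each permitted merge or split raises the circle sum by $4$ and
removes two arcs, so the number of clockwise arcs is unchanged. That a surgery really merges two
circles or splits one needs proof as well: a parity argument for merging, and `turning` again for
splitting. Closures add only anti-clockwise arcs and do not affect degrees.

That $e_\lambda$ is a left unit (`mulBasis_idem`) holds because the circles below the cut are all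
small and anti-clockwise. Each surgery is then a merge with a circle of type $1$, has a unique
result, and copies labels from the top line to the bottom line.

For multiplicities, a subquotient $A/B\cong L(\lambda)\langle j\rangle$ forces
$(\underline\lambda\mu|\in A\setminus B$ (`of_subquotient_iso`). In a chain this happens at most
once, and adjoining this vector to $N(j+1)$ shows that it can happen.

For finiteness, if one of the labels ∨, ∧ occurs finitely often in $\mu$, say $n$ times, every cup
diagram on $\mu$ has at most $n$ cups, each of bounded reach, so there are finitely many diagrams.
Otherwise the ∧ extend infinitely to the left and the ∨ infinitely to the right, and exchanging ∨
and ∧ on a long balanced interval gives cup diagrams with arbitrarily many clockwise cups. -/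

noncomputable section

namespace KhovanovArc

open scoped Classical DirectSum

/-! ## The turning number of a meander -/

/-- `U` pairs up the elements of `S`, and the arcs joining paired elements, drawn on one side of a
line on which `v` has the position `pos v`, do not cross. -/
structure Pairing {V : Type*} (pos : V → ℤ) (S : Finset V) (U : V → V) : Prop where
  mem : ∀ v ∈ S, U v ∈ S
  ne : ∀ v ∈ S, U v ≠ v
  invol : ∀ v ∈ S, U (U v) = v
  nest : ∀ v ∈ S, ∀ w ∈ S, pos v < pos w → pos w < pos (U v) →
    pos v < pos (U w) ∧ pos (U w) < pos (U v)

/-- The sign `±1` that alternates along `S`, beginning with `1`. -/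
def altSign {V : Type*} (pos : V → ℤ) (S : Finset V) (v : V) : ℤ :=
  ∏ w ∈ S, if pos w < pos v then -1 else 1

variable {V : Type*} {pos : V → ℤ} {S : Finset V} {U L : V → V}

/-- The points strictly between `v` and `U v` are paired among themselves by `U`, so there is an
even number of them and the two ends of the arc have opposite parity. -/
theorem Pairing.altSign_apply_of_lt (h : Pairing pos S U) (hinj : Set.InjOn pos S) {v : V}
    (hv : v ∈ S) (hlt : pos v < pos (U v)) : altSign pos S (U v) = -altSign pos S v := by
  have key : ∏ w ∈ S, (if pos v < pos w ∧ pos w < pos (U v) then (-1 : ℤ) else 1) = 1 := by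
    refine Finset.prod_involution (fun w _ => U w) ?_ ?_ ?_ ?_
    · intro w hw
      have h1 := h.nest v hv w hw
      have h2 := h.nest v hv (U w) (h.mem w hw)
      rw [h.invol w hw] at h2
      by_cases hc : pos v < pos w ∧ pos w < pos (U v)
      · simp [hc, h1 hc.1 hc.2]
      · rw [if_neg hc, if_neg fun hc' => hc (h2 hc'.1 hc'.2), one_mul]
    · exact fun w hw _ => h.ne w hw
    · exact fun w hw => h.mem w hw
    · exact fun w hw => h.invol w hw
  have : ∀ w ∈ S, (if pos w < pos (U v) then (-1 : ℤ) else 1) =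
      (if pos w < pos v then -1 else 1) *
        (if pos v < pos w ∧ pos w < pos (U v) then -1 else 1) * (if w = v then -1 else 1) := by
    intro w hw
    by_cases hwv : w = v
    · subst hwv
      simp [hlt]
    · have : pos w ≠ pos v := fun h => hwv (hinj hw hv h)
      rcases lt_or_gt_of_ne this with h1 | h1
      · simp [h1, hwv, h1.trans hlt, h1.not_gt]
      · simp [h1, hwv, h1.not_gt]
  rw [altSign, Finset.prod_congr rfl this, Finset.prod_mul_distrib, Finset.prod_mul_distrib, key,
    Finset.prod_ite_eq' S v, if_pos hv, altSign]
  ring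

theorem Pairing.altSign_apply (h : Pairing pos S U) (hinj : Set.InjOn pos S) {v : V}
    (hv : v ∈ S) : altSign pos S (U v) = -altSign pos S v := by
  have : pos (U v) ≠ pos v := fun e => h.ne v hv (hinj (h.mem v hv) hv e)
  rcases lt_or_gt_of_ne this with h1 | h1
  · have := h.altSign_apply_of_lt hinj (h.mem v hv) (by rwa [h.invol v hv])
    rw [h.invol v hv] at this
    omega
  · exact h.altSign_apply_of_lt hinj hv h1

theorem Pairing.even_card (h : Pairing pos S U) : ∏ _w ∈ S, (-1 : ℤ) = 1 :=
  Finset.prod_involution (fun w _ => U w) (by simp) (fun w hw _ => h.ne w hw)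
    (fun w hw => h.mem w hw) fun w hw => h.invol w hw

/-- No proper nonempty subset of `S` is stable under `U` and `L`. -/
def Joint (S : Finset V) (U L : V → V) : Prop :=
  ∀ T ⊆ S, T.Nonempty → (∀ v ∈ T, U v ∈ T) → (∀ v ∈ T, L v ∈ T) → T = S

theorem sign_sub_of_lt {a b : ℤ} (h : a < b) :
    Int.sign (b - a) = 1 ∧ Int.sign (a - b) = -1 :=
  ⟨Int.sign_eq_one_of_pos (by omega), Int.sign_eq_neg_one_of_neg (by omega)⟩

/-- A shortest arc works: a point strictly under it would belong to a shorter arc, by nesting. -/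
theorem Pairing.exists_adjacent (h : Pairing pos S U) (hinj : Set.InjOn pos S)
    (hS : S.Nonempty) : ∃ i ∈ S, pos i < pos (U i) ∧
      ∀ w ∈ S, ¬ (pos i < pos w ∧ pos w < pos (U i)) := by
  have hne : (S.filter fun i => pos i < pos (U i)).Nonempty := by
    obtain ⟨v, hv⟩ := hS
    have : pos (U v) ≠ pos v := fun e => h.ne v hv (hinj (h.mem v hv) hv e)
    rcases lt_or_gt_of_ne this with h1 | h1
    · exact ⟨U v, Finset.mem_filter.2 ⟨h.mem v hv, by rwa [h.invol v hv]⟩⟩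
    · exact ⟨v, Finset.mem_filter.2 ⟨hv, h1⟩⟩
  obtain ⟨i, hi, hmin⟩ := Finset.exists_min_image _ (fun i => pos (U i) - pos i) hne
  rw [Finset.mem_filter] at hi
  refine ⟨i, hi.1, hi.2, fun w hw hc => ?_⟩
  have h1 := h.nest i hi.1 w hw hc.1 hc.2
  have : pos (U w) ≠ pos w := fun e => h.ne w hw (hinj (h.mem w hw) hw e)
  rcases lt_or_gt_of_ne this with h2 | h2
  · have := hmin (U w) (Finset.mem_filter.2 ⟨h.mem w hw, by rwa [h.invol w hw]⟩)
    rw [h.invol w hw] at this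
    omega
  · have := hmin w (Finset.mem_filter.2 ⟨hw, h2⟩)
    omega

/-- The turning number of a closed meander, computed from its arcs on both sides of the line. -/
theorem turning {n : ℕ} : ∀ {S : Finset V} {L : V → V}, S.card = n → Set.InjOn pos S →
    S.Nonempty → Pairing pos S U → Pairing pos S L → Joint S U L →
    ∑ v ∈ S, altSign pos S v * (Int.sign (pos (U v) - pos v) + Int.sign (pos (L v) - pos v)) =
      4 := by
  induction n using Nat.strong_induction_on with
  | _ n ih =>
  intro S L hn hinj hne hU hL hJ
  -- The induction removes an innermost `U`-arc from `i` to `k`. If `L` joins the same points, they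
  -- form the whole meander. Otherwise the `L`-arcs ending at `i` and `k` are spliced along it into
  -- one arc from `a` to `b`.
  obtain ⟨i, hi, hik, hbet⟩ := hU.exists_adjacent hinj hne
  obtain ⟨k, hk⟩ : ∃ k, k = U i := ⟨_, rfl⟩
  rw [← hk] at hik hbet
  have hkS : k ∈ S := hk ▸ hU.mem i hi
  have hUk : U k = i := by rw [hk, hU.invol i hi]
  have hki : k ≠ i := hk ▸ hU.ne i hi
  have hsk : altSign pos S k = -altSign pos S i := by rw [hk, hU.altSign_apply hinj hi]
  have hsi : altSign pos S (L i) = -altSign pos S i := hL.altSign_apply hinj hi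
  have hsb : altSign pos S (L k) = altSign pos S i := by
    rw [hL.altSign_apply hinj hkS, hsk, neg_neg]
  by_cases hLi : L i = k
  · have hLk : L k = i := by rw [← hLi, hL.invol i hi]
    have hT : {i, k} = S := by
      refine hJ {i, k} ?_ ⟨i, by simp⟩ ?_ ?_
      · simp [Finset.insert_subset_iff, hi, hkS]
      · simp [← hk, hUk]
      · simp [hLi, hLk]
    have h1 : altSign pos S i = 1 := by
      rw [altSign, ← hT, Finset.prod_pair hki.symm]
      simp [hik.not_gt]
    conv_lhs => rw [← hT]
    rw [Finset.sum_pair hki.symm, hT, hsk, h1, ← hk, hUk, hLi, hLk]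
    have := sign_sub_of_lt hik
    rw [this.1, this.2]
    norm_num
  obtain ⟨a, ha⟩ : ∃ a, a = L i := ⟨_, rfl⟩
  obtain ⟨b, hb⟩ : ∃ b, b = L k := ⟨_, rfl⟩
  have haS : a ∈ S := ha ▸ hL.mem i hi
  have hbS : b ∈ S := hb ▸ hL.mem k hkS
  have hLa : L a = i := by rw [ha, hL.invol i hi]
  have hLb : L b = k := by rw [hb, hL.invol k hkS]
  rw [← ha] at hLi hsi
  rw [← hb] at hsb
  have hai : a ≠ i := ha ▸ hL.ne i hi
  have hbk : b ≠ k := hb ▸ hL.ne k hkS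
  have hbi : b ≠ i := by
    rintro rfl
    exact hLi (by rw [ha, hLb])
  have hab : a ≠ b := by
    rintro rfl
    exact hki (by rw [← hLb, hLa])
  have hL1 : ∀ v ∈ S, L v = i → v = a := fun v hv e => by rw [← hL.invol v hv, e, ha]
  have hL2 : ∀ v ∈ S, L v = k → v = b := fun v hv e => by rw [← hL.invol v hv, e, hb]
  have hU1 : ∀ v ∈ S, U v = i → v = k := fun v hv e => by rw [← hU.invol v hv, e, hk]
  have hU2 : ∀ v ∈ S, U v = k → v = i := fun v hv e => by rw [← hU.invol v hv, e, hUk]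
  have hpos : ∀ v ∈ S, ∀ w ∈ S, v ≠ w → pos v < pos w ∨ pos w < pos v := fun v hv w hw e =>
    lt_or_gt_of_ne fun e' => e (hinj hv hw e')
  set S' := (S.erase i).erase k with hS'
  have memS' : ∀ v, v ∈ S' ↔ v ∈ S ∧ v ≠ i ∧ v ≠ k := by
    intro v
    simp only [hS', Finset.mem_erase]
    tauto
  have hSS : S = insert i (insert k S') := by
    ext v
    simp only [Finset.mem_insert, memS']
    by_cases h1 : v = i
    · simp [h1, hi]
    · by_cases h2 : v = k
      · simp [h2, hkS]
      · simp [h1, h2]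
  have hk' : k ∉ S' := by simp [memS']
  have hi' : i ∉ insert k S' := by simp [memS', hki.symm]
  have haS' : a ∈ S' := (memS' a).2 ⟨haS, hai, hLi⟩
  have hbS' : b ∈ S' := (memS' b).2 ⟨hbS, hbi, hbk⟩
  have hsame : ∀ v ∈ S, v ≠ i → v ≠ k →
      (pos v < pos i ∧ pos v < pos k) ∨ (pos i < pos v ∧ pos k < pos v) := by
    intro v hv h1 h2
    have := hpos v hv i hi h1
    have := hpos v hv k hkS h2
    have := hbet v hv
    omega
  -- The removed points `i` and `k` lie on the same side of every other point, so their two sign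
  -- changes cancel.
  have halt : ∀ v ∈ S', altSign pos S' v = altSign pos S v := by
    intro v hv
    rw [memS'] at hv
    have : altSign pos S v = (if pos i < pos v then -1 else 1) *
        ((if pos k < pos v then -1 else 1) * altSign pos S' v) := by
      rw [altSign, hSS, Finset.prod_insert hi', Finset.prod_insert hk', altSign]
    rw [this]
    rcases hsame v hv.1 hv.2.1 hv.2.2 with h | h
    · rw [if_neg (by omega), if_neg (by omega)]
      ring
    · rw [if_pos (by omega), if_pos (by omega)]
      ring
  obtain ⟨L', hL'⟩ : ∃ L' : V → V, L' = fun v => if v = a then b else if v = b then a else L v :=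
    ⟨_, rfl⟩
  have hL'a : L' a = b := by simp [hL']
  have hL'b : L' b = a := by simp [hL', hab.symm]
  have hL'v : ∀ v, v ≠ a → v ≠ b → L' v = L v := fun v h1 h2 => by simp [hL', h1, h2]
  have hU' : Pairing pos S' U := by
    refine ⟨?_, ?_, ?_, ?_⟩
    · intro v hv
      rw [memS'] at hv ⊢
      exact ⟨hU.mem v hv.1, fun e => hv.2.2 (hU1 v hv.1 e), fun e => hv.2.1 (hU2 v hv.1 e)⟩
    · exact fun v hv => hU.ne v ((memS' v).1 hv).1
    · exact fun v hv => hU.invol v ((memS' v).1 hv).1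
    · exact fun v hv w hw => hU.nest v ((memS' v).1 hv).1 w ((memS' w).1 hw).1
  have hLout : ∀ v ∈ S', v ≠ a → v ≠ b → L v ∈ S' ∧ L v ≠ a ∧ L v ≠ b := by
    intro v hv h1 h2
    have hv' := (memS' v).1 hv
    refine ⟨(memS' _).2 ⟨hL.mem v hv'.1, fun e => h1 (hL1 v hv'.1 e), fun e => h2 (hL2 v hv'.1 e)⟩,
      fun e => hv'.2.1 ?_, fun e => hv'.2.2 ?_⟩
    · rw [← hL.invol v hv'.1, e, hLa]
    · rw [← hL.invol v hv'.1, e, hLb]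
  have nn := fun v (hv : v ∈ S) w (hw : w ∈ S) => hL.nest v hv w hw
  have hordI := hsame a haS hai hLi
  have hordB := hsame b hbS hbi hbk
  have hordAB := hpos a haS b hbS hab
  have niak := nn i hi k hkS
  have naik := nn a haS k hkS
  have nkib := nn k hkS i hi
  have nbki := nn b hbS i hi
  rw [← ha, ← hb] at niak
  rw [hLa, ← hb] at naik
  rw [← hb, ← ha] at nkib
  rw [hLb, ← ha] at nbki
  have niab := nn i hi b hbS
  have nkba := nn k hkS a haS
  have naib := nn a haS b hbS
  have nbka := nn b hbS a haS
  rw [← ha, hLb] at niab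
  rw [← hb, hLa] at nkba
  rw [hLa, hLb] at naib
  rw [hLb, hLa] at nbka
  have hnest' : Pairing pos S' L' := by
    refine ⟨?_, ?_, ?_, ?_⟩
    · intro v hv
      by_cases h1 : v = a
      · rwa [h1, hL'a]
      by_cases h2 : v = b
      · rwa [h2, hL'b]
      rw [hL'v v h1 h2]
      exact (hLout v hv h1 h2).1
    · intro v hv
      by_cases h1 : v = a
      · rw [h1, hL'a]
        exact hab.symm
      by_cases h2 : v = b
      · rwa [h2, hL'b]
      rw [hL'v v h1 h2]
      exact hL.ne v ((memS' v).1 hv).1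
    · intro v hv
      by_cases h1 : v = a
      · rw [h1, hL'a, hL'b]
      by_cases h2 : v = b
      · rw [h2, hL'b, hL'a]
      have := hLout v hv h1 h2
      rw [hL'v v h1 h2, hL'v _ this.2.1 this.2.2, hL.invol v ((memS' v).1 hv).1]
    · intro v hv w hw
      have hv0 := (memS' v).1 hv
      have hw0 := (memS' w).1 hw
      have hsv := hsame v hv0.1 hv0.2.1 hv0.2.2
      have hsw := hsame w hw0.1 hw0.2.1 hw0.2.2
      -- An old arc encloses both ends of another old arc or neither. Applied to the arcs `a`–`i`
      -- and `k`–`b`, with `i`, `k` adjacent, this shows that it encloses both ends of the spliced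
      -- arc or neither.
      have key : ∀ u ∈ S', u ≠ a → u ≠ b → ∀ x ∈ S, ∀ y ∈ S, L x = y →
          x ≠ u → y ≠ u →
          pos u < pos (L u) → (pos u < pos x ∧ pos x < pos (L u) ↔
            pos u < pos y ∧ pos y < pos (L u)) := by
        intro u hu h1 h2 x hx y hy hxy _ _ hlt
        have h3 := nn u ((memS' u).1 hu).1 x hx
        have h4 := nn u ((memS' u).1 hu).1 y hy
        rw [hxy] at h3
        rw [← hxy, hL.invol x hx, hxy] at h4
        omega
      by_cases h1 : v = a
      · subst h1
        rw [hL'a]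
        by_cases h3 : w = v
        · subst h3
          omega
        by_cases h4 : w = b
        · subst h4
          omega
        rw [hL'v w h3 h4]
        have hw1 := hLout w hw h3 h4
        have hw2 := (memS' _).1 hw1.1
        have hsLw := hsame _ hw2.1 hw2.2.1 hw2.2.2
        have e1 := hpos _ hw2.1 v haS hw1.2.1
        have e2 := hpos _ hw2.1 b hbS hw1.2.2
        have e3 := hpos w hw0.1 v haS h3
        have e4 := hpos w hw0.1 b hbS h4
        have n1 := nn i hi w hw0.1
        have n2 := nn v haS w hw0.1
        have n3 := nn k hkS w hw0.1
        have n4 := nn b hbS w hw0.1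
        have n5 := nn w hw0.1 i hi
        have n6 := nn w hw0.1 v haS
        have n7 := nn w hw0.1 k hkS
        have n8 := nn w hw0.1 b hbS
        rw [← ha] at n1 n5
        rw [hLa] at n2 n6
        rw [← hb] at n3 n7
        rw [hLb] at n4 n8
        have n9 := nn _ hw2.1 i hi
        have n10 := nn _ hw2.1 v haS
        have n11 := nn _ hw2.1 k hkS
        have n12 := nn _ hw2.1 b hbS
        rw [hL.invol w hw0.1] at n9 n10 n11 n12
        rw [← ha] at n9
        rw [hLa] at n10
        rw [← hb] at n11
        rw [hLb] at n12
        omega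
      by_cases h2 : v = b
      · subst h2
        rw [hL'b]
        by_cases h3 : w = a
        · subst h3
          omega
        by_cases h4 : w = v
        · subst h4
          omega
        rw [hL'v w h3 h4]
        have hw1 := hLout w hw h3 h4
        have hw2 := (memS' _).1 hw1.1
        have hsLw := hsame _ hw2.1 hw2.2.1 hw2.2.2
        have e1 := hpos _ hw2.1 a haS hw1.2.1
        have e2 := hpos _ hw2.1 v hbS hw1.2.2
        have e3 := hpos w hw0.1 a haS h3
        have e4 := hpos w hw0.1 v hbS h4
        have n1 := nn i hi w hw0.1
        have n2 := nn a haS w hw0.1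
        have n3 := nn k hkS w hw0.1
        have n4 := nn v hbS w hw0.1
        have n5 := nn w hw0.1 i hi
        have n6 := nn w hw0.1 a haS
        have n7 := nn w hw0.1 k hkS
        have n8 := nn w hw0.1 v hbS
        rw [← ha] at n1 n5
        rw [hLa] at n2 n6
        rw [← hb] at n3 n7
        rw [hLb] at n4 n8
        have n9 := nn _ hw2.1 i hi
        have n10 := nn _ hw2.1 a haS
        have n11 := nn _ hw2.1 k hkS
        have n12 := nn _ hw2.1 v hbS
        rw [hL.invol w hw0.1] at n9 n10 n11 n12
        rw [← ha] at n9
        rw [hLa] at n10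
        rw [← hb] at n11
        rw [hLb] at n12
        omega
      rw [hL'v v h1 h2]
      by_cases h3 : w = a
      · subst h3
        rw [hL'a]
        intro g1 g2
        have k1 := key v hv h1 h2 w haS i hi hLa (Ne.symm h1) (Ne.symm hv0.2.1) (by omega)
        have k2 := key v hv h1 h2 k hkS b hbS hb.symm (Ne.symm hv0.2.2) (Ne.symm h2) (by omega)
        have hv2 := (memS' _).1 (hLout v hv h1 h2).1
        have hsLv := hsame _ hv2.1 hv2.2.1 hv2.2.2
        omega
      by_cases h4 : w = b
      · subst h4
        rw [hL'b]
        intro g1 g2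
        have k1 := key v hv h1 h2 a haS i hi hLa (Ne.symm h1) (Ne.symm hv0.2.1) (by omega)
        have k2 := key v hv h1 h2 k hkS w hbS hb.symm (Ne.symm hv0.2.2) (Ne.symm h2) (by omega)
        have hv2 := (memS' _).1 (hLout v hv h1 h2).1
        have hsLv := hsame _ hv2.1 hv2.2.1 hv2.2.2
        omega
      rw [hL'v w h3 h4]
      exact nn v hv0.1 w hw0.1
  have hJ' : Joint S' U L' := by
    intro T hT hTne hTU hTL
    -- A set stable for the spliced meander becomes stable for the old one, after adding `i` and `k`
    -- in case it contains the spliced arc.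
    have hTL2 : a ∈ T ↔ b ∈ T := ⟨fun h => hL'a ▸ hTL a h, fun h => hL'b ▸ hTL b h⟩
    have hTS : T ⊆ S := fun v hv => ((memS' v).1 (hT hv)).1
    by_cases haT : a ∈ T
    · have : insert i (insert k T) = S := by
        refine hJ _ ?_ ⟨i, by simp⟩ ?_ ?_
        · simp [Finset.insert_subset_iff, hi, hkS, hTS]
        · intro v hv
          simp only [Finset.mem_insert] at hv ⊢
          rcases hv with rfl | rfl | hv
          · exact .inr (.inl hk.symm)
          · exact .inl hUk
          · exact .inr (.inr (hTU v hv))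
        · intro v hv
          simp only [Finset.mem_insert] at hv ⊢
          rcases hv with rfl | rfl | hv
          · exact .inr (.inr (ha ▸ haT))
          · exact .inr (.inr (hb ▸ hTL2.1 haT))
          · by_cases h1 : v = a
            · exact .inl (h1 ▸ hLa)
            by_cases h2 : v = b
            · exact .inr (.inl (h2 ▸ hLb))
            · exact .inr (.inr (hL'v v h1 h2 ▸ hTL v hv))
      refine Finset.Subset.antisymm hT fun v hv => ?_
      have hv' := (memS' v).1 hv
      have := hv'.1
      rw [← ‹_ = S›] at this
      simpa [hv'.2.1, hv'.2.2] using this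
    · have : T = S := by
        refine hJ _ hTS hTne hTU fun v hv => ?_
        have h1 : v ≠ a := fun e => haT (e ▸ hv)
        have h2 : v ≠ b := fun e => haT (hTL2.2 (e ▸ hv))
        exact hL'v v h1 h2 ▸ hTL v hv
      exact absurd (this ▸ haS) haT
  have hcard : S'.card < n := by
    rw [← hn]
    refine Finset.card_lt_card ⟨fun v hv => ((memS' v).1 hv).1, fun h => ?_⟩
    exact ((memS' i).1 (h hi)).2.1 rfl
  have hS'S : (S' : Set V) ⊆ S := fun v hv => ((memS' v).1 hv).1
  have hrec := ih _ hcard (L := L') rfl (hinj.mono hS'S) ⟨a, haS'⟩ hU' hnest' hJ'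
  rw [Finset.sum_congr rfl fun v hv => by rw [halt v hv]] at hrec
  rw [← hrec]
  have hdiff : ∑ v ∈ S', altSign pos S v *
        (Int.sign (pos (U v) - pos v) + Int.sign (pos (L v) - pos v)) -
      ∑ v ∈ S', altSign pos S v *
        (Int.sign (pos (U v) - pos v) + Int.sign (pos (L' v) - pos v)) =
      altSign pos S a * (Int.sign (pos i - pos a) - Int.sign (pos b - pos a)) +
      altSign pos S b * (Int.sign (pos k - pos b) - Int.sign (pos a - pos b)) := by
    rw [← Finset.sum_sub_distrib]
    have : ({a, b} : Finset V) ⊆ S' := by simp [Finset.insert_subset_iff, haS', hbS']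
    rw [← Finset.sum_subset this, Finset.sum_pair hab, hL'a, hL'b, hLa, hLb]
    · ring
    · intro v _ hv
      simp only [Finset.mem_insert, Finset.mem_singleton, not_or] at hv
      rw [hL'v v hv.1 hv.2]
      ring
  have hsplit : ∑ v ∈ S, altSign pos S v *
        (Int.sign (pos (U v) - pos v) + Int.sign (pos (L v) - pos v)) =
      altSign pos S i * (Int.sign (pos k - pos i) + Int.sign (pos a - pos i)) +
      (altSign pos S k * (Int.sign (pos i - pos k) + Int.sign (pos b - pos k)) +
      ∑ v ∈ S', altSign pos S v *
        (Int.sign (pos (U v) - pos v) + Int.sign (pos (L v) - pos v))) := by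
    conv_lhs => rw [hSS]
    rw [Finset.sum_insert hi', Finset.sum_insert hk', ← hSS, ← hk, hUk, ← ha, ← hb]
  rw [hsplit]
  have e1 := sign_sub_of_lt hik
  rw [hsk, hsi, hsb] at *
  rw [e1.1, e1.2]
  -- Non-crossing leaves three orders of the positions: `a < i < k < b`, `b < a < i < k` and `i < k
  -- < b < a`. In each of them the removed contributions cancel against the change at `a` and `b`.
  rcases hordI with hI | hI <;> rcases hordB with hB | hB <;> rcases hordAB with hA | hA
  all_goals first
    | omega
    | (have s1 := sign_sub_of_lt hI.1
       have s2 := sign_sub_of_lt hB.2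
       have s3 := sign_sub_of_lt hA
       simp only [s1.1, s1.2, s2.1, s2.2, s3.1, s3.2] at hdiff ⊢
       linarith)

/-! ## Non-crossing arcs -/

/-- The arcs in `s` are pairwise disjoint. -/
structure NonCrossing (s : Set (ℤ × ℤ)) : Prop where
  lt : ∀ p ∈ s, p.1 < p.2
  apart : ∀ p ∈ s, ∀ q ∈ s, p ≠ q →
    p.2 < q.1 ∨ q.2 < p.1 ∨ (p.1 < q.1 ∧ q.2 < p.2) ∨ (q.1 < p.1 ∧ p.2 < q.2)

/-- The other end of the arc in `s` that ends at `i`, or `i` itself if there is none. -/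
def mate (s : Set (ℤ × ℤ)) (i : ℤ) : ℤ :=
  if h : ∃ j, (i, j) ∈ s ∨ (j, i) ∈ s then h.choose else i

theorem isEnd_fst {s : Set (ℤ × ℤ)} {p : ℤ × ℤ} (hp : p ∈ s) : IsEnd s p.1 := ⟨p, hp, .inl rfl⟩

theorem isEnd_snd {s : Set (ℤ × ℤ)} {p : ℤ × ℤ} (hp : p ∈ s) : IsEnd s p.2 := ⟨p, hp, .inr rfl⟩

theorem mate_of_not_isEnd {s : Set (ℤ × ℤ)} {i : ℤ} (h : ¬ IsEnd s i) : mate s i = i := by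
  rw [mate, dif_neg]
  rintro ⟨j, hj | hj⟩
  · exact h (isEnd_fst hj)
  · exact h (isEnd_snd hj)

namespace NonCrossing

variable {s : Set (ℤ × ℤ)} (h : NonCrossing s)
include h

theorem eq_of_end {p q : ℤ × ℤ} (hp : p ∈ s) (hq : q ∈ s) {i : ℤ} (hi : i = p.1 ∨ i = p.2)
    (hi' : i = q.1 ∨ i = q.2) : p = q := by
  by_contra hne
  have h1 := h.apart p hp q hq hne
  have h2 := h.lt p hp
  have h3 := h.lt q hq
  omega

theorem mate_fst {p : ℤ × ℤ} (hp : p ∈ s) : mate s p.1 = p.2 := by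
  have hex : ∃ j, (p.1, j) ∈ s ∨ (j, p.1) ∈ s := ⟨p.2, .inl hp⟩
  rw [mate, dif_pos hex]
  rcases hex.choose_spec with h1 | h1
  · exact (congrArg Prod.snd (h.eq_of_end hp h1 (.inl rfl) (.inl rfl))).symm
  · have h2 := h.eq_of_end hp h1 (.inl rfl) (.inr rfl)
    have h3 := h.lt _ h1
    have h4 := congrArg Prod.fst h2
    simp only at h3 h4
    omega

theorem mate_snd {p : ℤ × ℤ} (hp : p ∈ s) : mate s p.2 = p.1 := by
  have hex : ∃ j, (p.2, j) ∈ s ∨ (j, p.2) ∈ s := ⟨p.1, .inr hp⟩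
  rw [mate, dif_pos hex]
  rcases hex.choose_spec with h1 | h1
  · have h2 := h.eq_of_end hp h1 (.inr rfl) (.inl rfl)
    have h3 := h.lt _ h1
    have h4 := congrArg Prod.snd h2
    simp only at h3 h4
    omega
  · exact (congrArg Prod.fst (h.eq_of_end hp h1 (.inr rfl) (.inr rfl))).symm

theorem mate_mate (i : ℤ) : mate s (mate s i) = i := by
  by_cases hi : IsEnd s i
  · obtain ⟨p, hp, rfl | rfl⟩ := hi
    · rw [h.mate_fst hp, h.mate_snd hp]
    · rw [h.mate_snd hp, h.mate_fst hp]
  · rw [mate_of_not_isEnd hi, mate_of_not_isEnd hi]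

theorem mate_ne {i : ℤ} (hi : IsEnd s i) : mate s i ≠ i := by
  obtain ⟨p, hp, rfl | rfl⟩ := hi
  · rw [h.mate_fst hp]
    exact (h.lt p hp).ne'
  · rw [h.mate_snd hp]
    exact (h.lt p hp).ne

theorem isEnd_mate {i : ℤ} (hi : IsEnd s i) : IsEnd s (mate s i) := by
  obtain ⟨p, hp, rfl | rfl⟩ := hi
  · rw [h.mate_fst hp]
    exact isEnd_snd hp
  · rw [h.mate_snd hp]
    exact isEnd_fst hp

theorem arc_mem {i : ℤ} (hi : IsEnd s i) : (i, mate s i) ∈ s ∨ (mate s i, i) ∈ s := by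
  obtain ⟨p, hp, rfl | rfl⟩ := hi
  · rw [h.mate_fst hp]
    exact .inl hp
  · rw [h.mate_snd hp]
    exact .inr hp

theorem arc_mem_of_lt {i : ℤ} (hi : i < mate s i) : (i, mate s i) ∈ s := by
  have : IsEnd s i := by
    by_contra hc
    rw [mate_of_not_isEnd hc] at hi
    exact lt_irrefl _ hi
  rcases h.arc_mem this with h1 | h1
  · exact h1
  · exact absurd (h.lt _ h1) (not_lt_of_gt hi)

theorem mate_nest {i j : ℤ} (hj : IsEnd s j) (h1 : i < j) (h2 : j < mate s i) :
    i < mate s j ∧ mate s j < mate s i := by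
  have hp := h.arc_mem_of_lt (h1.trans h2)
  obtain ⟨q, hq, hjq⟩ := hj
  have hpq : (i, mate s i) ≠ q := by
    rintro rfl
    simp only at hjq
    omega
  have h3 := h.apart _ hp _ hq hpq
  have h4 := h.lt _ hq
  simp only at h3
  rcases hjq with rfl | rfl
  · rw [h.mate_fst hq]
    omega
  · rw [h.mate_snd hq]
    omega

/-- A sum over the ends of arcs, as a sum over arcs. -/
theorem sum_sign {t : Finset (ℤ × ℤ)} (ht : (t : Set (ℤ × ℤ)) = s) {P : Finset ℤ}
    (hP : ∀ i, IsEnd s i → i ∈ P) (f : ℤ → ℤ) (hf : ∀ p ∈ s, f p.2 = -f p.1) :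
    ∑ i ∈ P, f i * Int.sign (mate s i - i) = 2 * ∑ p ∈ t, f p.1 := by
  have h1 : ∀ i, f i * Int.sign (mate s i - i) =
      (if i < mate s i then f i else 0) - (if mate s i < i then f i else 0) := by
    intro i
    rcases lt_trichotomy i (mate s i) with hi | hi | hi
    · rw [if_pos hi, if_neg hi.not_gt, (sign_sub_of_lt hi).1]
      ring
    · rw [← hi]
      simp
    · rw [if_pos hi, if_neg hi.not_gt, (sign_sub_of_lt hi).2]
      ring
  have mem : ∀ p, p ∈ t ↔ p ∈ s := fun p => by rw [← ht, Finset.mem_coe]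
  have h2 : P.filter (fun i => i < mate s i) = t.image Prod.fst := by
    ext i
    rw [Finset.mem_filter, Finset.mem_image]
    constructor
    · rintro ⟨_, hi⟩
      exact ⟨_, (mem _).2 (h.arc_mem_of_lt hi), rfl⟩
    · rintro ⟨p, hp, rfl⟩
      rw [mem] at hp
      refine ⟨hP _ (isEnd_fst hp), ?_⟩
      rw [h.mate_fst hp]
      exact h.lt p hp
  have h3 : P.filter (fun i => mate s i < i) = t.image Prod.snd := by
    ext i
    rw [Finset.mem_filter, Finset.mem_image]
    constructor
    · rintro ⟨_, hi⟩
      have := h.arc_mem_of_lt (i := mate s i) (by rwa [h.mate_mate])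
      rw [h.mate_mate] at this
      exact ⟨_, (mem _).2 this, rfl⟩
    · rintro ⟨p, hp, rfl⟩
      rw [mem] at hp
      refine ⟨hP _ (isEnd_snd hp), ?_⟩
      rw [h.mate_snd hp]
      exact h.lt p hp
  rw [Finset.sum_congr rfl fun i _ => h1 i, Finset.sum_sub_distrib, ← Finset.sum_filter,
    ← Finset.sum_filter, h2, h3, Finset.sum_image, Finset.sum_image,
    Finset.sum_congr (rfl : t = t) fun p hp => hf p ((mem p).1 hp), Finset.sum_neg_distrib]
  · ring
  · intro p hp q hq e
    exact h.eq_of_end ((mem p).1 hp) ((mem q).1 hq) (.inr rfl) (.inr e)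
  · intro p hp q hq e
    exact h.eq_of_end ((mem p).1 hp) ((mem q).1 hq) (.inl rfl) (.inl e)

end NonCrossing

/-! ## Stacked diagrams -/

/-- The arcs `a`, `m`, `d` form a stacked diagram on the vertices in `P`, without intersections. -/
structure IsStack (P : Finset ℤ) (a m d : Set (ℤ × ℤ)) : Prop where
  cups : NonCrossing a
  middle : NonCrossing m
  caps : NonCrossing d
  cup_end : ∀ i, IsEnd a i ↔ i ∈ P
  cap_end : ∀ i, IsEnd d i ↔ i ∈ P
  middle_end : ∀ i, IsEnd m i → i ∈ P
  inner : ∀ q ∈ m, ∀ i ∈ P, q.1 < i → i < q.2 → IsEnd m i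

/-- The vertex to which `v` is joined by a cup at the bottom or a cap at the top. -/
def outer (a d : Set (ℤ × ℤ)) (v : ℤ × Bool) : ℤ × Bool :=
  (if v.2 then mate d v.1 else mate a v.1, v.2)

/-- The vertex to which `v` is joined in the middle section. -/
def cross (m : Set (ℤ × ℤ)) (v : ℤ × Bool) : ℤ × Bool :=
  (mate m v.1, if IsEnd m v.1 then v.2 else !v.2)

/-- The position of `v` on a single line, after rotating the top line. -/
def place (R : ℤ) (v : ℤ × Bool) : ℤ := if v.2 then R - v.1 else v.1

/-- The vertices of a stacked diagram. -/
abbrev verts (P : Finset ℤ) : Finset (ℤ × Bool) := P ×ˢ Finset.univ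

theorem mem_verts {P : Finset ℤ} {v : ℤ × Bool} : v ∈ verts P ↔ v.1 ∈ P := by
  simp

/-- With such an `R`, the rotated top line lies entirely to the right of the bottom line, so that
the whole stack can be viewed as a meander on a single line. -/
theorem exists_width (P : Finset ℤ) : ∃ R : ℤ, ∀ i ∈ P, ∀ j ∈ P, i + j < R := by
  obtain ⟨B, hB⟩ := P.bddAbove
  refine ⟨2 * B + 1, fun i hi j hj => ?_⟩
  have := hB hi
  have := hB hj
  omega

theorem place_injOn {P : Finset ℤ} {R : ℤ} (hR : ∀ i ∈ P, ∀ j ∈ P, i + j < R) :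
    Set.InjOn (place R) (verts P) := by
  rintro ⟨i, b⟩ hi ⟨j, c⟩ hj h
  rw [Finset.mem_coe, mem_verts] at hi hj
  have := hR i hi j hj
  cases b <;> cases c <;> simp [place] at h ⊢ <;> omega

theorem Pairing.mono {V : Type*} {pos : V → ℤ} {S T : Finset V} {U : V → V}
    (h : Pairing pos S U) (hTS : T ⊆ S) (hT : ∀ v ∈ T, U v ∈ T) : Pairing pos T U :=
  ⟨hT, fun v hv => h.ne v (hTS hv), fun v hv => h.invol v (hTS hv),
    fun v hv w hw => h.nest v (hTS hv) w (hTS hw)⟩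

namespace IsStack

variable {P : Finset ℤ} {a m d : Set (ℤ × ℤ)} (h : IsStack P a m d)
include h

theorem mate_cups {i : ℤ} (hi : i ∈ P) : mate a i ∈ P :=
  (h.cup_end _).1 (h.cups.isEnd_mate ((h.cup_end i).2 hi))

theorem mate_caps {i : ℤ} (hi : i ∈ P) : mate d i ∈ P :=
  (h.cap_end _).1 (h.caps.isEnd_mate ((h.cap_end i).2 hi))

theorem mate_middle {i : ℤ} (hi : i ∈ P) : mate m i ∈ P := by
  by_cases he : IsEnd m i
  · exact h.middle_end _ (h.middle.isEnd_mate he)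
  · rwa [mate_of_not_isEnd he]

/-- A half-turn of the top line carries the caps above it to the side on which the bottom cups lie,
in a disjoint range of positions. -/
theorem pairing_outer {R : ℤ} (hR : ∀ i ∈ P, ∀ j ∈ P, i + j < R) :
    Pairing (place R) (verts P) (outer a d) := by
  refine ⟨?_, ?_, ?_, ?_⟩
  · rintro ⟨i, b⟩ hi
    rw [mem_verts] at hi ⊢
    cases b
    · exact h.mate_cups hi
    · exact h.mate_caps hi
  · rintro ⟨i, b⟩ hi
    rw [mem_verts] at hi
    cases b <;> simp only [outer, ne_eq, Prod.mk.injEq, and_true]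
    · exact h.cups.mate_ne ((h.cup_end i).2 hi)
    · exact h.caps.mate_ne ((h.cap_end i).2 hi)
  · rintro ⟨i, b⟩ hi
    cases b <;> simp [outer, h.cups.mate_mate, h.caps.mate_mate]
  · rintro ⟨i, b⟩ hi ⟨j, c⟩ hj
    rw [mem_verts] at hi hj
    simp only at hi hj
    have h1 := hR i hi j hj
    have h2 := hR _ (h.mate_cups hi) j hj
    have h3 := hR _ (h.mate_caps hi) j hj
    cases b <;> cases c <;> simp only [outer, place, if_true, if_false, Bool.false_eq_true]
    · exact h.cups.mate_nest ((h.cup_end j).2 hj)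
    · omega
    · omega
    · intro h4 h5
      have := h.caps.mate_nest (i := mate d i) ((h.cap_end j).2 hj) (by omega)
        (by rw [h.caps.mate_mate]; omega)
      rw [h.caps.mate_mate] at this
      omega

/-- After the half-turn, vertical segments become concentric arcs from `i` to `R - i`. They do not
meet the middle arcs because no vertex without a middle arc lies under one (`IsStack.inner`). -/
theorem pairing_cross {R : ℤ} (hR : ∀ i ∈ P, ∀ j ∈ P, i + j < R) :
    Pairing (place R) (verts P) (cross m) := by
  refine ⟨?_, ?_, ?_, ?_⟩
  · rintro ⟨i, b⟩ hi
    rw [mem_verts] at hi ⊢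
    exact h.mate_middle hi
  · rintro ⟨i, b⟩ hi he
    rw [cross, Prod.mk.injEq] at he
    by_cases hm : IsEnd m i
    · exact h.middle.mate_ne hm he.1
    · simp [hm] at he
  · rintro ⟨i, b⟩ hi
    by_cases hm : IsEnd m i
    · simp [cross, hm, h.middle.isEnd_mate hm, h.middle.mate_mate]
    · simp [cross, hm, mate_of_not_isEnd hm]
  · rintro ⟨i, b⟩ hi ⟨j, c⟩ hj
    rw [mem_verts] at hi hj
    simp only at hi hj
    have h1 := hR i hi j hj
    have h2 := hR _ (h.mate_middle hi) j hj
    have h3 := hR _ (h.mate_middle hi) _ (h.mate_middle hj)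
    have h4 := hR i hi _ (h.mate_middle hj)
    have hin : ∀ i j, j ∈ P → i < j → j < mate m i → IsEnd m j := fun i j hj h5 h6 =>
      h.inner _ (h.middle.arc_mem_of_lt (h5.trans h6)) j hj h5 h6
    have hin1 := hin i j hj
    have hin2 := hin (mate m i) j hj
    have hin3 := hin j i hi
    have hin4 := hin (mate m j) i hi
    rw [h.middle.mate_mate] at hin2 hin4
    have hne1 := fun hj => h.middle.mate_nest (i := i) (j := j) hj
    have hne2 := fun hj => h.middle.mate_nest (i := mate m i) (j := j) hj
    rw [h.middle.mate_mate] at hne2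
    have hx1 : IsEnd m j → mate m j = i → IsEnd m i := fun h1 e => e ▸ h.middle.isEnd_mate h1
    have hx2 : IsEnd m i → mate m i = j → IsEnd m j := fun h1 e => e ▸ h.middle.isEnd_mate h1
    by_cases hmi : IsEnd m i <;> by_cases hmj : IsEnd m j <;> cases b <;> cases c <;>
      simp only [cross, place, hmi, hmj, if_true, if_false, Bool.false_eq_true, Bool.not_true,
        Bool.not_false, true_implies, imp_false, mate_of_not_isEnd, not_false_eq_true]
        at * <;> omega

/-- The two involutions list all edges at a vertex, so connectedness in the graph can be tested by
stability under `outer` and `cross`. -/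
theorem adj_iff {v w : ℤ × Bool} (hv : v ∈ verts P) :
    (stack a m d).Adj v w ↔ w = outer a d v ∨ w = cross m v := by
  obtain ⟨R, hR⟩ := exists_width P
  have hno := (h.pairing_outer hR).ne v hv
  have hnc := (h.pairing_cross hR).ne v hv
  rw [mem_verts] at hv
  obtain ⟨i, b⟩ := v
  obtain ⟨j, c⟩ := w
  simp only at hv
  have hm : ∀ {s : Set (ℤ × ℤ)}, NonCrossing s → ((i, j) ∈ s ∨ (j, i) ∈ s ↔
      IsEnd s i ∧ j = mate s i) := by
    intro s hs
    constructor
    · rintro (h1 | h1)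
      · exact ⟨isEnd_fst h1, (hs.mate_fst h1).symm⟩
      · exact ⟨isEnd_snd h1, (hs.mate_snd h1).symm⟩
    · rintro ⟨h1, rfl⟩
      exact hs.arc_mem h1
  have ha := hm h.cups
  have hmm := hm h.middle
  have hd := hm h.caps
  rw [h.cup_end] at ha
  rw [h.cap_end] at hd
  have hij : j = i → (IsEnd m j ↔ IsEnd m i) := fun e => e ▸ Iff.rfl
  rw [stack, SimpleGraph.fromRel_adj]
  constructor
  · rintro ⟨hne, hr⟩
    by_cases he : IsEnd m i
    · cases b <;> cases c <;> simp only [outer, cross, Set.mem_union, Prod.mk.injEq, he] at * <;>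
        grind
    · cases b <;> cases c <;>
        simp only [outer, cross, Set.mem_union, Prod.mk.injEq, he, mate_of_not_isEnd he] at * <;>
        grind
  · rintro (hw | hw)
    · refine ⟨fun e => hno (hw ▸ e.symm), ?_⟩
      cases b <;> cases c <;> simp only [outer, Set.mem_union, Prod.mk.injEq] at * <;> grind
    · refine ⟨fun e => hnc (hw ▸ e.symm), ?_⟩
      by_cases he : IsEnd m i
      · cases b <;> cases c <;> simp only [cross, Set.mem_union, Prod.mk.injEq, he] at * <;>
          grind
      · cases b <;> cases c <;>
          simp only [cross, Set.mem_union, Prod.mk.injEq, he, mate_of_not_isEnd he] at * <;>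
          grind

end IsStack

/-! ## Circles of a stacked diagram -/

/-- The label of `v` as a sign. -/
def mark (O : Finset (ℤ × Bool)) (v : ℤ × Bool) : ℤ := if v ∈ O then 1 else -1

/-- The label of `v` as a sign, after rotating the top line. -/
def turnedMark (O : Finset (ℤ × Bool)) (v : ℤ × Bool) : ℤ := if v.2 then -mark O v else mark O v

/-- The contribution of the vertex `v` to (four times) the turning number. -/
def turn (a m d : Set (ℤ × ℤ)) (O : Finset (ℤ × Bool)) (v : ℤ × Bool) : ℤ :=
  mark O v * (Int.sign ((cross m v).1 - v.1) + Int.sign ((outer a d v).1 - v.1))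

/-- The vertices of the circle through `v`. -/
def circle (P : Finset ℤ) (a m d : Set (ℤ × ℤ)) (v : ℤ × Bool) : Finset (ℤ × Bool) :=
  (verts P).filter fun w => (stack a m d).Reachable v w

theorem circle_subset {P : Finset ℤ} {a m d : Set (ℤ × ℤ)} {v : ℤ × Bool} :
    circle P a m d v ⊆ verts P :=
  Finset.filter_subset _ _

theorem reachable_mem {V : Type*} {G : SimpleGraph V} {T : Set V}
    (hT : ∀ u ∈ T, ∀ w, G.Adj u w → w ∈ T) {u w : V} (hu : u ∈ T) (h : G.Reachable u w) :
    w ∈ T := by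
  obtain ⟨p⟩ := h
  induction p with
  | nil => exact hu
  | cons hadj _ ih => exact ih (hT _ hu _ hadj)

theorem mark_eq_neg {O : Finset (ℤ × Bool)} {v w : ℤ × Bool} (h : v ∈ O ↔ w ∉ O) :
    mark O w = -mark O v := by
  unfold mark
  split_ifs <;> simp_all

theorem mark_congr {O O' : Finset (ℤ × Bool)} {v w : ℤ × Bool} (h : v ∈ O ↔ w ∈ O') :
    mark O v = mark O' w := by
  unfold mark
  simp [h]

theorem sum_eq_zero_of_pairing {V : Type*} {T : Finset V} {f : V → ℤ} {U : V → V}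
    (h1 : ∀ v ∈ T, U v ∈ T) (h2 : ∀ v ∈ T, U v ≠ v) (h3 : ∀ v ∈ T, U (U v) = v)
    (h4 : ∀ v ∈ T, f (U v) = -f v) : ∑ v ∈ T, f v = 0 :=
  Finset.sum_involution (fun v _ => U v) (fun v hv => by rw [h4 v hv]; ring)
    (fun v hv _ => h2 v hv) h1 h3

namespace IsStack

variable {P : Finset ℤ} {a m d : Set (ℤ × ℤ)} (h : IsStack P a m d)
include h

theorem outer_mem {v : ℤ × Bool} (hv : v ∈ verts P) : outer a d v ∈ verts P := by
  obtain ⟨R, hR⟩ := exists_width P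
  exact (h.pairing_outer hR).mem v hv

theorem cross_mem {v : ℤ × Bool} (hv : v ∈ verts P) : cross m v ∈ verts P := by
  obtain ⟨R, hR⟩ := exists_width P
  exact (h.pairing_cross hR).mem v hv

theorem outer_ne {v : ℤ × Bool} (hv : v ∈ verts P) : outer a d v ≠ v := by
  obtain ⟨R, hR⟩ := exists_width P
  exact (h.pairing_outer hR).ne v hv

theorem cross_ne {v : ℤ × Bool} (hv : v ∈ verts P) : cross m v ≠ v := by
  obtain ⟨R, hR⟩ := exists_width P
  exact (h.pairing_cross hR).ne v hv

theorem outer_outer {v : ℤ × Bool} (hv : v ∈ verts P) : outer a d (outer a d v) = v := by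
  obtain ⟨R, hR⟩ := exists_width P
  exact (h.pairing_outer hR).invol v hv

theorem cross_cross {v : ℤ × Bool} (hv : v ∈ verts P) : cross m (cross m v) = v := by
  obtain ⟨R, hR⟩ := exists_width P
  exact (h.pairing_cross hR).invol v hv

theorem adj_outer {v : ℤ × Bool} (hv : v ∈ verts P) : (stack a m d).Adj v (outer a d v) :=
  (h.adj_iff hv).2 (.inl rfl)

theorem adj_cross {v : ℤ × Bool} (hv : v ∈ verts P) : (stack a m d).Adj v (cross m v) :=
  (h.adj_iff hv).2 (.inr rfl)

/-- A set of vertices stable under `outer` and `cross` is a union of circles. -/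
theorem reachable_closed {T : Set (ℤ × Bool)} (hT : ∀ u ∈ T, u ∈ verts P)
    (ho : ∀ u ∈ T, outer a d u ∈ T) (hc : ∀ u ∈ T, cross m u ∈ T) {u w : ℤ × Bool} (hu : u ∈ T)
    (hw : (stack a m d).Reachable u w) : w ∈ T := by
  refine reachable_mem (fun u hu w hadj => ?_) hu hw
  rcases (h.adj_iff (hT u hu)).1 hadj with rfl | rfl
  · exact ho u hu
  · exact hc u hu

theorem reachable_verts {u w : ℤ × Bool} (hu : u ∈ verts P)
    (hw : (stack a m d).Reachable u w) : w ∈ verts P :=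
  h.reachable_closed (T := {v | v ∈ verts P}) (fun _ h => h) (fun _ => h.outer_mem)
    (fun _ => h.cross_mem) hu hw

theorem mem_circle {v w : ℤ × Bool} (hv : v ∈ verts P) :
    w ∈ circle P a m d v ↔ (stack a m d).Reachable v w := by
  rw [circle, Finset.mem_filter]
  exact ⟨fun h' => h'.2, fun h' => ⟨h.reachable_verts hv h', h'⟩⟩

theorem outer_mem_circle {v w : ℤ × Bool} (hv : v ∈ verts P) (hw : w ∈ circle P a m d v) :
    outer a d w ∈ circle P a m d v := by
  have hw' := circle_subset hw
  rw [h.mem_circle hv] at hw ⊢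
  exact hw.trans (h.adj_outer hw').reachable

theorem cross_mem_circle {v w : ℤ × Bool} (hv : v ∈ verts P) (hw : w ∈ circle P a m d v) :
    cross m w ∈ circle P a m d v := by
  have hw' := circle_subset hw
  rw [h.mem_circle hv] at hw ⊢
  exact hw.trans (h.adj_cross hw').reachable

/-- A nonempty part of a connected component that is stable under both involutions is the whole
component. This is the hypothesis under which `turning` applies. -/
theorem joint_circle {v : ℤ × Bool} (hv : v ∈ verts P) :
    Joint (circle P a m d v) (cross m) (outer a d) := by
  rintro T hT ⟨u, hu⟩ hc ho
  refine Finset.Subset.antisymm hT fun w hw => ?_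
  have h1 := (h.mem_circle hv).1 (hT hu)
  have h2 := (h.mem_circle hv).1 hw
  exact h.reachable_closed (T := T) (fun _ h' => circle_subset (hT h')) ho hc hu
    (h1.symm.trans h2)

theorem pairing_circle_outer {R : ℤ} (hR : ∀ i ∈ P, ∀ j ∈ P, i + j < R) {v : ℤ × Bool}
    (hv : v ∈ verts P) : Pairing (place R) (circle P a m d v) (outer a d) :=
  (h.pairing_outer hR).mono circle_subset fun _ => h.outer_mem_circle hv

theorem pairing_circle_cross {R : ℤ} (hR : ∀ i ∈ P, ∀ j ∈ P, i + j < R) {v : ℤ × Bool}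
    (hv : v ∈ verts P) : Pairing (place R) (circle P a m d v) (cross m) :=
  (h.pairing_cross hR).mono circle_subset fun _ => h.cross_mem_circle hv

theorem turning_circle {R : ℤ} (hR : ∀ i ∈ P, ∀ j ∈ P, i + j < R) {v : ℤ × Bool}
    (hv : v ∈ verts P) : ∑ w ∈ circle P a m d v, altSign (place R) (circle P a m d v) w *
      (Int.sign (place R (cross m w) - place R w) +
        Int.sign (place R (outer a d w) - place R w)) = 4 :=
  turning rfl ((place_injOn hR).mono circle_subset)
    ⟨v, (h.mem_circle hv).2 (SimpleGraph.Reachable.refl _)⟩ (h.pairing_circle_cross hR hv)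
    (h.pairing_circle_outer hR hv) (h.joint_circle hv)

theorem exists_leftmost {v : ℤ × Bool} (hv : v ∈ verts P) :
    ∃ w ∈ circle P a m d v, ∀ u ∈ circle P a m d v, w.1 ≤ u.1 :=
  Finset.exists_min_image _ Prod.fst ⟨v, (h.mem_circle hv).2 (SimpleGraph.Reachable.refl _)⟩

variable {O : Finset (ℤ × Bool)} (hO : IsOrientation a m d O)
include hO

theorem mark_outer {v : ℤ × Bool} (hv : v ∈ verts P) :
    mark O (outer a d v) = -mark O v := by
  obtain ⟨i, b⟩ := v
  rw [mem_verts] at hv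
  cases b
  · obtain ⟨p, hp, rfl | rfl⟩ := (h.cup_end i).2 hv
    · simp only [outer, Bool.false_eq_true, if_false, h.cups.mate_fst hp]
      exact mark_eq_neg (hO.1 p (.inl hp))
    · simp only [outer, Bool.false_eq_true, if_false, h.cups.mate_snd hp]
      rw [mark_eq_neg (hO.1 p (.inl hp)), neg_neg]
  · obtain ⟨p, hp, rfl | rfl⟩ := (h.cap_end i).2 hv
    · simp only [outer, if_true, h.caps.mate_fst hp]
      exact mark_eq_neg (hO.2.1 p (.inl hp))
    · simp only [outer, if_true, h.caps.mate_snd hp]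
      rw [mark_eq_neg (hO.2.1 p (.inl hp)), neg_neg]

theorem mark_cross {v : ℤ × Bool} :
    mark O (cross m v) = if IsEnd m v.1 then -mark O v else mark O v := by
  obtain ⟨i, b⟩ := v
  by_cases he : IsEnd m i
  · simp only [he, cross, if_true]
    obtain ⟨p, hp, rfl | rfl⟩ := he
    · rw [h.middle.mate_fst hp]
      cases b
      · exact mark_eq_neg (hO.1 p (.inr hp))
      · exact mark_eq_neg (hO.2.1 p (.inr hp))
    · rw [h.middle.mate_snd hp]
      cases b
      · rw [mark_eq_neg (hO.1 p (.inr hp)), neg_neg]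
      · rw [mark_eq_neg (hO.2.1 p (.inr hp)), neg_neg]
  · simp only [he, cross, if_false, mate_of_not_isEnd he]
    have := hO.2.2 i he
    cases b
    · exact mark_congr this.symm
    · exact mark_congr this

theorem turnedMark_outer {v : ℤ × Bool} (hv : v ∈ verts P) :
    turnedMark O (outer a d v) = -turnedMark O v := by
  have := h.mark_outer hO hv
  unfold turnedMark
  have h2 : (outer a d v).2 = v.2 := rfl
  rw [h2, this]
  split_ifs <;> rfl

theorem turnedMark_cross {v : ℤ × Bool} :
    turnedMark O (cross m v) = -turnedMark O v := by
  have := h.mark_cross hO (v := v)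
  unfold turnedMark
  rw [this]
  obtain ⟨i, b⟩ := v
  by_cases he : IsEnd m i
  · simp only [cross, he, if_true]
    split_ifs <;> rfl
  · cases b <;> simp [cross, he]

/-- Both `turnedMark` and `altSign` change sign along every edge, vertical segments included, so
they are proportional on a connected circle. -/
theorem turnedMark_eq {R : ℤ} (hR : ∀ i ∈ P, ∀ j ∈ P, i + j < R) {v w : ℤ × Bool}
    (hv : v ∈ verts P) (hw : w ∈ circle P a m d v) :
    turnedMark O w = turnedMark O v * altSign (place R) (circle P a m d v) v *
      altSign (place R) (circle P a m d v) w := by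
  have hsq : ∀ u, altSign (place R) (circle P a m d v) u *
      altSign (place R) (circle P a m d v) u = 1 := by
    intro u
    rw [altSign, ← Finset.prod_mul_distrib]
    refine Finset.prod_eq_one fun x _ => ?_
    split_ifs <;> rfl
  have hinj : Set.InjOn (place R) (circle P a m d v) := (place_injOn hR).mono circle_subset
  have := h.reachable_closed (T := {w | w ∈ circle P a m d v ∧
    turnedMark O w = turnedMark O v * altSign (place R) (circle P a m d v) v *
      altSign (place R) (circle P a m d v) w}) (fun u hu => circle_subset hu.1) ?_ ?_
      (u := v) ⟨(h.mem_circle hv).2 (SimpleGraph.Reachable.refl _), ?_⟩ ((h.mem_circle hv).1 hw)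
  · exact this.2
  · rintro u ⟨hu, he⟩
    refine ⟨h.outer_mem_circle hv hu, ?_⟩
    rw [h.turnedMark_outer hO (circle_subset hu), he,
      (h.pairing_circle_outer hR hv).altSign_apply hinj hu]
    ring
  · rintro u ⟨hu, he⟩
    refine ⟨h.cross_mem_circle hv hu, ?_⟩
    rw [h.turnedMark_cross hO, he, (h.pairing_circle_cross hR hv).altSign_apply hinj hu]
    ring
  · rw [mul_assoc, hsq, mul_one]

/-- All leftmost vertices of a circle have the same label, which determines the turning number. -/
theorem mark_leftmost {R : ℤ} (hR : ∀ i ∈ P, ∀ j ∈ P, i + j < R) {v w : ℤ × Bool}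
    (hv : v ∈ verts P) (hw : w ∈ circle P a m d v)
    (hmin : ∀ u ∈ circle P a m d v, w.1 ≤ u.1) :
    mark O w = turnedMark O v * altSign (place R) (circle P a m d v) v := by
  have key := h.turnedMark_eq hO hR hv hw
  have hw' := circle_subset hw
  obtain ⟨i, b⟩ := w
  cases b
  -- A leftmost vertex on the bottom line comes first on the single line.
  · have : altSign (place R) (circle P a m d v) (i, false) = 1 := by
      refine Finset.prod_eq_one fun u hu => if_neg ?_
      have h1 := hmin u hu
      have h2 := circle_subset hu
      rw [mem_verts] at h2 hw'
      have := hR _ hw' _ h2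
      obtain ⟨j, c⟩ := u
      cases c <;> simp [place] at * <;> omega
    rw [this, mul_one] at key
    rw [← key]
    rfl
  -- A leftmost vertex on the top line comes last after the half-turn, preceded by an odd number of
  -- vertices. This sign and the one in `turnedMark` cancel.
  · have : altSign (place R) (circle P a m d v) (i, true) = -1 := by
      rw [altSign, ← Finset.mul_prod_erase _ _ hw, if_neg (lt_irrefl _), one_mul]
      have h3 : ∀ u ∈ (circle P a m d v).erase (i, true),
          (if place R u < place R (i, true) then (-1 : ℤ) else 1) = -1 := by
        intro u hu
        rw [Finset.mem_erase] at hu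
        refine if_pos ?_
        have h1 := hmin u hu.2
        have h2 := circle_subset hu.2
        rw [mem_verts] at h2 hw'
        have := hR _ hw' _ h2
        obtain ⟨j, c⟩ := u
        cases c <;> simp [place] at * <;> omega
      rw [Finset.prod_congr rfl h3]
      have h4 := (h.pairing_circle_outer hR hv).even_card
      rw [← Finset.mul_prod_erase _ _ hw] at h4
      omega
    rw [this] at key
    have h5 : turnedMark O (i, true) = -mark O (i, true) := rfl
    rw [h5] at key
    linarith

/-- A circle may have leftmost vertices on both lines. Since these carry equal labels, the type of
the circle can be read off at any one of them. -/
theorem clockwise_iff {v w : ℤ × Bool} (hv : v ∈ verts P)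
    (hw : w ∈ circle P a m d v) (hmin : ∀ u ∈ circle P a m d v, w.1 ≤ u.1) :
    Clockwise (stack a m d) O v ↔ w ∈ O := by
  obtain ⟨R, hR⟩ := exists_width P
  constructor
  · rintro ⟨w', h1, h2, h3⟩
    have e1 := h.mark_leftmost hO hR hv hw hmin
    have e2 := h.mark_leftmost hO hR hv ((h.mem_circle hv).2 h1)
      fun u hu => h2 u ((h.mem_circle hv).1 hu)
    rw [← e2, mark, mark, if_pos h3] at e1
    by_contra hc
    rw [if_neg hc] at e1
    norm_num at e1
  · exact fun hwO => ⟨w, (h.mem_circle hv).1 hw,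
      fun u hu => hmin u ((h.mem_circle hv).2 hu), hwO⟩

/-- By `turning_circle`, the sum on the single line is `4` times the mark of a leftmost vertex. It
differs from the sum of `turn` only in the vertical segments, which have a direction after the
half-turn but none before it; their contributions cancel. -/
theorem sum_turn_circle {v : ℤ × Bool} (hv : v ∈ verts P) :
    ∑ w ∈ circle P a m d v, turn a m d O w =
      if Clockwise (stack a m d) O v then 4 else -4 := by
  obtain ⟨R, hR⟩ := exists_width P
  obtain ⟨w, hw, hmin⟩ := h.exists_leftmost hv
  have e := h.mark_leftmost hO hR hv hw hmin
  have h1 : (∑ w ∈ circle P a m d v, turnedMark O w *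
      (Int.sign (place R (cross m w) - place R w) +
        Int.sign (place R (outer a d w) - place R w))) = mark O w * 4 := by
    rw [← h.turning_circle hR hv, Finset.mul_sum]
    refine Finset.sum_congr rfl fun u hu => ?_
    rw [h.turnedMark_eq hO hR hv hu, e]
    ring
  -- At a vertex on a vertical segment the half-turn adds exactly `mark O u`. The total of these
  -- terms is the sum of all marks minus the sum at the ends of middle arcs; both vanish by pairing
  -- opposite marks.
  have h2 : ∀ u ∈ circle P a m d v, turnedMark O u *
      (Int.sign (place R (cross m u) - place R u) +
        Int.sign (place R (outer a d u) - place R u)) =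
      turn a m d O u + (mark O u - if IsEnd m u.1 then mark O u else 0) := by
    rintro ⟨i, b⟩ hu
    have hi := circle_subset hu
    rw [mem_verts] at hi
    have hii := hR i hi i hi
    have hneg : ∀ x y : ℤ, Int.sign (R - x - (R - y)) = -Int.sign (x - y) := by
      intro x y
      rw [← Int.sign_neg]
      congr 1
      ring
    by_cases he : IsEnd m i
    · cases b
      · simp [turn, turnedMark, cross, outer, place, he]
      · simp only [turnedMark, cross, outer, place, he, turn, if_true, hneg]
        ring
    · cases b
      · have := (sign_sub_of_lt (a := i) (b := R - i) (by omega)).1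
        simp only [turnedMark, cross, outer, place, he, turn, mate_of_not_isEnd, if_false, this,
          Bool.false_eq_true, Bool.not_false, if_true, not_false_eq_true, sub_self, Int.sign_zero]
        ring
      · have := (sign_sub_of_lt (a := i) (b := R - i) (by omega)).2
        simp only [turnedMark, cross, outer, place, he, turn, mate_of_not_isEnd, if_false, this,
          Bool.false_eq_true, Bool.not_true, if_true, not_false_eq_true, sub_self, Int.sign_zero,
          hneg]
        ring
  have h3 : ∑ u ∈ circle P a m d v, mark O u = 0 :=
    sum_eq_zero_of_pairing (U := outer a d) (fun u hu => h.outer_mem_circle hv hu)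
      (fun u hu => h.outer_ne (circle_subset hu))
      (fun u hu => h.outer_outer (circle_subset hu))
      fun u hu => h.mark_outer hO (circle_subset hu)
  have h4 : ∑ u ∈ circle P a m d v, (if IsEnd m u.1 then mark O u else 0) = 0 := by
    refine sum_eq_zero_of_pairing (U := cross m) (fun u hu => h.cross_mem_circle hv hu)
      (fun u hu => h.cross_ne (circle_subset hu))
      (fun u hu => h.cross_cross (circle_subset hu)) fun u hu => ?_
    rw [h.mark_cross hO]
    by_cases he : IsEnd m u.1
    · have : IsEnd m (cross m u).1 := h.middle.isEnd_mate he
      rw [if_pos he, if_pos this, if_pos he]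
    · have : ¬ IsEnd m (cross m u).1 := by rwa [cross, mate_of_not_isEnd he]
      rw [if_neg this, if_neg he, neg_zero]
  rw [Finset.sum_congr rfl h2, Finset.sum_add_distrib, Finset.sum_sub_distrib, h3, h4] at h1
  rw [← sub_zero (0 : ℤ)] at h1
  simp only [sub_zero, add_zero] at h1
  rw [h1, h.clockwise_iff hO hv hw hmin, mark]
  split_ifs <;> rfl

end IsStack

/-! ## A single surgery -/

/-- The diagrams before and after the surgery at the cap-cup pair `p`. -/
structure IsSurgery (P : Finset ℤ) (a m d : Set (ℤ × ℤ)) (p : ℤ × ℤ) : Prop where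
  before : IsStack P a (insert p m) d
  after : IsStack P a m d
  fst_free : ¬ IsEnd m p.1
  snd_free : ¬ IsEnd m p.2

namespace IsSurgery

variable {P : Finset ℤ} {a m d : Set (ℤ × ℤ)} {p : ℤ × ℤ} (h : IsSurgery P a m d p)
include h

theorem lt : p.1 < p.2 := h.before.middle.lt p (Set.mem_insert _ _)

theorem fst_mem : p.1 ∈ P := h.before.middle_end _ (isEnd_fst (Set.mem_insert _ _))

theorem snd_mem : p.2 ∈ P := h.before.middle_end _ (isEnd_snd (Set.mem_insert _ _))

theorem cross_fst (b : Bool) : cross (insert p m) (p.1, b) = (p.2, b) := by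
  simp [cross, h.before.middle.mate_fst (Set.mem_insert _ _),
    isEnd_fst (Set.mem_insert p m)]

theorem cross_snd (b : Bool) : cross (insert p m) (p.2, b) = (p.1, b) := by
  simp [cross, h.before.middle.mate_snd (Set.mem_insert _ _),
    isEnd_snd (Set.mem_insert p m)]

theorem cross_fst' (b : Bool) : cross m (p.1, b) = (p.1, !b) := by
  simp [cross, mate_of_not_isEnd h.fst_free, h.fst_free]

theorem cross_snd' (b : Bool) : cross m (p.2, b) = (p.2, !b) := by
  simp [cross, mate_of_not_isEnd h.snd_free, h.snd_free]

theorem isEnd_iff {i : ℤ} (h1 : i ≠ p.1) (h2 : i ≠ p.2) :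
    IsEnd (insert p m) i ↔ IsEnd m i := by
  constructor
  · rintro ⟨q, rfl | hq, hi⟩
    · omega
    · exact ⟨q, hq, hi⟩
  · rintro ⟨q, hq, hi⟩
    exact ⟨q, .inr hq, hi⟩

theorem cross_eq {v : ℤ × Bool} (h1 : v.1 ≠ p.1) (h2 : v.1 ≠ p.2) :
    cross m v = cross (insert p m) v := by
  have he := h.isEnd_iff h1 h2
  have : mate m v.1 = mate (insert p m) v.1 := by
    by_cases hm : IsEnd m v.1
    · obtain ⟨q, hq, hi | hi⟩ := hm
      · rw [hi, h.after.middle.mate_fst hq, h.before.middle.mate_fst (.inr hq)]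
      · rw [hi, h.after.middle.mate_snd hq, h.before.middle.mate_snd (.inr hq)]
    · rw [mate_of_not_isEnd hm, mate_of_not_isEnd (he.not.2 hm)]
  rw [cross, cross, this]
  simp [he]

theorem vert_fst (b : Bool) : (p.1, b) ∈ verts P := mem_verts.2 h.fst_mem

theorem vert_snd (b : Bool) : (p.2, b) ∈ verts P := mem_verts.2 h.snd_mem

theorem reachable_before (b : Bool) :
    (stack a (insert p m) d).Reachable (p.1, b) (p.2, b) := by
  have := h.before.adj_cross (h.vert_fst b)
  rw [h.cross_fst] at this
  exact this.reachable

theorem reachable_after_fst (b : Bool) : (stack a m d).Reachable (p.1, b) (p.1, !b) := by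
  have := h.after.adj_cross (h.vert_fst b)
  rw [h.cross_fst'] at this
  exact this.reachable

theorem reachable_after_snd (b : Bool) : (stack a m d).Reachable (p.2, b) (p.2, !b) := by
  have := h.after.adj_cross (h.vert_snd b)
  rw [h.cross_snd'] at this
  exact this.reachable

/-- If the two new segments lie on one circle, then vertices connected before the surgery remain
connected. -/
theorem reachable_after (hxy : (stack a m d).Reachable (p.1, false) (p.2, false))
    {u v : ℤ × Bool} (hu : u ∈ verts P) (huv : (stack a (insert p m) d).Reachable u v) :
    (stack a m d).Reachable u v := by
  have hall : ∀ b, (stack a m d).Reachable (p.1, b) (p.2, b) := by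
    rintro (_ | _)
    · exact hxy
    · exact ((h.reachable_after_fst true).trans hxy).trans (h.reachable_after_snd false)
  refine (h.before.reachable_closed (T := {v | v ∈ verts P ∧ (stack a m d).Reachable u v})
    (fun _ h' => h'.1) ?_ ?_ ⟨hu, .refl _⟩ huv).2
  · rintro v ⟨hv, hr⟩
    exact ⟨h.before.outer_mem hv, hr.trans (h.after.adj_outer hv).reachable⟩
  · rintro v ⟨hv, hr⟩
    refine ⟨h.before.cross_mem hv, ?_⟩
    by_cases h1 : v.1 = p.1
    · obtain ⟨i, b⟩ := v
      simp only at h1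
      subst h1
      rw [h.cross_fst]
      exact hr.trans (hall b)
    by_cases h2 : v.1 = p.2
    · obtain ⟨i, b⟩ := v
      simp only at h2
      subst h2
      rw [h.cross_snd]
      exact hr.trans (hall b).symm
    rw [← h.cross_eq h1 h2]
    exact hr.trans (h.after.adj_cross hv).reachable

/-- The vertices of the circles involved in the surgery. -/
theorem involved_closed {u v : ℤ × Bool}
    (hu : (stack a (insert p m) d).Reachable (p.1, false) u ∨
      (stack a (insert p m) d).Reachable (p.1, true) u)
    (huv : (stack a m d).Reachable u v) :
    (stack a (insert p m) d).Reachable (p.1, false) v ∨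
      (stack a (insert p m) d).Reachable (p.1, true) v := by
  have hb := h.reachable_before
  refine h.after.reachable_closed (T := {v | (stack a (insert p m) d).Reachable (p.1, false) v ∨
      (stack a (insert p m) d).Reachable (p.1, true) v}) ?_ ?_ ?_ hu huv
  · rintro v (hv | hv)
    · exact h.before.reachable_verts (h.vert_fst _) hv
    · exact h.before.reachable_verts (h.vert_fst _) hv
  · rintro v (hv | hv)
    · have := h.before.reachable_verts (h.vert_fst _) hv
      exact .inl (hv.trans (h.before.adj_outer this).reachable)
    · have := h.before.reachable_verts (h.vert_fst _) hv
      exact .inr (hv.trans (h.before.adj_outer this).reachable)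
  · rintro v hv
    by_cases h1 : v.1 = p.1
    · obtain ⟨i, b⟩ := v
      simp only at h1
      subst h1
      rw [Set.mem_ofPred_eq, h.cross_fst']
      cases b
      · exact .inr (.refl _)
      · exact .inl (.refl _)
    by_cases h2 : v.1 = p.2
    · obtain ⟨i, b⟩ := v
      simp only at h2
      subst h2
      rw [Set.mem_ofPred_eq, h.cross_snd']
      cases b
      · exact .inr (hb _)
      · exact .inl (hb _)
    have hv' : v ∈ verts P := by
      rcases hv with hv | hv
      · exact h.before.reachable_verts (h.vert_fst _) hv
      · exact h.before.reachable_verts (h.vert_fst _) hv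
    rw [Set.mem_ofPred_eq, h.cross_eq h1 h2]
    exact hv.imp (fun hv => hv.trans (h.before.adj_cross hv').reachable)
      fun hv => hv.trans (h.before.adj_cross hv').reachable

/-- If two circles are involved in the surgery, they merge. -/
theorem merge (hxz : ¬ (stack a (insert p m) d).Reachable (p.1, false) (p.1, true)) :
    (stack a m d).Reachable (p.1, false) (p.2, false) := by
  by_contra hxy
  have hb := h.reachable_before
  -- `T` is the intersection of the circles through `(p.1, false)` before and after the surgery. The
  -- outer arcs pair up `T`, so its size is even. Of the four vertices at which `cross` changes only
  -- `(p.1, false)` lies in `T`, so `cross` pairs up the rest and the size is odd.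
  set T := (verts P).filter fun v => (stack a (insert p m) d).Reachable (p.1, false) v ∧
    (stack a m d).Reachable (p.1, false) v with hT
  have memT : ∀ v, v ∈ T ↔ v ∈ verts P ∧ (stack a (insert p m) d).Reachable (p.1, false) v ∧
    (stack a m d).Reachable (p.1, false) v := fun v => by rw [hT, Finset.mem_filter]
  have hsub : T ⊆ verts P := fun v hv => ((memT v).1 hv).1
  have hx : (p.1, false) ∈ T := (memT _).2 ⟨h.vert_fst _, .refl _, .refl _⟩
  obtain ⟨R, hR⟩ := exists_width P
  have e1 : ∏ _w ∈ T, (-1 : ℤ) = 1 := by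
    refine ((h.before.pairing_outer hR).mono hsub fun v hv => ?_).even_card
    rw [memT] at hv ⊢
    exact ⟨h.before.outer_mem hv.1, hv.2.1.trans (h.before.adj_outer hv.1).reachable,
      hv.2.2.trans (h.after.adj_outer hv.1).reachable⟩
  have e2 : ∏ _w ∈ T.erase (p.1, false), (-1 : ℤ) = 1 := by
    refine ((h.before.pairing_cross hR).mono ((Finset.erase_subset _ _).trans hsub)
      fun v hv => ?_).even_card
    rw [Finset.mem_erase, memT] at hv
    obtain ⟨hvx, hv, hv1, hv2⟩ := hv
    have hvy : v ≠ (p.2, false) := fun e => hxy (e ▸ hv2)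
    have hvz : v ≠ (p.1, true) := fun e => hxz (e ▸ hv1)
    have hvw : v ≠ (p.2, true) := by
      rintro rfl
      exact hxz (hv1.trans (hb true).symm)
    obtain ⟨i, b⟩ := v
    have h1 : i ≠ p.1 := by
      rintro rfl
      cases b <;> simp_all
    have h2 : i ≠ p.2 := by
      rintro rfl
      cases b <;> simp_all
    have he := h.cross_eq (v := (i, b)) h1 h2
    rw [Finset.mem_erase, memT]
    refine ⟨fun e => hvy ?_, h.before.cross_mem hv,
      hv1.trans (h.before.adj_cross hv).reachable, ?_⟩
    · rw [← h.before.cross_cross hv, e, h.cross_fst]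
    · rw [← he]
      exact hv2.trans (h.after.adj_cross hv).reachable
  rw [← Finset.mul_prod_erase _ _ hx, e2] at e1
  norm_num at e1

/-- If only one circle is involved in the surgery, it splits. -/
theorem split (hxz : (stack a (insert p m) d).Reachable (p.1, false) (p.1, true)) :
    ¬ (stack a m d).Reachable (p.1, false) (p.2, false) := by
  intro hxy
  obtain ⟨R, hR⟩ := exists_width P
  have hvx := h.vert_fst false
  have hC : circle P a m d (p.1, false) = circle P a (insert p m) d (p.1, false) := by
    ext v
    rw [h.after.mem_circle hvx, h.before.mem_circle hvx]
    constructor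
    · intro hv
      rcases h.involved_closed (.inl (.refl _)) hv with h1 | h1
      · exact h1
      · exact hxz.trans h1
    · exact h.reachable_after hxy hvx
  -- If the circle did not split, the same vertex set would carry two meanders with the same
  -- alternating signs, both of total `4`. They differ at the four ends of the cap-cup pair only,
  -- which contribute `4 * A (p.1, false)` before the surgery and `0` after it.
  have t1 := h.before.turning_circle hR hvx
  have t2 := h.after.turning_circle hR hvx
  rw [hC] at t2
  set C := circle P a (insert p m) d (p.1, false) with hCdef
  set A := altSign (place R) C
  have hinj : Set.InjOn (place R) C := (place_injOn hR).mono circle_subset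
  have hx : (p.1, false) ∈ C := (h.before.mem_circle hvx).2 (.refl _)
  have hz : (p.1, true) ∈ C := (h.before.mem_circle hvx).2 hxz
  have hy : (p.2, false) ∈ C := (h.before.mem_circle hvx).2 (h.reachable_before false)
  have hw : (p.2, true) ∈ C := (h.before.mem_circle hvx).2 (hxz.trans (h.reachable_before true))
  have ay : A (p.2, false) = -A (p.1, false) := by
    have := (h.before.pairing_circle_cross hR hvx).altSign_apply hinj hx
    rwa [h.cross_fst] at this
  have az : A (p.1, true) = -A (p.1, false) := by
    have := (h.after.pairing_circle_cross hR hvx)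
    rw [hC] at this
    have := this.altSign_apply hinj hx
    rwa [h.cross_fst'] at this
  have aw : A (p.2, true) = A (p.1, false) := by
    have := (h.before.pairing_circle_cross hR hvx).altSign_apply hinj hz
    rw [h.cross_fst] at this
    rw [← neg_neg (A (p.1, false)), ← az]
    exact this
  have hne := h.lt.ne
  have hsub : ({(p.1, false), (p.2, false), (p.1, true), (p.2, true)} : Finset (ℤ × Bool)) ⊆ C := by
    simp [Finset.insert_subset_iff, hx, hy, hz, hw]
  have hdiff : ∑ v ∈ C, (A v * (Int.sign (place R (cross (insert p m) v) - place R v) +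
        Int.sign (place R (outer a d v) - place R v)) -
      A v * (Int.sign (place R (cross m v) - place R v) +
        Int.sign (place R (outer a d v) - place R v))) = 0 := by
    rw [Finset.sum_sub_distrib, t1, t2, sub_self]
  rw [← Finset.sum_subset hsub] at hdiff
  · rw [Finset.sum_insert (by simp [hne]), Finset.sum_insert (by simp),
      Finset.sum_insert (by simp [hne]), Finset.sum_singleton] at hdiff
    have r1 := hR _ h.fst_mem _ h.fst_mem
    have r2 := hR _ h.fst_mem _ h.snd_mem
    have r3 := hR _ h.snd_mem _ h.snd_mem
    have s1 := sign_sub_of_lt h.lt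
    have s2 := sign_sub_of_lt (a := R - p.2) (b := R - p.1) (by have := h.lt; omega)
    have s3 := sign_sub_of_lt (a := p.1) (b := R - p.1) (by omega)
    have s4 := sign_sub_of_lt (a := p.2) (b := R - p.2) (by omega)
    simp only [h.cross_fst, h.cross_snd, h.cross_fst', h.cross_snd', ay, az, aw, place,
      Bool.false_eq_true, if_false, if_true, Bool.not_true, Bool.not_false, s1.1, s1.2, s2.1,
      s2.2, s3.1, s3.2, s4.1, s4.2] at hdiff
    have hsq : A (p.1, false) * A (p.1, false) = 1 := by
      simp only [A, altSign]
      rw [← Finset.prod_mul_distrib]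
      refine Finset.prod_eq_one fun x _ => ?_
      split_ifs <;> rfl
    have h0 : A (p.1, false) = 0 := by linarith
    rw [h0] at hsq
    norm_num at hsq
  · rintro ⟨i, b⟩ hv hv'
    have h1 : i ≠ p.1 := by
      rintro rfl
      cases b <;> simp at hv'
    have h2 : i ≠ p.2 := by
      rintro rfl
      cases b <;> simp at hv'
    rw [h.cross_eq (v := (i, b)) h1 h2, sub_self]

/-- A surgery increases (four times) the turning number by `4`. -/
theorem sum_turn {O O' : Finset (ℤ × Bool)} (hO : IsOrientation a (insert p m) d O)
    (hO' : IsOrientation a m d O')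
    (hout : ∀ u, ¬ (stack a (insert p m) d).Reachable (p.1, false) u →
      ¬ (stack a (insert p m) d).Reachable (p.1, true) u → (u ∈ O' ↔ u ∈ O))
    (hin : if (stack a (insert p m) d).Reachable (p.1, false) (p.1, true) then
      (¬ Clockwise (stack a (insert p m) d) O (p.1, false) ∧
        ((¬ Clockwise (stack a m d) O' (p.1, false) ∧ Clockwise (stack a m d) O' (p.2, false)) ∨
          (Clockwise (stack a m d) O' (p.1, false) ∧
            ¬ Clockwise (stack a m d) O' (p.2, false)))) ∨
      (Clockwise (stack a (insert p m) d) O (p.1, false) ∧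
        Clockwise (stack a m d) O' (p.1, false) ∧ Clockwise (stack a m d) O' (p.2, false))
    else
      (¬ Clockwise (stack a (insert p m) d) O (p.1, false) ∧
        ¬ Clockwise (stack a (insert p m) d) O (p.1, true) ∧
        ¬ Clockwise (stack a m d) O' (p.1, false)) ∨
      (¬ Clockwise (stack a (insert p m) d) O (p.1, false) ∧
        Clockwise (stack a (insert p m) d) O (p.1, true) ∧
        Clockwise (stack a m d) O' (p.1, false)) ∨
      (Clockwise (stack a (insert p m) d) O (p.1, false) ∧
        ¬ Clockwise (stack a (insert p m) d) O (p.1, true) ∧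
        Clockwise (stack a m d) O' (p.1, false))) :
    ∑ v ∈ verts P, turn a m d O' v = ∑ v ∈ verts P, turn a (insert p m) d O v + 4 := by
  have hb := h.reachable_before
  have hvx := h.vert_fst false
  have hvy := h.vert_snd false
  have hvz := h.vert_fst true
  set I := (verts P).filter fun u => (stack a (insert p m) d).Reachable (p.1, false) u ∨
      (stack a (insert p m) d).Reachable (p.1, true) u with hI
  have memI : ∀ u, u ∈ I ↔ (stack a (insert p m) d).Reachable (p.1, false) u ∨
      (stack a (insert p m) d).Reachable (p.1, true) u := by
    intro u
    rw [hI, Finset.mem_filter]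
    refine ⟨fun h' => h'.2, fun h' => ⟨?_, h'⟩⟩
    rcases h' with h' | h'
    · exact h.before.reachable_verts hvx h'
    · exact h.before.reachable_verts hvz h'
  have hIsub : I ⊆ verts P := Finset.filter_subset _ _
  have hrest : ∑ v ∈ verts P \ I, turn a m d O' v =
      ∑ v ∈ verts P \ I, turn a (insert p m) d O v := by
    refine Finset.sum_congr rfl fun v hv => ?_
    rw [Finset.mem_sdiff, memI, not_or] at hv
    obtain ⟨i, b⟩ := v
    have h1 : i ≠ p.1 := by
      rintro rfl
      cases b
      · exact hv.2.1 (.refl _)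
      · exact hv.2.2 (.refl _)
    have h2 : i ≠ p.2 := by
      rintro rfl
      cases b
      · exact hv.2.1 (hb _)
      · exact hv.2.2 (hb _)
    rw [turn, turn, h.cross_eq (v := (i, b)) h1 h2, mark_congr (hout _ hv.2.1 hv.2.2)]
  rw [← Finset.sum_sdiff hIsub, ← Finset.sum_sdiff hIsub, hrest, add_assoc, add_right_inj]
  have cx := h.before.sum_turn_circle hO hvx
  have cz := h.before.sum_turn_circle hO hvz
  have cx' := h.after.sum_turn_circle hO' hvx
  have cy' := h.after.sum_turn_circle hO' hvy
  -- Type `1` counts `-4` and type `x` counts `4`. All permitted changes of type, in the split and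
  -- in the merge, raise the total by `4`; the discarded `x ⊗ x` of a merge would not.
  by_cases hxz : (stack a (insert p m) d).Reachable (p.1, false) (p.1, true)
  · rw [if_pos hxz] at hin
    have hxy := h.split hxz
    have hI1 : I = circle P a (insert p m) d (p.1, false) := by
      ext v
      rw [memI, h.before.mem_circle hvx, or_iff_left_of_imp hxz.trans]
    have hI2 : I = circle P a m d (p.1, false) ∪ circle P a m d (p.2, false) := by
      ext v
      rw [Finset.mem_union, h.after.mem_circle hvx, h.after.mem_circle hvy]
      constructor
      · intro hv
        rw [hI1, h.before.mem_circle hvx] at hv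
        refine h.before.reachable_closed (T := {v | (stack a m d).Reachable (p.1, false) v ∨
          (stack a m d).Reachable (p.2, false) v}) ?_ ?_ ?_ (.inl (.refl _)) hv
        · rintro v (hv | hv)
          · exact h.after.reachable_verts hvx hv
          · exact h.after.reachable_verts hvy hv
        · rintro v (hv | hv)
          · have := h.after.reachable_verts hvx hv
            exact .inl (hv.trans (h.after.adj_outer this).reachable)
          · have := h.after.reachable_verts hvy hv
            exact .inr (hv.trans (h.after.adj_outer this).reachable)
        · rintro v hv
          by_cases h1 : v.1 = p.1
          · obtain ⟨i, b⟩ := v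
            simp only at h1
            subst h1
            rw [Set.mem_ofPred_eq, h.cross_fst]
            cases b
            · exact .inr (.refl _)
            · exact .inr (h.reachable_after_snd false)
          by_cases h2 : v.1 = p.2
          · obtain ⟨i, b⟩ := v
            simp only at h2
            subst h2
            rw [Set.mem_ofPred_eq, h.cross_snd]
            cases b
            · exact .inl (.refl _)
            · exact .inl (h.reachable_after_fst false)
          have hv' : v ∈ verts P := by
            rcases hv with hv | hv
            · exact h.after.reachable_verts hvx hv
            · exact h.after.reachable_verts hvy hv
          rw [Set.mem_ofPred_eq, ← h.cross_eq h1 h2]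
          exact hv.imp (fun hv => hv.trans (h.after.adj_cross hv').reachable)
            fun hv => hv.trans (h.after.adj_cross hv').reachable
      · rw [memI]
        rintro (hv | hv)
        · exact h.involved_closed (.inl (.refl _)) hv
        · exact h.involved_closed (.inl (hb _)) hv
    have hdis : Disjoint (circle P a m d (p.1, false)) (circle P a m d (p.2, false)) := by
      rw [Finset.disjoint_left]
      intro v h1 h2
      rw [h.after.mem_circle hvx] at h1
      rw [h.after.mem_circle hvy] at h2
      exact hxy (h1.trans h2.symm)
    have e1 : ∑ v ∈ I, turn a m d O' v = ∑ v ∈ circle P a m d (p.1, false), turn a m d O' v +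
        ∑ v ∈ circle P a m d (p.2, false), turn a m d O' v := by
      rw [hI2, Finset.sum_union hdis]
    rw [e1, cx', cy', hI1, cx]
    rcases hin with ⟨h1, ⟨h2, h3⟩ | ⟨h2, h3⟩⟩ | ⟨h1, h2, h3⟩ <;> simp [h1, h2, h3]
  · rw [if_neg hxz] at hin
    have hxy := h.merge hxz
    have hI1 : I = circle P a (insert p m) d (p.1, false) ∪
        circle P a (insert p m) d (p.1, true) := by
      ext v
      rw [memI, Finset.mem_union, h.before.mem_circle hvx, h.before.mem_circle hvz]
    have hdis : Disjoint (circle P a (insert p m) d (p.1, false))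
        (circle P a (insert p m) d (p.1, true)) := by
      rw [Finset.disjoint_left]
      intro v h1 h2
      rw [h.before.mem_circle hvx] at h1
      rw [h.before.mem_circle hvz] at h2
      exact hxz (h1.trans h2.symm)
    have hI2 : I = circle P a m d (p.1, false) := by
      ext v
      rw [h.after.mem_circle hvx, memI]
      constructor
      · rintro (hv | hv)
        · exact h.reachable_after hxy hvx hv
        · exact (h.reachable_after_fst false).trans (h.reachable_after hxy hvz hv)
      · exact fun hv => h.involved_closed (.inl (.refl _)) hv
    have e1 : ∑ v ∈ I, turn a (insert p m) d O v =
        ∑ v ∈ circle P a (insert p m) d (p.1, false), turn a (insert p m) d O v +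
        ∑ v ∈ circle P a (insert p m) d (p.1, true), turn a (insert p m) d O v := by
      rw [hI1, Finset.sum_union hdis]
    rw [e1, cx, cz, hI2, cx']
    rcases hin with ⟨h1, h2, h3⟩ | ⟨h1, h2, h3⟩ | ⟨h1, h2, h3⟩ <;> simp [h1, h2, h3]

end IsSurgery

/-! ## Iterated surgeries -/

/-- The number of clockwise cups and caps of an oriented stacked diagram. -/
def stackDeg (a d : Finset (ℤ × ℤ)) (m : List (ℤ × ℤ)) (O : Finset (ℤ × Bool)) : ℕ :=
  (a.filter fun p => (p.1, false) ∈ O).card + (d.filter fun p => (p.1, true) ∈ O).card +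
    ((m.toFinset.filter fun p => (p.1, false) ∈ O).card +
      (m.toFinset.filter fun p => (p.1, true) ∈ O).card)

theorem sum_mark (s : Finset (ℤ × ℤ)) (O : Finset (ℤ × Bool)) (b : Bool) :
    ∑ p ∈ s, mark O (p.1, b) = 2 * ((s.filter fun p => (p.1, b) ∈ O).card : ℤ) - s.card := by
  have : ∀ p ∈ s, mark O (p.1, b) = 2 * (if (p.1, b) ∈ O then 1 else 0) - 1 := by
    intro p _
    unfold mark
    split_ifs <;> rfl
  rw [Finset.sum_congr rfl this, Finset.sum_sub_distrib, ← Finset.mul_sum, Finset.sum_boole]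
  simp

/-- The two ends of an arc have opposite marks and opposite directions, so an arc contributes `2` if
it is clockwise and `-2` otherwise. Vertical segments have no horizontal direction. Each middle arc
counts twice, once on either line. -/
theorem IsStack.sum_turn {P : Finset ℤ} {a d : Finset (ℤ × ℤ)} {m : List (ℤ × ℤ)}
    (h : IsStack P a {q | q ∈ m} d) {O : Finset (ℤ × Bool)}
    (hO : IsOrientation a {q | q ∈ m} d O) :
    ∑ v ∈ verts P, turn a {q | q ∈ m} d O v =
      4 * (stackDeg a d m O : ℤ) - 2 * (a.card + d.card + 2 * m.toFinset.card) := by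
  have hm : ((m.toFinset : Finset (ℤ × ℤ)) : Set (ℤ × ℤ)) = {q | q ∈ m} := by
    ext
    simp
  have e1 := h.cups.sum_sign rfl (fun i => (h.cup_end i).1) (fun i => mark O (i, false))
    fun p hp => mark_eq_neg (hO.1 p (.inl hp))
  have e2 := h.caps.sum_sign rfl (fun i => (h.cap_end i).1) (fun i => mark O (i, true))
    fun p hp => mark_eq_neg (hO.2.1 p (.inl hp))
  have e3 := h.middle.sum_sign hm h.middle_end (fun i => mark O (i, false))
    fun p hp => mark_eq_neg (hO.1 p (.inr hp))
  have e4 := h.middle.sum_sign hm h.middle_end (fun i => mark O (i, true))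
    fun p hp => mark_eq_neg (hO.2.1 p (.inr hp))
  rw [sum_mark] at e1 e2 e3 e4
  have : ∑ v ∈ verts P, turn a {q | q ∈ m} d O v =
      ∑ i ∈ P, mark O (i, false) * Int.sign (mate {q | q ∈ m} i - i) +
      ∑ i ∈ P, mark O (i, false) * Int.sign (mate a i - i) +
      (∑ i ∈ P, mark O (i, true) * Int.sign (mate {q | q ∈ m} i - i) +
      ∑ i ∈ P, mark O (i, true) * Int.sign (mate d i - i)) := by
    rw [Finset.sum_product, ← Finset.sum_add_distrib, ← Finset.sum_add_distrib,
      ← Finset.sum_add_distrib]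
    refine Finset.sum_congr rfl fun i _ => ?_
    simp only [Fintype.univ_bool, Finset.mem_singleton, Bool.true_eq_false, not_false_eq_true,
      Finset.sum_insert, Finset.sum_singleton, turn, cross, outer, if_true, if_false,
      Bool.false_eq_true]
    ring
  rw [this, e1, e2, e3, e4, stackDeg]
  push_cast
  ring

theorem setOf_mem_cons (p : ℤ × ℤ) (m : List (ℤ × ℤ)) :
    {q | q ∈ p :: m} = insert p {q | q ∈ m} := by
  ext
  simp

/-- Cutting an outermost cap-cup pair of the middle section. -/
theorem IsStack.isSurgery {P : Finset ℤ} {a d : Set (ℤ × ℤ)} {p : ℤ × ℤ} {m : Set (ℤ × ℤ)}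
    (h : IsStack P a (insert p m) d) (hp : p ∉ m) (hle : ∀ q ∈ m, p.1 ≤ q.1) :
    IsSurgery P a m d p := by
  have free : ∀ i, (i = p.1 ∨ i = p.2) → ¬ IsEnd m i := by
    rintro i hi ⟨q, hq, hiq⟩
    exact hp (h.middle.eq_of_end (.inl rfl) (.inr hq) hi hiq ▸ hq)
  refine ⟨h, ⟨h.cups, ⟨fun q hq => h.middle.lt q (.inr hq),
    fun q hq r hr => h.middle.apart q (.inr hq) r (.inr hr)⟩, h.caps, h.cup_end, h.cap_end,
    fun i ⟨q, hq, hi⟩ => h.middle_end i ⟨q, .inr hq, hi⟩, ?_⟩, free _ (.inl rfl),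
    free _ (.inr rfl)⟩
  intro q hq i hi h1 h2
  obtain ⟨r, hr, hir⟩ := h.inner q (.inr hq) i hi h1 h2
  -- No end of the arc that is cut lies under a remaining arc, because the arc that is cut starts
  -- furthest to the left.
  rcases hr with rfl | hr
  · have h3 := h.middle.apart r (.inl rfl) q (.inr hq) (by rintro rfl; exact hp hq)
    have := hle q hq
    have := h.middle.lt r (.inl rfl)
    omega
  · exact ⟨r, hr, hir⟩

/-- The surgeries are homogeneous. -/
theorem surgeries_support {P : Finset ℤ} {a d : Finset (ℤ × ℤ)} {O' : Finset (ℤ × Bool)} :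
    ∀ {m : List (ℤ × ℤ)} {O : Finset (ℤ × Bool)}, IsStack P a {q | q ∈ m} d →
      m.Pairwise (fun p q => p.1 ≤ q.1) → m.Nodup → IsOrientation a {q | q ∈ m} d O →
      O' ∈ (surgeries P a d m O).support → stackDeg a d [] O' = stackDeg a d m O := by
  intro m
  induction m with
  | nil =>
    intro O _ _ _ _ hO'
    rw [surgeries] at hO'
    have := Finsupp.support_single_subset hO'
    rw [Finset.mem_singleton.1 this]
  | cons p m ih =>
    intro O h hs hn hO hO'
    rw [List.pairwise_cons] at hs
    rw [List.nodup_cons] at hn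
    rw [surgeries] at hO'
    have := Finsupp.support_finsetSum hO'
    rw [Finset.mem_biUnion] at this
    obtain ⟨O₁, hO₁, hO'⟩ := this
    rw [Finset.mem_filter] at hO₁
    have hsur := hO₁.2
    have hO0 := hO
    have h0 := h
    rw [setOf_mem_cons] at h hO
    have hS := h.isSurgery (m := {q | q ∈ m}) hn.1 hs.1
    unfold Surgery at hsur
    rw [setOf_mem_cons] at hsur
    rw [ih hS.after hs.2 hn.2 hsur.1 hO']
    -- The sum over circles grows by `4`. In the sum over arcs the two removed arcs already account
    -- for this `4`, so the number of clockwise arcs stays the same.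
    have e := hS.sum_turn hO hsur.1 hsur.2.1 hsur.2.2
    have e1 := hS.after.sum_turn hsur.1
    have e2 := h0.sum_turn hO0
    rw [setOf_mem_cons] at e2
    rw [e1, e2] at e
    have hc : (p :: m).toFinset.card = m.toFinset.card + 1 := by
      rw [List.toFinset_cons, Finset.card_insert_of_notMem (by simpa using hn.1)]
    rw [hc] at e
    push_cast at e
    omega

/-! ## Merging with small anti-clockwise circles -/

/-- The orientation obtained by copying the labels of the top line to the ends of the arcs in `m`
on the bottom line. -/
def slide (m : Set (ℤ × ℤ)) (O : Finset (ℤ × Bool)) : Finset (ℤ × Bool) :=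
  (O ∪ O.image fun u => (u.1, false)).filter fun u =>
    if u.2 = false ∧ IsEnd m u.1 then (u.1, true) ∈ O else u ∈ O

theorem mem_slide {m : Set (ℤ × ℤ)} {O : Finset (ℤ × Bool)} {u : ℤ × Bool} :
    u ∈ slide m O ↔ if u.2 = false ∧ IsEnd m u.1 then (u.1, true) ∈ O else u ∈ O := by
  rw [slide, Finset.mem_filter, and_iff_right_iff_imp]
  intro h
  split_ifs at h with hu
  · refine Finset.mem_union_right _ (Finset.mem_image.2 ⟨_, h, ?_⟩)
    ext
    · rfl
    · exact hu.1.symm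
  · exact Finset.mem_union_left _ h

theorem slide_subset {m : Set (ℤ × ℤ)} {O : Finset (ℤ × Bool)} {P : Finset ℤ}
    (h : O ⊆ verts P) : slide m O ⊆ verts P := by
  intro u hu
  rw [mem_slide] at hu
  rw [mem_verts]
  split_ifs at hu
  · exact (mem_verts (v := (u.1, true))).1 (h hu)
  · exact mem_verts.1 (h hu)

theorem isEnd_singleton {p : ℤ × ℤ} {i : ℤ} : IsEnd {p} i ↔ i = p.1 ∨ i = p.2 := by
  simp [IsEnd]

namespace IsSurgery

variable {P : Finset ℤ} {a m d : Set (ℤ × ℤ)} {p : ℤ × ℤ} (h : IsSurgery P a m d p)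
  (hpa : p ∈ a) {O : Finset (ℤ × Bool)} (hO : IsOrientation a (insert p m) d O)
include h hpa

/-- The bottom cup and the middle cap over the same two vertices close up to a circle. -/
theorem reachable_small {u : ℤ × Bool}
    (hu : (stack a (insert p m) d).Reachable (p.1, false) u) :
    u = (p.1, false) ∨ u = (p.2, false) := by
  refine h.before.reachable_closed (T := {u | u = (p.1, false) ∨ u = (p.2, false)}) ?_ ?_ ?_
    (.inl rfl) hu
  · rintro u (rfl | rfl)
    · exact h.vert_fst _
    · exact h.vert_snd _
  · rintro u (rfl | rfl)
    · right
      simp [outer, h.before.cups.mate_fst hpa]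
    · left
      simp [outer, h.before.cups.mate_snd hpa]
  · rintro u (rfl | rfl)
    · exact .inr (h.cross_fst _)
    · exact .inl (h.cross_snd _)

theorem not_reachable_small :
    ¬ (stack a (insert p m) d).Reachable (p.1, false) (p.1, true) := by
  intro hr
  rcases h.reachable_small hpa hr with e | e <;> simp at e

/-- After sliding, the bottom cup `p` has the labels of the top middle cup `p`, so it stays oriented
and the two new vertical segments join equal labels. -/
theorem isOrientation_slide (hO : IsOrientation a (insert p m) d O) :
    IsOrientation a m d (slide {p} O) := by
  have hfalse : ∀ i, (i, false) ∈ slide {p} O ↔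
      if i = p.1 ∨ i = p.2 then (i, true) ∈ O else (i, false) ∈ O := by
    intro i
    simp [mem_slide, isEnd_singleton]
  have htrue : ∀ i, (i, true) ∈ slide {p} O ↔ (i, true) ∈ O := by
    intro i
    simp [mem_slide]
  refine ⟨?_, ?_, ?_⟩
  · intro q hq
    rw [hfalse, hfalse]
    by_cases hqp : q = p
    · subst hqp
      rw [if_pos (.inl rfl), if_pos (.inr rfl)]
      exact hO.2.1 q (.inr (.inl rfl))
    · have key : ∀ i, (i = q.1 ∨ i = q.2) → ¬ (i = p.1 ∨ i = p.2) := by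
        intro i hi hi'
        rcases hq with hq | hq
        · exact hqp (h.before.cups.eq_of_end hq hpa hi hi')
        · exact hqp (h.before.middle.eq_of_end (.inr hq) (.inl rfl) hi hi')
      rw [if_neg (key _ (.inl rfl)), if_neg (key _ (.inr rfl))]
      exact hO.1 q (hq.imp id .inr)
  · intro q hq
    rw [htrue, htrue]
    exact hO.2.1 q (hq.imp id .inr)
  · intro i hi
    rw [htrue, hfalse]
    split_ifs with hc
    · rfl
    · exact hO.2.2 i ((h.isEnd_iff (fun e => hc (.inl e)) fun e => hc (.inr e)).not.2 hi)

include hO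

/-- If the circle below the cap-cup pair is small and anti-clockwise, the result of the surgery
is unique. -/
theorem conditions_iff (hp : (p.1, false) ∉ O) {O' : Finset (ℤ × Bool)} :
    (IsOrientation a m d O' ∧
      (∀ u, ¬ (stack a (insert p m) d).Reachable (p.1, false) u →
        ¬ (stack a (insert p m) d).Reachable (p.1, true) u → (u ∈ O' ↔ u ∈ O)) ∧
      ((¬ Clockwise (stack a (insert p m) d) O (p.1, false) ∧
        ¬ Clockwise (stack a (insert p m) d) O (p.1, true) ∧
        ¬ Clockwise (stack a m d) O' (p.1, false)) ∨
      (¬ Clockwise (stack a (insert p m) d) O (p.1, false) ∧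
        Clockwise (stack a (insert p m) d) O (p.1, true) ∧
        Clockwise (stack a m d) O' (p.1, false)) ∨
      (Clockwise (stack a (insert p m) d) O (p.1, false) ∧
        ¬ Clockwise (stack a (insert p m) d) O (p.1, true) ∧
        Clockwise (stack a m d) O' (p.1, false)))) ↔ O' = slide {p} O := by
  have hvx := h.vert_fst false
  have hvz := h.vert_fst true
  have hxz := h.not_reachable_small hpa
  have hxy := h.merge hxz
  have hcw : ¬ Clockwise (stack a (insert p m) d) O (p.1, false) := by
    rw [h.before.clockwise_iff hO hvx ((h.before.mem_circle hvx).2 (.refl _))]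
    · exact hp
    · intro u hu
      rcases h.reachable_small hpa ((h.before.mem_circle hvx).1 hu) with rfl | rfl
      · exact le_rfl
      · exact h.lt.le
  -- The upper circle passes through `(p.1, true)`, so its leftmost vertex `v` is also leftmost on
  -- the merged circle. The rules `1 ⊗ 1 ↦ 1` and `1 ⊗ x ↦ x` then say that `v` keeps its label.
  obtain ⟨v, hv, hmin⟩ := h.before.exists_leftmost hvz
  have hvr := (h.before.mem_circle hvz).1 hv
  have hmin1 : v.1 ≤ p.1 := hmin _ ((h.before.mem_circle hvz).2 (.refl _))
  have hcw2 := h.before.clockwise_iff hO hvz hv hmin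
  have hv' : v ∈ circle P a m d (p.1, false) :=
    (h.after.mem_circle hvx).2 ((h.reachable_after_fst false).trans
      (h.reachable_after hxy hvz hvr))
  have hmin' : ∀ u ∈ circle P a m d (p.1, false), v.1 ≤ u.1 := by
    intro u hu
    rcases h.involved_closed (.inl (.refl _)) ((h.after.mem_circle hvx).1 hu) with h1 | h1
    · have := h.lt
      rcases h.reachable_small hpa h1 with rfl | rfl <;> simp only <;> omega
    · exact hmin u ((h.before.mem_circle hvz).2 h1)
  have hvx' : v ≠ (p.1, false) := by
    rintro rfl
    exact hxz hvr.symm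
  have hvy' : v ≠ (p.2, false) := by
    rintro rfl
    exact hxz ((h.reachable_before false).trans hvr.symm)
  have hslide : ∀ u : ℤ × Bool, u ≠ (p.1, false) → u ≠ (p.2, false) →
      (u ∈ slide {p} O ↔ u ∈ O) := by
    rintro ⟨i, b⟩ h1 h2
    rw [mem_slide, if_neg]
    simp only [isEnd_singleton]
    rintro ⟨rfl, rfl | rfl⟩
    · exact h1 rfl
    · exact h2 rfl
  have hori := h.isOrientation_slide hpa hO
  constructor
  · rintro ⟨hO', hout, hc⟩
    rw [h.after.clockwise_iff hO' hvx hv' hmin'] at hc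
    have hvO : v ∈ O' ↔ v ∈ slide {p} O := by
      rw [hslide v hvx' hvy']
      tauto
    -- One label determines the orientation of a connected circle.
    have hall : ∀ u ∈ circle P a m d (p.1, false), mark O' u = mark (slide {p} O) u := by
      intro u hu
      have hvu : (stack a m d).Reachable v u :=
        ((h.after.mem_circle hvx).1 hv').symm.trans ((h.after.mem_circle hvx).1 hu)
      refine (h.after.reachable_closed (T := {u | u ∈ verts P ∧
        mark O' u = mark (slide {p} O) u}) (fun _ h' => h'.1) ?_ ?_
        ⟨circle_subset hv', mark_congr hvO⟩ hvu).2
      · rintro u ⟨hu, he⟩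
        refine ⟨h.after.outer_mem hu, ?_⟩
        rw [h.after.mark_outer hO' hu, h.after.mark_outer hori hu, he]
      · rintro u ⟨hu, he⟩
        refine ⟨h.after.cross_mem hu, ?_⟩
        rw [h.after.mark_cross hO', h.after.mark_cross hori, he]
    ext u
    by_cases hu : u ∈ circle P a m d (p.1, false)
    · have := hall u hu
      unfold mark at this
      split_ifs at this with h1 h2 <;> simp_all
    · have hr : ¬ (stack a m d).Reachable (p.1, false) u := fun hr =>
        hu ((h.after.mem_circle hvx).2 hr)
      have h1 : ¬ (stack a (insert p m) d).Reachable (p.1, false) u := fun h1 =>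
        hr (h.reachable_after hxy hvx h1)
      rw [hout u h1 fun h2 =>
        hr ((h.reachable_after_fst false).trans (h.reachable_after hxy hvz h2)), hslide]
      · rintro rfl
        exact h1 (.refl _)
      · rintro rfl
        exact h1 (h.reachable_before false)
  · rintro rfl
    refine ⟨hori, fun u h1 _ => hslide u ?_ ?_, ?_⟩
    · rintro rfl
      exact h1 (.refl _)
    · rintro rfl
      exact h1 (h.reachable_before false)
    · rw [h.after.clockwise_iff hori hvx hv' hmin', hslide v hvx' hvy', hcw2]
      tauto

end IsSurgery

/-- Surgeries that merge circles with small anti-clockwise circles at the bottom. -/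
theorem surgeries_small {P : Finset ℤ} {a d : Set (ℤ × ℤ)} :
    ∀ {m : List (ℤ × ℤ)} {O : Finset (ℤ × Bool)}, IsStack P a {q | q ∈ m} d →
      m.Pairwise (fun p q => p.1 ≤ q.1) → m.Nodup → IsOrientation a {q | q ∈ m} d O →
      O ⊆ verts P → (∀ q ∈ m, q ∈ a ∧ (q.1, false) ∉ O) →
      surgeries P a d m O = Finsupp.single (slide {q | q ∈ m} O) 1 := by
  intro m
  induction m with
  | nil =>
    intro O _ _ _ _ _ _
    rw [surgeries]
    congr 1
    ext u
    simp [mem_slide, IsEnd]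
  | cons p m ih =>
    intro O h hs hn hO hsub hm
    rw [List.pairwise_cons] at hs
    rw [List.nodup_cons] at hn
    rw [setOf_mem_cons] at h hO
    have hS := h.isSurgery (m := {q | q ∈ m}) hn.1 hs.1
    have hpa := (hm p (by simp)).1
    -- The sum over the results of the first surgery has a single term, and the remaining small
    -- circles keep their labels, so the induction goes on.
    have hfil : ((P ×ˢ Finset.univ).powerset.filter fun O' => Surgery a d p m O O') =
        {slide {p} O} := by
      ext O'
      rw [Finset.mem_filter, Finset.mem_powerset, Finset.mem_singleton]
      unfold Surgery
      rw [setOf_mem_cons]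
      dsimp only
      rw [if_neg (hS.not_reachable_small hpa)]
      constructor
      · rintro ⟨_, h2⟩
        exact (hS.conditions_iff hpa hO (hm p (by simp)).2).1 h2
      · intro h1
        have h2 : O' ⊆ verts P := h1 ▸ slide_subset hsub
        exact ⟨h2, (hS.conditions_iff hpa hO (hm p (by simp)).2).2 h1⟩
    rw [surgeries, hfil, Finset.sum_singleton, ih hS.after hs.2 hn.2
      (hS.isOrientation_slide hpa hO) (slide_subset hsub)]
    · congr 1
      ext ⟨i, b⟩
      have hend : IsEnd {q | q ∈ p :: m} i ↔ (i = p.1 ∨ i = p.2) ∨ IsEnd {q | q ∈ m} i := by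
        simp [IsEnd]
      simp only [mem_slide, hend, isEnd_singleton]
      cases b <;> grind
    · intro q hq
      refine ⟨(hm q (by simp [hq])).1, ?_⟩
      have hne : q ≠ p := by
        rintro rfl
        exact hn.1 hq
      rw [mem_slide, if_neg]
      · exact (hm q (by simp [hq])).2
      · rintro ⟨_, hc⟩
        rw [isEnd_singleton] at hc
        exact hne (h.middle.eq_of_end (.inr hq) (.inl rfl) (.inl rfl) hc)

/-! ## Linked weights -/

/-- The label is `∨` or `∧`. -/
def Active (o : Option Label) : Prop := o = some .down ∨ o = some .up

theorem Active.ne_none {o : Option Label} (h : Active o) : o ≠ none := by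
  rcases h with rfl | rfl <;> simp

theorem Weight.Linked.symm {w v : Weight} (h : w.Linked v) : v.Linked w := by
  obtain ⟨σ, h1, h2, h3⟩ := h
  refine ⟨σ.symm, ?_, ?_, ?_⟩
  · refine h1.subset fun i hi hc => hi ?_
    rw [Equiv.symm_apply_eq, hc]
  · intro i hi
    have e : v.label i = w.label (σ.symm i) := by rw [← h3, Equiv.apply_symm_apply]
    rw [e]
    refine h2 _ fun hc => hi ?_
    rw [Equiv.apply_symm_apply] at hc
    exact hc.symm
  · intro i
    rw [← h3, Equiv.apply_symm_apply]

theorem Weight.Linked.active_or {w v : Weight} (h : w.Linked v) (i : ℤ) :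
    w.label i = v.label i ∨ (Active (w.label i) ∧ Active (v.label i)) := by
  obtain ⟨σ, h1, h2, h3⟩ := h
  by_cases hi : σ i = i
  · left
    rw [← h3 i, hi]
  · right
    refine ⟨h2 i hi, ?_⟩
    have e : v.label i = w.label (σ.symm i) := by rw [← h3, Equiv.apply_symm_apply]
    rw [e]
    refine h2 _ fun hc => hi ?_
    rw [Equiv.apply_symm_apply] at hc
    exact (Equiv.eq_symm_apply σ).1 hc

theorem Weight.Linked.trans {u w v : Weight} (h : u.Linked w) (h' : w.Linked v) :
    u.Linked v := by
  have ha := h.active_or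
  obtain ⟨σ, h1, h2, h3⟩ := h
  obtain ⟨τ, h1', h2', h3'⟩ := h'
  refine ⟨τ * σ, ?_, ?_, ?_⟩
  · refine (h1.union h1').subset fun i hi => ?_
    by_contra hc
    simp only [Set.mem_union, Set.mem_ofPred_eq, not_or, not_not] at hc
    exact hi (by rw [Equiv.Perm.mul_apply, hc.1, hc.2])
  · intro i hi
    by_cases hc : σ i = i
    · rw [Equiv.Perm.mul_apply, hc] at hi
      have := h2' i hi
      rcases ha i with e | e
      · rwa [e]
      · exact e.1
    · exact h2 i hc
  · intro i
    rw [Equiv.Perm.mul_apply, h3', h3]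

theorem Block.linked {Λ : Block} {w v : Weight} (hw : w ∈ Λ.carrier) (hv : v ∈ Λ.carrier) :
    w.Linked v := by
  obtain ⟨u, hu⟩ := Λ.is_class
  rw [hu] at hw hv
  exact hw.symm.trans hv

theorem Block.mem_of_linked {Λ : Block} {w v : Weight} (hw : w ∈ Λ.carrier) (h : w.Linked v) :
    v ∈ Λ.carrier := by
  obtain ⟨u, hu⟩ := Λ.is_class
  rw [hu] at hw ⊢
  exact hw.trans h

theorem Weight.Linked.line_eq {w v : Weight} (h : w.Linked v) : w.line = v.line := by
  ext i
  simp only [Weight.line, Set.mem_ofPred_eq]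
  rcases h.active_or i with e | e
  · rw [e]
  · exact iff_of_true e.1.ne_none e.2.ne_none

/-- The support of the linking permutation serves as `S`: the permutation maps every larger finite
set onto itself. -/
theorem Weight.Linked.exists_count {w v : Weight} (h : w.Linked v) : ∃ S : Finset ℤ,
    (∀ i ∉ S, w.label i = v.label i) ∧ ∀ T : Finset ℤ, S ⊆ T → ∀ o,
      (T.filter fun i => w.label i = o).card = (T.filter fun i => v.label i = o).card := by
  obtain ⟨σ, h1, h2, h3⟩ := h
  refine ⟨h1.toFinset, ?_, ?_⟩
  · intro i hi
    rw [Set.Finite.mem_toFinset, Set.mem_ofPred_eq, not_not] at hi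
    rw [← h3 i, hi]
  · intro T hT o
    have hσ : ∀ i ∈ T, σ i ∈ T := by
      intro i hi
      by_cases hc : σ i = i
      · rwa [hc]
      · refine hT ?_
        rw [Set.Finite.mem_toFinset]
        exact fun e => hc (σ.injective e)
    have hσ' : ∀ i ∈ T, σ.symm i ∈ T := by
      intro i hi
      by_cases hc : σ.symm i = i
      · rwa [hc]
      · refine hT ?_
        rw [Set.Finite.mem_toFinset, Set.mem_ofPred_eq, Equiv.apply_symm_apply]
        exact fun e => hc e.symm
    refine Finset.card_bij' (fun i _ => σ i) (fun i _ => σ.symm i) ?_ ?_ ?_ ?_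
    · intro i hi
      rw [Finset.mem_filter] at hi ⊢
      exact ⟨hσ i hi.1, by rw [h3, hi.2]⟩
    · intro i hi
      rw [Finset.mem_filter] at hi ⊢
      refine ⟨hσ' i hi.1, ?_⟩
      rw [← h3, Equiv.apply_symm_apply, hi.2]
    · intro i _
      simp
    · intro i _
      simp

/-- Weights that differ in finitely many labels `∨`, `∧`, of which they have the same numbers. -/
theorem Weight.linked_of_count {w v : Weight} (T : Finset ℤ)
    (hT : ∀ i ∉ T, w.label i = v.label i)
    (ha : ∀ i, w.label i = v.label i ∨ (Active (w.label i) ∧ Active (v.label i)))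
    (hc : (T.filter fun i => w.label i = some .up).card =
      (T.filter fun i => v.label i = some .up).card) : w.Linked v := by
  set A := T.filter fun i => w.label i = some .up ∧ v.label i = some .down with hA
  set B := T.filter fun i => w.label i = some .down ∧ v.label i = some .up with hB
  set C := T.filter fun i => w.label i = some .up ∧ v.label i = some .up with hC
  have h1 : (T.filter fun i => w.label i = some .up) = A ∪ C := by
    ext i
    have := ha i
    simp only [Finset.mem_filter, Finset.mem_union, hA, hC, Active] at this ⊢
    grind
  have h2 : (T.filter fun i => v.label i = some .up) = B ∪ C := by
    ext i
    have := ha i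
    simp only [Finset.mem_filter, Finset.mem_union, hB, hC, Active] at this ⊢
    grind
  have hAC : Disjoint A C := by
    rw [Finset.disjoint_left]
    intro i hi hi'
    rw [Finset.mem_filter] at hi hi'
    simp [hi.2.2] at hi'
  have hBC : Disjoint B C := by
    rw [Finset.disjoint_left]
    intro i hi hi'
    rw [Finset.mem_filter] at hi hi'
    simp [hi.2.1] at hi'
  have hAB : ∀ i ∈ A, i ∉ B := by
    intro i hi hi'
    rw [Finset.mem_filter] at hi hi'
    simp [hi.2.1] at hi'
  rw [h1, h2, Finset.card_union_of_disjoint hAC, Finset.card_union_of_disjoint hBC] at hc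
  -- `A` and `B` hold the positions at which ∧ becomes ∨ and vice versa. Equal numbers of ∧ give
  -- equal sizes, and exchanging `A` with `B` along a bijection links the weights.
  have e : A ≃ B := Finset.equivOfCardEq (by omega)
  let s : ℤ → ℤ := fun i =>
    if h : i ∈ A then e ⟨i, h⟩ else if h : i ∈ B then e.symm ⟨i, h⟩ else i
  have sA : ∀ i (h : i ∈ A), s i = e ⟨i, h⟩ := fun i h => dif_pos h
  have sB : ∀ i (h : i ∈ B), s i = e.symm ⟨i, h⟩ := fun i h => by
    simp only [s]
    rw [dif_neg fun h' => hAB i h' h, dif_pos h]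
  have sC : ∀ i, i ∉ A → i ∉ B → s i = i := fun i h h' => by
    simp only [s]
    rw [dif_neg h, dif_neg h']
  have hs : Function.Involutive s := by
    intro i
    by_cases hiA : i ∈ A
    · rw [sA i hiA, sB _ (e ⟨i, hiA⟩).2]
      simp
    by_cases hiB : i ∈ B
    · rw [sB i hiB, sA _ (e.symm ⟨i, hiB⟩).2]
      simp
    rw [sC i hiA hiB, sC i hiA hiB]
  have hmove : ∀ i, s i ≠ i → i ∈ A ∨ i ∈ B := by
    intro i hi
    by_contra hc
    rw [not_or] at hc
    exact hi (sC i hc.1 hc.2)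
  refine ⟨hs.toPerm s, ?_, ?_, ?_⟩
  · refine T.finite_toSet.subset fun i hi => ?_
    rcases hmove i hi with h | h
    · exact (Finset.mem_filter.1 h).1
    · exact (Finset.mem_filter.1 h).1
  · intro i hi
    rcases hmove i hi with h | h
    · exact .inr (Finset.mem_filter.1 h).2.1
    · exact .inl (Finset.mem_filter.1 h).2.1
  · intro i
    change v.label (s i) = w.label i
    by_cases hiA : i ∈ A
    · rw [sA i hiA, (Finset.mem_filter.1 hiA).2.1, (Finset.mem_filter.1 (e ⟨i, hiA⟩).2).2.2]
    by_cases hiB : i ∈ B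
    · rw [sB i hiB, (Finset.mem_filter.1 hiB).2.1,
        (Finset.mem_filter.1 (e.symm ⟨i, hiB⟩).2).2.2]
    rw [sC i hiA hiB]
    by_cases hiT : i ∈ T
    · have := ha i
      simp only [hA, hB, Finset.mem_filter, Active] at this hiA hiB
      grind
    · exact (hT i hiT).symm

/-! ## Orientations of a cup diagram -/

theorem ArcDiagram.nonCrossing (a : ArcDiagram) : NonCrossing (a.arcs : Set (ℤ × ℤ)) :=
  ⟨a.arc_lt, a.arc_arc⟩

/-- Every arc in `s` has one end labelled `∨` and one labelled `∧`. -/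
def Alternates (s : Set (ℤ × ℤ)) (f : Labelling) : Prop :=
  ∀ p ∈ s, (f p.1 = some .down ∧ f p.2 = some .up) ∨ (f p.1 = some .up ∧ f p.2 = some .down)

theorem Alternates.mate {s : Set (ℤ × ℤ)} {f : Labelling} (hf : Alternates s f)
    (hs : NonCrossing s) {i : ℤ} (hi : IsEnd s i) :
    (f i = some .down ∧ f (mate s i) = some .up) ∨
      (f i = some .up ∧ f (mate s i) = some .down) := by
  obtain ⟨p, hp, rfl | rfl⟩ := hi
  · rw [hs.mate_fst hp]
    exact hf p hp
  · rw [hs.mate_snd hp]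
    have := hf p hp
    tauto

theorem Alternates.active {s : Set (ℤ × ℤ)} {f : Labelling} (hf : Alternates s f) {i : ℤ}
    (hi : IsEnd s i) : Active (f i) := by
  obtain ⟨p, hp, rfl | rfl⟩ := hi
  · exact (hf p hp).imp And.left And.left
  · exact (hf p hp).symm.imp And.right And.right

/-- Every arc has one end with each of the labels ∨, ∧ in both labellings, so the differences at its
two ends cancel. -/
theorem ends_subset_count {s : Set (ℤ × ℤ)} (hs : NonCrossing s) {f g : Labelling}
    (hf : Alternates s f) (hg : Alternates s g) {T : Finset ℤ} (hT : ∀ i, IsEnd s i → i ∈ T)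
    (o : Option Label) : ((T.filter fun i => f i = o ∧ IsEnd s i).card : ℤ) =
      (T.filter fun i => g i = o ∧ IsEnd s i).card := by
  have key : ∑ i ∈ T.filter (fun i => IsEnd s i),
      ((if f i = o then (1 : ℤ) else 0) - if g i = o then 1 else 0) = 0 := by
    refine sum_eq_zero_of_pairing (U := KhovanovArc.mate s) ?_ ?_ ?_ ?_
    · intro i hi
      rw [Finset.mem_filter] at hi ⊢
      exact ⟨hT _ (hs.isEnd_mate hi.2), hs.isEnd_mate hi.2⟩
    · exact fun i hi => hs.mate_ne (Finset.mem_filter.1 hi).2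
    · exact fun i hi => hs.mate_mate i
    · intro i hi
      have h1 := hf.mate hs (Finset.mem_filter.1 hi).2
      have h2 := hg.mate hs (Finset.mem_filter.1 hi).2
      rcases h1 with ⟨h1, h1'⟩ | ⟨h1, h1'⟩ <;> rcases h2 with ⟨h2, h2'⟩ | ⟨h2, h2'⟩ <;>
        simp [h1, h1', h2, h2']
  rw [Finset.sum_sub_distrib, Finset.sum_boole, Finset.sum_boole, Finset.filter_filter,
    Finset.filter_filter] at key
  simp only [and_comm (b := IsEnd s _)]
  linarith

theorem count_eq_of_alternates {s : Set (ℤ × ℤ)} (hs : NonCrossing s) {f g : Labelling}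
    (hf : Alternates s f) (hg : Alternates s g) {T : Finset ℤ} (hT : ∀ i, IsEnd s i → i ∈ T)
    (hfg : ∀ i, ¬ IsEnd s i → f i = g i) (o : Option Label) :
    (T.filter fun i => f i = o).card = (T.filter fun i => g i = o).card := by
  have h1 := ends_subset_count hs hf hg hT o
  have h2 : (T.filter fun i => f i = o ∧ ¬ IsEnd s i) =
      T.filter fun i => g i = o ∧ ¬ IsEnd s i := by
    refine Finset.filter_congr fun i _ => and_congr_left fun hi => ?_
    rw [hfg i hi]
  have h3 := Finset.card_filter_add_card_filter_not (s := T.filter fun i => f i = o) (IsEnd s)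
  have h4 := Finset.card_filter_add_card_filter_not (s := T.filter fun i => g i = o) (IsEnd s)
  rw [Finset.filter_filter, Finset.filter_filter] at h3 h4
  rw [← h3, ← h4, h2]
  omega

theorem exists_ends (s : Finset (ℤ × ℤ)) : ∃ E : Finset ℤ, ∀ i, i ∈ E ↔ IsEnd s i := by
  refine ⟨s.image Prod.fst ∪ s.image Prod.snd, fun i => ?_⟩
  simp only [Finset.mem_union, Finset.mem_image, IsEnd, Finset.mem_coe]
  constructor
  · rintro (⟨p, hp, rfl⟩ | ⟨p, hp, rfl⟩)
    · exact ⟨p, hp, .inl rfl⟩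
    · exact ⟨p, hp, .inr rfl⟩
  · rintro ⟨p, hp, rfl | rfl⟩
    · exact .inl ⟨p, hp, rfl⟩
    · exact .inr ⟨p, hp, rfl⟩

namespace ArcDiagram.Oriented

variable {a : ArcDiagram} {w v : Weight}

theorem alternates (h : a.Oriented w) : Alternates a.arcs w.label := h.arcs

theorem mem_rays (h : a.Oriented w) {i : ℤ} (hi : ¬ IsEnd a.arcs i) (ha : Active (w.label i)) :
    i ∈ a.rays := by
  by_contra hc
  have hl : i ∈ a.line := by
    rw [h.line_eq]
    exact ha.ne_none
  have := h.free i hl hi hc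
  rcases ha with e | e <;> simp [e] at this

theorem not_isEnd_of_mem_rays {i : ℤ} (hi : i ∈ a.rays) : ¬ IsEnd a.arcs i := by
  rintro ⟨p, hp, rfl | rfl⟩
  · have := a.arc_ray p hp _ hi
    have := a.arc_lt p hp
    omega
  · have := a.arc_ray p hp _ hi
    have := a.arc_lt p hp
    omega

/-- The ends of arcs carry equally many ∧ in both weights, hence so do the rays. On rays all ∧ come
before all ∨. If ray `i` were ∨ in `w` and ∧ in `v`, then every ray labelled ∧ in `w` would lie left
of `i` and be ∧ in `v` too, and `v` would have at least one more. -/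
theorem ray_label_aux (h : a.Oriented w) (h' : a.Oriented v) (hl : w.Linked v) {i : ℤ}
    (hi : ¬ IsEnd a.arcs i) (hw : w.label i = some .down) : v.label i ≠ some .up := by
  intro hv
  obtain ⟨S, hS, hcount⟩ := hl.exists_count
  obtain ⟨E, hE⟩ := exists_ends a.arcs
  set T := insert i (S ∪ E)
  have hTE : ∀ j, IsEnd a.arcs j → j ∈ T := fun j hj => by simp [T, (hE j).2 hj]
  have hiT : i ∈ T := by simp [T]
  have h1 := hcount T (fun j hj => by simp [T, hj]) (some .up)
  have h2 := ends_subset_count a.nonCrossing h.alternates h'.alternates hTE (some .up)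
  have h3 := Finset.card_filter_add_card_filter_not (s := T.filter fun i => w.label i = some .up)
    (IsEnd a.arcs)
  have h4 := Finset.card_filter_add_card_filter_not (s := T.filter fun i => v.label i = some .up)
    (IsEnd a.arcs)
  rw [Finset.filter_filter, Finset.filter_filter] at h3 h4
  have h5 : (T.filter fun j => w.label j = some .up ∧ ¬ IsEnd a.arcs j).card <
      (T.filter fun j => v.label j = some .up ∧ ¬ IsEnd a.arcs j).card := by
    refine Finset.card_lt_card ⟨fun j hj => ?_, fun hsub => ?_⟩
    · rw [Finset.mem_filter] at hj ⊢
      refine ⟨hj.1, ?_, hj.2.2⟩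
      have hjr := h.mem_rays hj.2.2 (.inr hj.2.1)
      have hir := h.mem_rays hi (.inl hw)
      rcases lt_trichotomy i j with hij | rfl | hij
      · exact absurd ⟨hw, hj.2.1⟩ (h.rays_sorted i hir j hjr hij)
      · exact hv
      · rcases h'.rays j hjr with e | e
        · exact absurd ⟨e, hv⟩ (h'.rays_sorted j hjr i hir hij)
        · exact e
    · have := hsub (Finset.mem_filter.2 ⟨hiT, hv, hi⟩)
      rw [Finset.mem_filter, hw] at this
      simp at this
  omega

/-- Orientations of a cup diagram by weights of the same block agree outside the cups. -/
theorem label_eq (h : a.Oriented w) (h' : a.Oriented v) (hl : w.Linked v) {i : ℤ}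
    (hi : ¬ IsEnd a.arcs i) : w.label i = v.label i := by
  rcases hl.active_or i with e | ⟨e | e, e' | e'⟩
  · exact e
  · rw [e, e']
  · exact absurd e' (h.ray_label_aux h' hl hi e)
  · exact absurd e (h'.ray_label_aux h hl.symm hi e')
  · rw [e, e']

end ArcDiagram.Oriented

namespace ArcDiagram

variable {a : ArcDiagram} {w v : Weight}

theorem reverse_fst {p : ℤ × ℤ} (hp : p ∈ a.arcs) : a.reverse w p.1 = some .down :=
  if_pos ⟨p, hp, rfl⟩

theorem reverse_snd {p : ℤ × ℤ} (hp : p ∈ a.arcs) : a.reverse w p.2 = some .up := by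
  unfold reverse
  rw [if_neg, if_pos ⟨p, hp, rfl⟩]
  rintro ⟨q, hq, e⟩
  have h1 := a.nonCrossing.eq_of_end hp hq (.inr rfl) (.inl e)
  subst h1
  exact (a.arc_lt p hp).ne' e

theorem reverse_of_not_isEnd {i : ℤ} (hi : ¬ IsEnd a.arcs i) : a.reverse w i = w.label i := by
  unfold reverse
  rw [if_neg, if_neg]
  · rintro ⟨q, hq, e⟩
    exact hi ⟨q, hq, .inr e⟩
  · rintro ⟨q, hq, e⟩
    exact hi ⟨q, hq, .inl e⟩

theorem alternates_reverse : Alternates a.arcs (a.reverse w) :=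
  fun _ hp => .inl ⟨reverse_fst hp, reverse_snd hp⟩

/-- Thus the reversed labelling, and with it the closure of `a`, depends only on `a` and the block
and not on the weight that orients `a`. -/
theorem reverse_eq (h : a.Oriented w) (h' : a.Oriented v) (hl : w.Linked v) :
    a.reverse w = a.reverse v := by
  funext i
  by_cases hi : IsEnd a.arcs i
  · obtain ⟨p, hp, rfl | rfl⟩ := hi
    · rw [reverse_fst hp, reverse_fst hp]
    · rw [reverse_snd hp, reverse_snd hp]
  · rw [reverse_of_not_isEnd hi, reverse_of_not_isEnd hi, h.label_eq h' hl hi]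

/-- No ray lies under an arc, so below `p` the sign merely records whether a vertex is a left end, a
right end or neither. In this form partial sums become sums over arcs. -/
theorem sgn_reverse (h : a.Oriented w) {p : ℤ × ℤ} (hp : p ∈ a.arcs) {i : ℤ} (h1 : p.1 ≤ i)
    (h2 : i ≤ p.2) : sgn (a.reverse w i) =
      ∑ q ∈ a.arcs, ((if q.1 = i then 1 else 0) - if q.2 = i then 1 else 0) := by
  by_cases hi : IsEnd a.arcs i
  · obtain ⟨q, hq, hqi⟩ := hi
    rw [Finset.sum_eq_single_of_mem q hq]
    · have := a.arc_lt q hq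
      rcases hqi with rfl | rfl
      · rw [reverse_fst hq, if_pos rfl, if_neg this.ne']
        rfl
      · rw [reverse_snd hq, if_pos rfl, if_neg this.ne]
        rfl
    · intro r hr hne
      have : ¬ (i = r.1 ∨ i = r.2) := fun e => hne (a.nonCrossing.eq_of_end hr hq e hqi)
      rw [if_neg (by omega), if_neg (by omega), sub_zero]
  · rw [Finset.sum_eq_zero, reverse_of_not_isEnd hi]
    · have hna : ¬ Active (w.label i) := by
        intro hc
        have := a.arc_ray p hp i (h.mem_rays hi hc)
        omega
      rcases sgn_step (w.label i) with e | e | e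
      · exact absurd (.inl e.2) hna
      · exact absurd (.inr e.2) hna
      · exact e.1
    · intro r hr
      have : ¬ (i = r.1 ∨ i = r.2) := fun e => hi ⟨r, hr, e⟩
      rw [if_neg (by omega), if_neg (by omega), sub_zero]

theorem sum_sgn_reverse (h : a.Oriented w) {p : ℤ × ℤ} (hp : p ∈ a.arcs) {k : ℤ}
    (h2 : k ≤ p.2) : ∑ i ∈ Finset.Icc p.1 k, sgn (a.reverse w i) =
      ∑ q ∈ a.arcs, ((if p.1 ≤ q.1 ∧ q.1 ≤ k then 1 else 0) -
        if p.1 ≤ q.2 ∧ q.2 ≤ k then 1 else 0) := by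
  rw [Finset.sum_congr rfl fun i hi => sgn_reverse h hp (Finset.mem_Icc.1 hi).1
    ((Finset.mem_Icc.1 hi).2.trans h2), Finset.sum_comm]
  refine Finset.sum_congr rfl fun q _ => ?_
  rw [Finset.sum_sub_distrib, Finset.sum_ite_eq, Finset.sum_ite_eq]
  simp only [Finset.mem_Icc]

/-- In a partial sum starting at `p.1`, arcs other than `p` contribute `0` or `1`, and `p`
contributes `1` until its right end is reached. In the complete sum all contributions vanish. -/
theorem joined_of_mem_arcs (h : a.Oriented w) {p : ℤ × ℤ} (hp : p ∈ a.arcs) :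
    Joined (a.reverse w) p.1 p.2 := by
  have hlt := a.arc_lt p hp
  refine ⟨hlt, reverse_fst hp, reverse_snd hp, ?_, ?_⟩
  · rw [sum_sgn_reverse h hp le_rfl]
    refine Finset.sum_eq_zero fun q hq => ?_
    have := a.arc_lt q hq
    by_cases hpq : p = q
    · subst hpq
      rw [if_pos (by omega), if_pos (by omega), sub_self]
    · have := a.arc_arc p hp q hq hpq
      by_cases hc : p.1 ≤ q.1 ∧ q.1 ≤ p.2
      · rw [if_pos hc, if_pos (by omega), sub_self]
      · rw [if_neg hc, if_neg (by omega), sub_self]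
  · intro k h1 h2
    rw [sum_sgn_reverse h hp h2.le]
    refine Finset.sum_pos' (fun q hq => ?_) ⟨p, hp, ?_⟩
    · have := a.arc_lt q hq
      by_cases hpq : p = q
      · subst hpq
        rw [if_pos (by omega), if_neg (by omega)]
        norm_num
      · have := a.arc_arc p hp q hq hpq
        split_ifs <;> omega
    · rw [if_pos (by omega), if_neg (by omega)]
      norm_num

theorem _root_.KhovanovArc.Joined.right_unique {f : Labelling} {i j k : ℤ} (h : Joined f i j)
    (h' : Joined f i k) : j = k := by
  rcases h.eq_or_apart h' le_rfl with e | e | e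
  · exact e.2
  · have := h.1
    omega
  · omega

theorem _root_.KhovanovArc.Joined.left_unique {f : Labelling} {i j k : ℤ} (h : Joined f i k)
    (h' : Joined f j k) : i = j := by
  have := h.1
  have := h'.1
  rcases le_total i j with hij | hij
  · rcases h.eq_or_apart h' hij with e | e | e <;> omega
  · rcases h'.eq_or_apart h hij with e | e | e <;> omega

/-- A joined pair that shares an end with an arc of `a` equals that arc by uniqueness of partners.
Otherwise it would consist of two rays labelled ∨ ∧ in this order, which an orientation forbids. -/
theorem joined_reverse_iff (h : a.Oriented w) {i j : ℤ} :
    Joined (a.reverse w) i j ↔ (i, j) ∈ a.arcs := by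
  refine ⟨fun hj => ?_, fun hp => joined_of_mem_arcs h hp⟩
  by_cases hi : IsEnd a.arcs i
  · obtain ⟨q, hq, rfl | rfl⟩ := hi
    · rwa [hj.right_unique (joined_of_mem_arcs h hq)]
    · have := hj.2.1
      rw [reverse_snd hq] at this
      simp at this
  by_cases hk : IsEnd a.arcs j
  · obtain ⟨q, hq, rfl | rfl⟩ := hk
    · have := hj.2.2.1
      rw [reverse_fst hq] at this
      simp at this
    · rwa [hj.left_unique (joined_of_mem_arcs h hq)]
  have h1 := hj.2.1
  have h2 := hj.2.2.1
  rw [reverse_of_not_isEnd hi] at h1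
  rw [reverse_of_not_isEnd hk] at h2
  exact absurd ⟨h1, h2⟩ (h.rays_sorted i (h.mem_rays hi (.inl h1)) j
    (h.mem_rays hk (.inr h2)) hj.1)

theorem active_reverse (h : a.Oriented w) (i : ℤ) :
    w.label i = a.reverse w i ∨ (Active (w.label i) ∧ Active (a.reverse w i)) := by
  by_cases hi : IsEnd a.arcs i
  · exact .inr ⟨h.alternates.active hi, alternates_reverse.active hi⟩
  · rw [reverse_of_not_isEnd hi]
    exact .inl rfl

/-- The weight `v` with `v̲ = a` and `v ⊂ w`, if `a w` is oriented. -/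
def source (a : ArcDiagram) (w : Weight) (h : a.Oriented w) : Weight where
  label := a.reverse w
  consecutive := by
    convert w.consecutive using 1
    ext i
    simp only [Set.mem_ofPred_eq]
    rcases active_reverse h i with e | e
    · rw [e]
    · exact iff_of_true e.2.ne_none e.1.ne_none
  almost_sorted := by
    obtain ⟨F, hF, hs⟩ := w.almost_sorted
    obtain ⟨E, hE⟩ := exists_ends a.arcs
    refine ⟨F ∪ E, hF.union E.finite_toSet, fun i j hi hj hij => ?_⟩
    rw [Set.mem_union, not_or, Finset.mem_coe, hE] at hi hj
    rw [reverse_of_not_isEnd hi.2, reverse_of_not_isEnd hj.2]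
    exact hs i j hi.1 hj.1 hij

theorem linked_source (h : a.Oriented w) : w.Linked (a.source w h) := by
  obtain ⟨E, hE⟩ := exists_ends a.arcs
  refine Weight.linked_of_count E (fun i hi => ?_) (active_reverse h) ?_
  · rw [hE] at hi
    exact (reverse_of_not_isEnd hi).symm
  · exact count_eq_of_alternates a.nonCrossing h.alternates alternates_reverse
      (fun i => (hE i).2) (fun i hi => (reverse_of_not_isEnd hi).symm) _

theorem mem_underline_arcs {w : Weight} {p : ℤ × ℤ} :
    p ∈ w.underline.arcs ↔ Joined w.label p.1 p.2 := by
  rw [Weight.underline, Set.Finite.mem_toFinset]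
  rfl

/-- This identifies the oriented cup diagrams on `w` with the weights `v ⊂ w`, and hence the basis
of the cell module with the index set in the theorem. -/
theorem underline_source (h : a.Oriented w) : (a.source w h).underline = a := by
  have hj : ∀ {i j}, Joined (a.source w h).label i j ↔ (i, j) ∈ a.arcs :=
    joined_reverse_iff h
  refine ArcDiagram.ext ?_ ?_ ?_
  · rw [h.line_eq]
    exact (linked_source h).line_eq.symm
  · ext p
    rw [mem_underline_arcs, hj]
  · ext i
    have hend : (∀ j, ¬ Joined (a.source w h).label i j ∧ ¬ Joined (a.source w h).label j i) ↔
        ¬ IsEnd a.arcs i := by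
      simp only [hj, IsEnd]
      constructor
      · rintro h1 ⟨q, hq, rfl | rfl⟩
        · exact (h1 q.2).1 hq
        · exact (h1 q.1).2 hq
      · exact fun h1 j => ⟨fun h2 => h1 ⟨_, h2, .inl rfl⟩, fun h2 => h1 ⟨_, h2, .inr rfl⟩⟩
    change (Active ((a.source w h).label i) ∧
      ∀ j, ¬ Joined (a.source w h).label i j ∧ ¬ Joined (a.source w h).label j i) ↔ _
    rw [hend]
    constructor
    · rintro ⟨h1, h2⟩
      change Active (a.reverse w i) at h1
      rw [reverse_of_not_isEnd h2] at h1
      exact h.mem_rays h2 h1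
    · intro hi
      have h2 := Oriented.not_isEnd_of_mem_rays hi
      refine ⟨?_, h2⟩
      change Active (a.reverse w i)
      rw [reverse_of_not_isEnd h2]
      exact h.rays i hi

theorem reverse_underline (w : Weight) : w.underline.reverse w = w.label := by
  funext i
  by_cases hi : IsEnd w.underline.arcs i
  · obtain ⟨p, hp, rfl | rfl⟩ := hi
    · rw [reverse_fst hp, (mem_underline_arcs.1 hp).2.1]
    · rw [reverse_snd hp, (mem_underline_arcs.1 hp).2.2.1]
  · rw [reverse_of_not_isEnd hi]

/-- The diagram `v̲` determines the weight `v` within its block. -/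
theorem underline_injective {v v' : Weight} (hl : v.Linked v')
    (h : v.underline = v'.underline) : v = v' := by
  have h1 := v'.underline_oriented
  rw [← h] at h1
  have := reverse_eq v.underline_oriented h1 hl
  rw [reverse_underline] at this
  rw [h, reverse_underline] at this
  exact Weight.ext this

/-- Without clockwise cups there is nothing to reverse, so `a.source w h` is `w` itself. -/
theorem eq_underline_of_deg {h : a.Oriented w} (hd : a.deg w = 0) : a = w.underline := by
  rw [deg, Finset.card_eq_zero, Finset.filter_eq_empty_iff] at hd
  have : a.source w h = w := by
    refine Weight.ext ?_
    funext i
    change a.reverse w i = w.label i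
    by_cases hi : IsEnd a.arcs i
    · obtain ⟨p, hp, rfl | rfl⟩ := hi
      · rw [reverse_fst hp]
        rcases h.arcs p hp with e | e
        · exact e.1.symm
        · exact absurd e.1 (hd hp)
      · rw [reverse_snd hp]
        rcases h.arcs p hp with e | e
        · exact e.2.symm
        · exact absurd e.1 (hd hp)
    · exact reverse_of_not_isEnd hi
  rw [← underline_source h, this]

end ArcDiagram

/-! ## Closures -/

theorem sum_sgn (f : Labelling) (T : Finset ℤ) : ∑ i ∈ T, sgn (f i) =
    ((T.filter fun i => f i = some .down).card : ℤ) -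
      (T.filter fun i => f i = some .up).card := by
  rw [← Finset.sum_boole, ← Finset.sum_boole, ← Finset.sum_sub_distrib]
  refine Finset.sum_congr rfl fun i _ => ?_
  rcases f i with _ | (_ | _ | _ | _) <;> simp [sgn]

section Close

variable {l r : ℤ} {f g : Labelling}

theorem close_mid {i : ℤ} (h : l ≤ i ∧ i ≤ r) : close l r f i = f i := if_pos h

theorem close_left {i : ℤ} (h : closeLeft l r f ≤ i) (h' : i < l) :
    close l r f i = some .down := by
  rw [close, if_neg (by omega), if_pos ⟨h, h'⟩]

theorem close_right {i : ℤ} (hlr : l ≤ r) (h : r < i) (h' : i ≤ closeRight l r f) :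
    close l r f i = some .up := by
  rw [close, if_neg (by omega), if_neg (by omega), if_pos ⟨h, h'⟩]

theorem close_outside {i : ℤ} (h : close l r f i ≠ none) :
    (l ≤ i ∧ i ≤ r) ∨ closeLeft l r f ≤ i ∧ i < l ∨ r < i ∧ i ≤ closeRight l r f := by
  by_contra hc
  simp only [not_or] at hc
  rw [close, if_neg hc.1, if_neg hc.2.1, if_neg hc.2.2] at h
  exact h rfl

theorem closeLeft_le : closeLeft l r f ≤ l := by
  unfold closeLeft
  omega

theorem le_closeRight : r ≤ closeRight l r f := by
  unfold closeRight
  omega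

theorem close_bounds (hlr : l ≤ r) {i : ℤ} (h : close l r f i ≠ none) :
    closeLeft l r f ≤ i ∧ i ≤ closeRight l r f := by
  have := close_outside h
  have := closeLeft_le (l := l) (r := r) (f := f)
  have := le_closeRight (l := l) (r := r) (f := f)
  omega

theorem mem_closePoints (hlr : l ≤ r) {i : ℤ} :
    i ∈ closePoints l r f ↔ Active (close l r f i) := by
  rw [closePoints, Finset.mem_filter, Finset.mem_Icc]
  exact ⟨fun h => h.2, fun h => ⟨close_bounds hlr h.ne_none, h⟩⟩

theorem mem_closeUps (hlr : l ≤ r) {i : ℤ} :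
    i ∈ closeUps l r f ↔ close l r f i = some .up := by
  rw [closeUps, Finset.mem_filter, Finset.mem_Icc]
  exact ⟨fun h => h.2, fun h => ⟨close_bounds hlr (by simp [h]), h⟩⟩

/-- The closures of two labellings differ at most in the window. -/
theorem close_eq_or (hc : ∀ o, count f l r o = count g l r o) (i : ℤ) :
    (l ≤ i ∧ i ≤ r) ∨ close l r f i = close l r g i := by
  by_cases hi : l ≤ i ∧ i ≤ r
  · exact .inl hi
  · right
    rw [close, close, closeLeft, closeLeft, closeRight, closeRight, hc, hc, if_neg hi, if_neg hi]

theorem close_active_or (hc : ∀ o, count f l r o = count g l r o)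
    (ha : ∀ i, f i = g i ∨ (Active (f i) ∧ Active (g i))) (i : ℤ) :
    close l r f i = close l r g i ∨ (Active (close l r f i) ∧ Active (close l r g i)) := by
  rcases close_eq_or hc i with hi | hi
  · rw [close_mid hi, close_mid hi]
    exact ha i
  · exact .inl hi

theorem closePoints_congr (hlr : l ≤ r) (hc : ∀ o, count f l r o = count g l r o)
    (ha : ∀ i, f i = g i ∨ (Active (f i) ∧ Active (g i))) :
    closePoints l r f = closePoints l r g := by
  ext i
  rw [mem_closePoints hlr, mem_closePoints hlr]
  rcases close_active_or hc ha i with h | h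
  · rw [h]
  · exact iff_of_true h.1 h.2

theorem sum_close_left {k : ℤ} (h1 : closeLeft l r f ≤ k) (h2 : k ≤ l) :
    ∑ i ∈ Finset.Icc k (l - 1), sgn (close l r f i) = l - k := by
  rw [Finset.sum_congr (g := fun _ => 1) rfl]
  · rw [Finset.sum_const, Int.card_Icc]
    simp only [nsmul_eq_mul, mul_one]
    omega
  · intro i hi
    rw [Finset.mem_Icc] at hi
    rw [close_left (by omega) (by omega)]
    rfl

theorem sum_close_right {k : ℤ} (hlr : l ≤ r) (h1 : r ≤ k) (h2 : k ≤ closeRight l r f) :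
    ∑ i ∈ Finset.Icc (r + 1) k, sgn (close l r f i) = -(k - r) := by
  rw [Finset.sum_congr (g := fun _ => -1) rfl]
  · rw [Finset.sum_const, Int.card_Icc]
    simp only [nsmul_eq_mul, mul_neg, mul_one]
    omega
  · intro i hi
    rw [Finset.mem_Icc] at hi
    rw [close_right hlr (by omega) (by omega)]
    rfl

theorem sum_close_mid {i k : ℤ} (h1 : l ≤ i) (h2 : k ≤ r) :
    ∑ j ∈ Finset.Icc i k, sgn (close l r f j) =
      (((Finset.Icc i k).filter fun i => f i = some .down).card : ℤ) -
      ((Finset.Icc i k).filter fun i => f i = some .up).card := by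
  rw [← sum_sgn]
  refine Finset.sum_congr rfl fun j hj => ?_
  rw [Finset.mem_Icc] at hj
  rw [close_mid (by omega)]

theorem count_mono {i k : ℤ} (h1 : l ≤ i) (h2 : k ≤ r) (o : Label) :
    ((Finset.Icc i k).filter fun i => f i = some o).card ≤ count f l r o :=
  Finset.card_le_card (Finset.filter_subset_filter _ (Finset.Icc_subset_Icc h1 h2))

/-- The closure leaves no rays. From any ∨ to the right end of the closed line the sum is at most
`0`, since the new ∧ outweigh the old ∨ and the old ∧ outweigh the new ∨. The mirror image of this
argument treats a ∧. -/
theorem exists_joined_close (hlr : l ≤ r) {k : ℤ} (hk : Active (close l r f k)) :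
    ∃ j, Joined (close l r f) k j ∨ Joined (close l r f) j k := by
  have hL := closeLeft_le (l := l) (r := r) (f := f)
  have hR := le_closeRight (l := l) (r := r) (f := f)
  have eL : closeLeft l r f = l - count f l r .up := rfl
  have eR : closeRight l r f = r + count f l r .down := rfl
  have hb := close_outside hk.ne_none
  have htot := sum_close_mid (f := f) (le_refl l) (le_refl r)
  have htot' : ∑ j ∈ Finset.Icc l r, sgn (close l r f j) =
    (count f l r .down : ℤ) - count f l r .up := htot
  have hright := sum_close_right (f := f) hlr hR le_rfl
  have hleft := sum_close_left (f := f) le_rfl hL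
  rcases hk with hk | hk
  · have hkr : k ≤ r := by
      by_contra hc
      rw [close_right hlr (by omega) (by omega)] at hk
      simp at hk
    obtain ⟨j, -, hj⟩ := exists_joined_right hk (hkr.trans hR) (by
      rw [sum_split _ (k := r) (by omega) hR, hright]
      by_cases hkl : k < l
      · rw [sum_split _ (k := l - 1) (by omega) (by omega), sub_add_cancel, htot',
          sum_close_left (by omega) hkl.le]
        omega
      · rw [sum_close_mid (by omega) le_rfl]
        have := count_mono (f := f) (l := l) (r := r) (i := k) (by omega) le_rfl .down
        omega)
    exact ⟨j, .inl hj⟩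
  · have hkl : l ≤ k := by
      by_contra hc
      rw [close_left (by omega) (by omega)] at hk
      simp at hk
    obtain ⟨j, -, hj⟩ := exists_joined_left hk (hL.trans hkl) (by
      rw [sum_split _ (k := l - 1) (by omega) (by omega), sub_add_cancel, hleft]
      by_cases hkr : r < k
      · rw [sum_split _ (k := r) (by omega) (by omega), htot',
          sum_close_right hlr hkr.le (by omega)]
        omega
      · rw [sum_close_mid le_rfl (by omega)]
        have := count_mono (f := f) (l := l) (r := r) (k := k) le_rfl (by omega) .up
        omega)
    exact ⟨j, .inr hj⟩

end Close

theorem nonCrossing_joined (f : Labelling) : NonCrossing {p : ℤ × ℤ | Joined f p.1 p.2} := by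
  refine ⟨fun p hp => hp.1, fun p hp q hq hpq => ?_⟩
  rcases le_total p.1 q.1 with h | h
  · rcases hp.eq_or_apart hq h with h | h | h
    · exact absurd (Prod.ext h.1 h.2) hpq
    · exact .inl h
    · exact .inr (.inr (.inl h))
  · rcases hq.eq_or_apart hp h with h | h | h
    · exact absurd (Prod.ext h.1.symm h.2.symm) hpq
    · exact .inr (.inl h)
    · exact .inr (.inr (.inr h))

section CloseArcs

variable {l r : ℤ} {a : ArcDiagram} {w v : Weight}

theorem mem_closeArcs (hlr : l ≤ r) {p : ℤ × ℤ} :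
    p ∈ closeArcs l r a w ↔ Joined (close l r (a.reverse w)) p.1 p.2 := by
  simp only [closeArcs, Finset.mem_filter, Finset.mem_product, Finset.mem_Icc]
  refine ⟨fun h => h.2, fun h => ⟨⟨?_, ?_⟩, h⟩⟩
  · exact close_bounds hlr (by simp [h.2.1])
  · exact close_bounds hlr (by simp [h.2.2.1])

theorem nonCrossing_closeArcs (hlr : l ≤ r) :
    NonCrossing (closeArcs l r a w : Set (ℤ × ℤ)) := by
  convert nonCrossing_joined (close l r (a.reverse w)) using 1
  ext p
  exact mem_closeArcs hlr

variable (hin : ∀ i, IsEnd a.arcs i → l ≤ i ∧ i ≤ r) (h : a.Oriented w) (hv : a.Oriented v)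
  (hl : w.Linked v)
include hin h

theorem count_reverse (o : Label) : count (a.reverse w) l r o = count w.label l r o :=
  count_eq_of_alternates a.nonCrossing ArcDiagram.alternates_reverse h.alternates
    (fun i hi => Finset.mem_Icc.2 (hin i hi)) (fun _ hi => ArcDiagram.reverse_of_not_isEnd hi) _

theorem closePoints_reverse (hlr : l ≤ r) :
    closePoints l r (a.reverse w) = closePoints l r w.label :=
  closePoints_congr hlr (count_reverse hin h) fun i =>
    (ArcDiagram.active_reverse h i).imp Eq.symm And.symm

theorem isEnd_closeArcs (hlr : l ≤ r) (i : ℤ) :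
    IsEnd (closeArcs l r a w) i ↔ i ∈ closePoints l r w.label := by
  rw [← closePoints_reverse hin h hlr, mem_closePoints hlr]
  constructor
  · rintro ⟨p, hp, rfl | rfl⟩
    · exact .inl ((mem_closeArcs hlr).1 hp).2.1
    · exact .inr ((mem_closeArcs hlr).1 hp).2.2.1
  · intro hi
    obtain ⟨j, hj | hj⟩ := exists_joined_close hlr hi
    · exact ⟨(i, j), (mem_closeArcs hlr).2 hj, .inl rfl⟩
    · exact ⟨(j, i), (mem_closeArcs hlr).2 hj, .inr rfl⟩

theorem arcs_subset_closeArcs (hlr : l ≤ r) : a.arcs ⊆ closeArcs l r a w := by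
  intro p hp
  have h1 := hin _ (isEnd_fst (s := (a.arcs : Set (ℤ × ℤ))) hp)
  have h2 := hin _ (isEnd_snd (s := (a.arcs : Set (ℤ × ℤ))) hp)
  have hj := ArcDiagram.joined_of_mem_arcs h hp
  have hsum : ∀ k, k ≤ p.2 → ∑ m ∈ Finset.Icc p.1 k, sgn (close l r (a.reverse w) m) =
      ∑ m ∈ Finset.Icc p.1 k, sgn (a.reverse w m) := by
    intro k hk
    refine Finset.sum_congr rfl fun m hm => ?_
    rw [Finset.mem_Icc] at hm
    rw [close_mid (by omega)]
  rw [mem_closeArcs hlr]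
  refine ⟨hj.1, ?_, ?_, ?_, ?_⟩
  · rw [close_mid h1]
    exact hj.2.1
  · rw [close_mid h2]
    exact hj.2.2.1
  · rw [hsum _ le_rfl]
    exact hj.2.2.2.1
  · intro k h3 h4
    rw [hsum k h4.le]
    exact hj.2.2.2.2 k h3 h4

include hv hl

theorem count_eq (o : Label) : count w.label l r o = count v.label l r o := by
  rw [← count_reverse hin h, ← count_reverse hin hv, ArcDiagram.reverse_eq h hv hl]

/-- Arcs created by the closure are anti-clockwise. -/
theorem closeArcs_cases (hlr : l ≤ r) {p : ℤ × ℤ} (hp : p ∈ closeArcs l r a w) :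
    p ∈ a.arcs ∨ (close l r v.label p.1 = some .down ∧ close l r v.label p.2 = some .up) := by
  by_cases hpa : p ∈ a.arcs
  · exact .inl hpa
  have hj := (mem_closeArcs hlr).1 hp
  have hcount : ∀ o, count (a.reverse w) l r o = count v.label l r o := fun o => by
    rw [count_reverse hin h, count_eq hin h hv hl]
  have key : ∀ i, (i = p.1 ∨ i = p.2) →
      close l r v.label i = close l r (a.reverse w) i := by
    intro i hi
    rcases close_eq_or hcount i with h1 | h1
    · have hne : ¬ IsEnd a.arcs i := by
        rintro ⟨q, hq, hqi⟩
        have := (nonCrossing_closeArcs hlr).eq_of_end (s := (closeArcs l r a w : Set (ℤ × ℤ))) hp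
          (arcs_subset_closeArcs hin h hlr hq) hi hqi
        exact hpa (this ▸ hq)
      rw [close_mid h1, close_mid h1, ArcDiagram.reverse_of_not_isEnd hne, h.label_eq hv hl hne]
    · exact h1.symm
  rw [key _ (.inl rfl), key _ (.inr rfl)]
  exact .inr ⟨hj.2.1, hj.2.2.1⟩

theorem alternates_closeArcs (hlr : l ≤ r) :
    Alternates (closeArcs l r a w) (close l r v.label) := by
  intro p hp
  rcases closeArcs_cases hin h hv hl hlr hp with hpa | hc
  · rw [close_mid (hin _ (isEnd_fst (s := (a.arcs : Set (ℤ × ℤ))) hpa)),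
      close_mid (hin _ (isEnd_snd (s := (a.arcs : Set (ℤ × ℤ))) hpa))]
    exact hv.arcs p hpa
  · exact .inl hc

/-- Only arcs of `a` can be clockwise in its closure, so degrees may be computed there. -/
theorem card_filter_closeArcs (hlr : l ≤ r) :
    ((closeArcs l r a w).filter fun p => p.1 ∈ closeUps l r v.label).card = a.deg v := by
  rw [ArcDiagram.deg]
  congr 1
  ext p
  rw [Finset.mem_filter, Finset.mem_filter, mem_closeUps hlr]
  constructor
  · rintro ⟨hp, hu⟩
    rcases closeArcs_cases hin h hv hl hlr hp with hpa | hc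
    · rw [close_mid (hin _ (isEnd_fst (s := (a.arcs : Set (ℤ × ℤ))) hpa))] at hu
      exact ⟨hpa, hu⟩
    · rw [hc.1] at hu
      simp at hu
  · rintro ⟨hpa, hu⟩
    refine ⟨arcs_subset_closeArcs hin h hlr hpa, ?_⟩
    rwa [close_mid (hin _ (isEnd_fst (s := (a.arcs : Set (ℤ × ℤ))) hpa))]

end CloseArcs

theorem mem_stackUps {l r : ℤ} (hlr : l ≤ r) {w v : Weight} {u : ℤ × Bool} :
    u ∈ stackUps l r w v ↔
      close l r (if u.2 then v.label else w.label) u.1 = some .up := by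
  obtain ⟨i, b⟩ := u
  cases b <;> simp [stackUps, mem_closeUps hlr]

theorem Alternates.up_iff {s : Set (ℤ × ℤ)} {f : Labelling} (hf : Alternates s f) {p : ℤ × ℤ}
    (hp : p ∈ s) : f p.1 = some .up ↔ ¬ f p.2 = some .up := by
  rcases hf p hp with h | h <;> simp [h]

/-! ## Windows -/

section Window

variable {Λ : Block} {x y : CircleDiagram Λ}

theorem CircleDiagram.linked (x y : CircleDiagram Λ) : x.wt.Linked y.wt :=
  Block.linked x.wt_mem y.wt_mem

theorem finite_window (x y : CircleDiagram Λ) : (window x y).Finite := by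
  unfold window
  split_ifs with hf
  · exact hf
  · obtain ⟨E, hE⟩ := exists_ends x.cup.arcs
    obtain ⟨E', hE'⟩ := exists_ends x.cap.arcs
    obtain ⟨E'', hE''⟩ := exists_ends y.cap.arcs
    refine (E ∪ (E' ∪ E'')).finite_toSet.subset fun i hi => ?_
    simp only [Finset.coe_union, Set.mem_union, Finset.mem_coe, hE, hE', hE'']
    exact hi

theorem window_bounds {i : ℤ} (hi : i ∈ window x y) :
    windowLeft x y ≤ i ∧ i ≤ windowRight x y :=
  ⟨csInf_le (finite_window x y).bddBelow hi, le_csSup (finite_window x y).bddAbove hi⟩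

theorem windowLeft_le_windowRight (x y : CircleDiagram Λ) : windowLeft x y ≤ windowRight x y := by
  rcases (window x y).eq_empty_or_nonempty with h | ⟨i, hi⟩
  -- Without cups and caps the window can be empty; both of its ends are then the default value `0`.
  · rw [windowLeft, windowRight, h, Int.csInf_empty, Int.csSup_empty]
  · exact (window_bounds hi).1.trans (window_bounds hi).2

theorem ArcDiagram.isEnd_mem_line {a : ArcDiagram} {i : ℤ} (hi : IsEnd a.arcs i) :
    i ∈ a.line := by
  obtain ⟨p, hp, rfl | rfl⟩ := hi
  · exact (a.arc_mem p hp).1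
  · exact (a.arc_mem p hp).2

theorem ends_in_window {i : ℤ}
    (hi : IsEnd x.cup.arcs i ∨ IsEnd x.cap.arcs i ∨ IsEnd y.cap.arcs i) :
    windowLeft x y ≤ i ∧ i ≤ windowRight x y := by
  refine window_bounds ?_
  unfold window
  split_ifs with hf
  · rcases hi with hi | hi | hi
    · rw [← x.cup_oriented.line_eq]
      exact ArcDiagram.isEnd_mem_line hi
    · rw [← x.cap_oriented.line_eq]
      exact ArcDiagram.isEnd_mem_line hi
    · rw [(x.linked y).line_eq, ← y.cap_oriented.line_eq]
      exact ArcDiagram.isEnd_mem_line hi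
  · exact hi

end Window

/-- The caps of the middle section in the order in which they are cut. -/
def cutOrder (s : Finset (ℤ × ℤ)) : List (ℤ × ℤ) := ((s.map toLex.toEmbedding).sort).map ofLex

theorem mem_cutOrder {s : Finset (ℤ × ℤ)} {p : ℤ × ℤ} : p ∈ cutOrder s ↔ p ∈ s := by
  simp only [cutOrder, List.mem_map, Finset.mem_sort, Finset.mem_map, Equiv.coe_toEmbedding]
  constructor
  · rintro ⟨q, ⟨q', hq', rfl⟩, rfl⟩
    exact hq'
  · exact fun hp => ⟨toLex p, ⟨p, hp, rfl⟩, rfl⟩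

theorem nodup_cutOrder (s : Finset (ℤ × ℤ)) : (cutOrder s).Nodup :=
  (Finset.sort_nodup _ _).map ofLex.injective

theorem pairwise_cutOrder (s : Finset (ℤ × ℤ)) :
    (cutOrder s).Pairwise fun p q => p.1 ≤ q.1 := by
  rw [cutOrder, List.pairwise_map]
  refine (Finset.pairwise_sort _ _).imp fun {p q} h => ?_
  rcases (Prod.Lex.le_iff).1 h with h | h
  · exact h.le
  · exact h.1.le

/-! ## Products of basis vectors -/

section Product

variable {Λ : Block} {x y : CircleDiagram Λ}

theorem productOrientations_eq (x y : CircleDiagram Λ) : productOrientations x y =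
    surgeries (closePoints (windowLeft x y) (windowRight x y) x.wt.label)
      (closeArcs (windowLeft x y) (windowRight x y) x.cup x.wt)
      (closeArcs (windowLeft x y) (windowRight x y) y.cap y.wt)
      (cutOrder (closeArcs (windowLeft x y) (windowRight x y) x.cap x.wt))
      (stackUps (windowLeft x y) (windowRight x y) x.wt y.wt) :=
  rfl

theorem setOf_mem_cutOrder (s : Finset (ℤ × ℤ)) : {q | q ∈ cutOrder s} = (s : Set (ℤ × ℤ)) := by
  ext p
  exact mem_cutOrder

theorem cup_in_window (i : ℤ) (hi : IsEnd x.cup.arcs i) :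
    windowLeft x y ≤ i ∧ i ≤ windowRight x y :=
  ends_in_window (.inl hi)

theorem mid_in_window (i : ℤ) (hi : IsEnd x.cap.arcs i) :
    windowLeft x y ≤ i ∧ i ≤ windowRight x y :=
  ends_in_window (.inr (.inl hi))

theorem cap_in_window (i : ℤ) (hi : IsEnd y.cap.arcs i) :
    windowLeft x y ≤ i ∧ i ≤ windowRight x y :=
  ends_in_window (.inr (.inr hi))

theorem stack_count (hxy : x.cap = y.cup) (o : Label) :
    count x.wt.label (windowLeft x y) (windowRight x y) o =
      count y.wt.label (windowLeft x y) (windowRight x y) o :=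
  count_eq mid_in_window x.cap_oriented (hxy ▸ y.cup_oriented) (x.linked y) o

theorem stack_points (hxy : x.cap = y.cup) :
    closePoints (windowLeft x y) (windowRight x y) x.wt.label =
      closePoints (windowLeft x y) (windowRight x y) y.wt.label :=
  closePoints_congr (windowLeft_le_windowRight x y) (stack_count hxy) (x.linked y).active_or

/-- Every vertex labelled ∨ or ∧ of a closure is an end of an arc, so at the start the middle
section has no vertical segments between such vertices and `IsStack.inner` is immediate. -/
theorem isStack_product (hxy : x.cap = y.cup) :
    IsStack (closePoints (windowLeft x y) (windowRight x y) x.wt.label)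
      (closeArcs (windowLeft x y) (windowRight x y) x.cup x.wt)
      (closeArcs (windowLeft x y) (windowRight x y) x.cap x.wt)
      (closeArcs (windowLeft x y) (windowRight x y) y.cap y.wt) := by
  have hlr := windowLeft_le_windowRight x y
  refine ⟨nonCrossing_closeArcs hlr, nonCrossing_closeArcs hlr, nonCrossing_closeArcs hlr,
    isEnd_closeArcs cup_in_window x.cup_oriented hlr, fun i => ?_,
    fun i => (isEnd_closeArcs mid_in_window x.cap_oriented hlr i).1,
    fun q _ i hi _ _ => (isEnd_closeArcs mid_in_window x.cap_oriented hlr i).2 hi⟩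
  rw [stack_points hxy]
  exact isEnd_closeArcs cap_in_window y.cap_oriented hlr i

theorem isOrientation_product (hxy : x.cap = y.cup) :
    IsOrientation (closeArcs (windowLeft x y) (windowRight x y) x.cup x.wt)
      (closeArcs (windowLeft x y) (windowRight x y) x.cap x.wt)
      (closeArcs (windowLeft x y) (windowRight x y) y.cap y.wt)
      (stackUps (windowLeft x y) (windowRight x y) x.wt y.wt) := by
  have hlr := windowLeft_le_windowRight x y
  have hy : x.cap.Oriented y.wt := hxy ▸ y.cup_oriented
  have hxx := x.linked x
  have hyy := y.linked y
  refine ⟨?_, ?_, ?_⟩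
  · intro p hp
    rw [mem_stackUps hlr, mem_stackUps hlr]
    rcases hp with hp | hp
    · exact (alternates_closeArcs cup_in_window x.cup_oriented x.cup_oriented hxx hlr).up_iff hp
    · exact (alternates_closeArcs mid_in_window x.cap_oriented x.cap_oriented hxx hlr).up_iff hp
  · intro p hp
    rw [mem_stackUps hlr, mem_stackUps hlr]
    rcases hp with hp | hp
    · exact (alternates_closeArcs cap_in_window y.cap_oriented y.cap_oriented hyy hlr).up_iff hp
    · exact (alternates_closeArcs mid_in_window x.cap_oriented hy (x.linked y) hlr).up_iff hp
  · intro i hi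
    rw [isEnd_closeArcs mid_in_window x.cap_oriented hlr] at hi
    rw [mem_stackUps hlr, mem_stackUps hlr]
    -- A vertex without a middle arc is not labelled ∧ on either line.
    refine iff_of_false (fun h1 => hi ?_) (fun h1 => hi ?_)
    · exact (mem_closePoints hlr).2 (.inr h1)
    · rw [stack_points hxy]
      exact (mem_closePoints hlr).2 (.inr h1)

theorem card_bottom {l r : ℤ} {w v : Weight} (s : Finset (ℤ × ℤ)) (hlr : l ≤ r) :
    (s.filter fun p => (p.1, false) ∈ stackUps l r w v).card =
      (s.filter fun p => p.1 ∈ closeUps l r w.label).card := by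
  congr 1
  refine Finset.filter_congr fun p _ => ?_
  rw [mem_stackUps hlr, mem_closeUps hlr]
  rfl

theorem card_top {l r : ℤ} {w v : Weight} (s : Finset (ℤ × ℤ)) (hlr : l ≤ r) :
    (s.filter fun p => (p.1, true) ∈ stackUps l r w v).card =
      (s.filter fun p => p.1 ∈ closeUps l r v.label).card := by
  congr 1
  refine Finset.filter_congr fun p _ => ?_
  rw [mem_stackUps hlr, mem_closeUps hlr]
  rfl

/-- On the bottom line the middle arcs count the clockwise caps of `x`; on the top line the same
arcs count the clockwise cups of `y`. -/
theorem stackDeg_product (hxy : x.cap = y.cup) :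
    stackDeg (closeArcs (windowLeft x y) (windowRight x y) x.cup x.wt)
      (closeArcs (windowLeft x y) (windowRight x y) y.cap y.wt)
      (cutOrder (closeArcs (windowLeft x y) (windowRight x y) x.cap x.wt))
      (stackUps (windowLeft x y) (windowRight x y) x.wt y.wt) = x.deg + y.deg := by
  have hlr := windowLeft_le_windowRight x y
  have hy : x.cap.Oriented y.wt := hxy ▸ y.cup_oriented
  have hm : (cutOrder (closeArcs (windowLeft x y) (windowRight x y) x.cap x.wt)).toFinset =
      closeArcs (windowLeft x y) (windowRight x y) x.cap x.wt := by
    ext p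
    rw [List.mem_toFinset, mem_cutOrder]
  rw [stackDeg, hm, card_bottom _ hlr, card_bottom _ hlr, card_top _ hlr, card_top _ hlr,
    card_filter_closeArcs cup_in_window x.cup_oriented x.cup_oriented (x.linked x) hlr,
    card_filter_closeArcs cap_in_window y.cap_oriented y.cap_oriented (y.linked y) hlr,
    card_filter_closeArcs mid_in_window x.cap_oriented x.cap_oriented (x.linked x) hlr,
    card_filter_closeArcs mid_in_window x.cap_oriented hy (x.linked y) hlr,
    CircleDiagram.deg, CircleDiagram.deg, hxy]
  ring

theorem stackDeg_opens {O : Finset (ℤ × Bool)} {z : CircleDiagram Λ} (hz : Opens x y O z) :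
    stackDeg (closeArcs (windowLeft x y) (windowRight x y) x.cup x.wt)
      (closeArcs (windowLeft x y) (windowRight x y) y.cap y.wt) [] O = z.deg := by
  have hlr := windowLeft_le_windowRight x y
  obtain ⟨h1, h2, rfl, -⟩ := hz
  rw [stackDeg, card_bottom _ hlr, card_top _ hlr,
    card_filter_closeArcs cup_in_window x.cup_oriented (h1 ▸ z.cup_oriented) (x.linked z) hlr,
    card_filter_closeArcs cap_in_window y.cap_oriented (h2 ▸ z.cap_oriented) (y.linked z) hlr,
    CircleDiagram.deg, h1, h2]
  simp

/-- The multiplication of `K_Λ` is homogeneous. -/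
theorem deg_of_mulBasis_ne_zero {z : CircleDiagram Λ} (hz : mulBasis x y z ≠ 0) :
    z.deg = x.deg + y.deg := by
  unfold mulBasis at hz
  split_ifs at hz with hxy
  · rw [Finsupp.sum, Finsupp.finsetSum_apply] at hz
    obtain ⟨O, hO, hne⟩ := Finset.exists_ne_zero_of_sum_ne_zero hz
    split_ifs at hne with hex
    · have hzc : hex.choose = z := by
        by_contra hc
        exact hne (Finsupp.single_eq_of_ne' hc)
      have hop := hex.choose_spec
      rw [hzc] at hop
      rw [productOrientations_eq] at hO
      have hst := isStack_product hxy
      have hor := isOrientation_product hxy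
      rw [← setOf_mem_cutOrder (closeArcs _ _ x.cap x.wt)] at hst hor
      rw [← stackDeg_opens hop, surgeries_support hst (pairwise_cutOrder _) (nodup_cutOrder _)
        hor hO, stackDeg_product hxy]
    · exact absurd rfl hne
  · exact absurd rfl hz

/-- Makes the choice in `mulBasis` immaterial. Inside the window `O` determines the ∧, and then
membership in the block determines all other labels; outside, both weights agree with that of `x`.
-/
theorem Opens.unique {O : Finset (ℤ × Bool)} {z z' : CircleDiagram Λ} (hz : Opens x y O z)
    (hz' : Opens x y O z') : z = z' := by
  have hlr := windowLeft_le_windowRight x y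
  obtain ⟨h1, h2, h3, h4⟩ := hz
  obtain ⟨h1', h2', h3', h4'⟩ := hz'
  refine CircleDiagram.ext (h1.trans h1'.symm) (Weight.ext ?_) (h2.trans h2'.symm)
  funext i
  by_cases hi : windowLeft x y ≤ i ∧ i ≤ windowRight x y
  · have hiff : z.wt.label i = some .up ↔ z'.wt.label i = some .up := by
      have e1 := mem_stackUps hlr (w := z.wt) (v := z.wt) (u := (i, false))
      have e2 := mem_stackUps hlr (w := z'.wt) (v := z'.wt) (u := (i, false))
      rw [← h3, if_neg (by simp), close_mid hi] at e1
      rw [← h3', if_neg (by simp), close_mid hi] at e2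
      exact e1.symm.trans e2
    rcases (z.linked z').active_or i with h | ⟨h | h, h' | h'⟩
    · exact h
    · rw [h, h']
    · exact absurd (h.symm.trans (hiff.2 h')) (by simp)
    · exact absurd (h'.symm.trans (hiff.1 h)) (by simp)
    · rw [h, h']
  · rw [h4 i hi, h4' i hi]

/-- `e_w` is a left unit. -/
theorem mulBasis_idem {w : Weight} (hw : w ∈ Λ.carrier) (hy : y.cup = w.underline) :
    mulBasis (idem w hw) y = Finsupp.single y 1 := by
  have hxy : (idem w hw).cap = y.cup := hy.symm
  set x := idem w hw with hx
  have hlr := windowLeft_le_windowRight x y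
  have hst := isStack_product hxy
  have hor := isOrientation_product hxy
  rw [← setOf_mem_cutOrder (closeArcs _ _ x.cap x.wt)] at hst hor
  have hsub : stackUps (windowLeft x y) (windowRight x y) x.wt y.wt ⊆
      verts (closePoints (windowLeft x y) (windowRight x y) x.wt.label) := by
    rintro ⟨i, b⟩ hi
    rw [mem_stackUps hlr] at hi
    rw [mem_verts]
    cases b
    · exact (mem_closePoints hlr).2 (.inr hi)
    · rw [stack_points hxy]
      exact (mem_closePoints hlr).2 (.inr hi)
  -- In the lower diagram the cups and caps coincide, and all are anti-clockwise because reversing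
  -- the weight along its own cup diagram changes nothing.
  have hsmall : ∀ q ∈ cutOrder (closeArcs (windowLeft x y) (windowRight x y) x.cap x.wt),
      q ∈ (closeArcs (windowLeft x y) (windowRight x y) x.cup x.wt : Set (ℤ × ℤ)) ∧
        (q.1, false) ∉ stackUps (windowLeft x y) (windowRight x y) x.wt y.wt := by
    intro q hq
    rw [mem_cutOrder] at hq
    refine ⟨hq, ?_⟩
    have hj := (mem_closeArcs hlr).1 hq
    have hrev : x.cap.reverse x.wt = x.wt.label := ArcDiagram.reverse_underline w
    rw [hrev] at hj
    rw [mem_stackUps hlr, if_neg (by simp), hj.2.1]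
    simp
  -- Every vertex labelled ∨ or ∧ is an end of a middle arc, so sliding overwrites all such labels
  -- of the bottom line by those of `y`.
  have hprod : productOrientations x y =
      Finsupp.single (stackUps (windowLeft x y) (windowRight x y) y.wt y.wt) 1 := by
    rw [productOrientations_eq, surgeries_small hst (pairwise_cutOrder _) (nodup_cutOrder _)
      hor hsub hsmall]
    congr 1
    ext ⟨i, b⟩
    rw [mem_slide, setOf_mem_cutOrder]
    cases b
    · simp only [true_and, isEnd_closeArcs mid_in_window x.cap_oriented hlr, mem_stackUps hlr,
        if_true, Bool.false_eq_true, if_false]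
      split_ifs with hi
      · rfl
      · refine iff_of_false (fun h1 => hi ?_) (fun h1 => hi ?_)
        · exact (mem_closePoints hlr).2 (.inr h1)
        · rw [stack_points hxy]
          exact (mem_closePoints hlr).2 (.inr h1)
    · simp [mem_stackUps hlr]
  have hop : Opens x y (stackUps (windowLeft x y) (windowRight x y) y.wt y.wt) y := by
    refine ⟨hy, rfl, rfl, fun i hi => ?_⟩
    have hy' : x.cap.Oriented y.wt := hxy ▸ y.cup_oriented
    exact (x.cap_oriented.label_eq hy' (x.linked y) fun he => hi (mid_in_window i he)).symm
  have hex : ∃ z, Opens x y (stackUps (windowLeft x y) (windowRight x y) y.wt y.wt) z := ⟨y, hop⟩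
  unfold mulBasis
  rw [if_pos hxy, hprod, Finsupp.sum_single_index]
  · rw [dif_pos hex, hex.choose_spec.unique hop]
  · split_ifs
    simp

theorem mul_single (x y : CircleDiagram Λ) :
    K.mul Λ (Finsupp.single x 1) (Finsupp.single y 1) = mulBasis x y := by
  simp [K.mul]

end Product

/-! ## The action on cell modules -/

section Cell

variable {Λ : Block} {μ : Weight} {hμ : μ ∈ Λ.carrier}

/-- The action of a basis vector of `K_Λ` on a basis vector of the cell module. -/
def cellAct (hμ : μ ∈ Λ.carrier) (x : CircleDiagram Λ) (c : CupsOn μ) : CupsOn μ →₀ ℂ :=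
  if h : x.cap = c.1 ∧ x.cup.Oriented μ then
    Finsupp.single ⟨x.cup, h.2⟩ (scalar hμ x c ⟨x.cup, h.2⟩)
  else 0

/-- The action of `K_Λ` on the space underlying the cell module. -/
def cellEnd (hμ : μ ∈ Λ.carrier) : K Λ →ₗ[ℂ] Module.End ℂ (CupsOn μ →₀ ℂ) :=
  (cellModule μ hμ).act

theorem cellEnd_apply (x : K Λ) (v : CupsOn μ →₀ ℂ) : cellEnd hμ x v =
    x.sum fun x α => α • v.sum fun c β => β • cellAct hμ x c := by
  change (Finsupp.lift _ ℂ _ (fun x => Finsupp.lift _ ℂ _ fun c => cellAct hμ x c) x) v = _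
  rw [Finsupp.lift_apply, Finsupp.sum, LinearMap.sum_apply, Finsupp.sum]
  refine Finset.sum_congr rfl fun x _ => ?_
  rw [LinearMap.smul_apply, Finsupp.lift_apply]

theorem capped_deg (c : CupsOn μ) : (c.capped hμ).deg = c.1.deg μ := by
  have := μ.underline_deg
  rw [CircleDiagram.deg]
  change c.1.deg μ + μ.underline.deg μ = _
  rw [this, add_zero]

/-- The cap diagram that closes off both cup diagrams has degree `0`, so homogeneity of the product
becomes homogeneity of the action. -/
theorem cellAct_apply_ne_zero {x : CircleDiagram Λ} {c a : CupsOn μ}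
    (h : cellAct hμ x c a ≠ 0) :
    x.cap = c.1 ∧ x.cup = a.1 ∧ a.1.deg μ = x.deg + c.1.deg μ := by
  unfold cellAct at h
  split_ifs at h with hc
  · have ha : (⟨x.cup, hc.2⟩ : CupsOn μ) = a := by
      by_contra hne
      exact h (Finsupp.single_eq_of_ne' hne)
    subst ha
    rw [Finsupp.single_eq_same, scalar, mul_single] at h
    have := deg_of_mulBasis_ne_zero h
    rw [capped_deg, capped_deg] at this
    exact ⟨hc.1, rfl, this⟩
  · exact absurd rfl h

theorem cellAct_idem {w : Weight} (hw : w ∈ Λ.carrier) {c : CupsOn μ} (hc : w.underline = c.1) :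
    cellAct hμ (idem w hw) c = Finsupp.single c 1 := by
  have h : (idem w hw).cap = c.1 ∧ (idem w hw).cup.Oriented μ :=
    ⟨hc, show w.underline.Oriented μ from hc ▸ c.2⟩
  have h' : (⟨(idem w hw).cup, h.2⟩ : CupsOn μ) = c := Subtype.ext hc
  rw [cellAct, dif_pos h, scalar, mul_single, mulBasis_idem, h', Finsupp.single_eq_same]
  exact hc.symm

theorem cellAct_idem_of_ne {w : Weight} (hw : w ∈ Λ.carrier) {c : CupsOn μ}
    (hc : w.underline ≠ c.1) : cellAct hμ (idem w hw) c = 0 :=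
  dif_neg fun h => hc h.1

/-- In degree `0` neither the cup nor the cap diagram has a clockwise arc, so both are determined by
the weight. -/
theorem eq_idem_of_deg {x : CircleDiagram Λ} (hx : x.deg = 0) : x = idem x.wt x.wt_mem := by
  rw [CircleDiagram.deg, Nat.add_eq_zero_iff] at hx
  exact CircleDiagram.ext (ArcDiagram.eq_underline_of_deg (h := x.cup_oriented) hx.1) rfl
    (ArcDiagram.eq_underline_of_deg (h := x.cap_oriented) hx.2)

theorem cellAct_of_deg {x : CircleDiagram Λ} (hx : x.deg = 0) (c : CupsOn μ) :
    cellAct hμ x c = 0 ∨ cellAct hμ x c = Finsupp.single c 1 := by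
  rw [eq_idem_of_deg hx]
  by_cases hc : x.wt.underline = c.1
  · exact .inr (cellAct_idem _ hc)
  · exact .inl (cellAct_idem_of_ne _ hc)

theorem cellModule_stable {s : Set (CupsOn μ)}
    (h : ∀ x : CircleDiagram Λ, ∀ c ∈ s, cellAct hμ x c ∈ Finsupp.supported ℂ ℂ s) :
    (cellModule μ hμ).Stable (Finsupp.supported ℂ ℂ s) := by
  intro x (v : CupsOn μ →₀ ℂ) hv
  change cellEnd hμ x v ∈ Finsupp.supported ℂ ℂ s
  rw [cellEnd_apply]
  refine Submodule.sum_mem _ fun x _ => Submodule.smul_mem _ _ ?_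
  exact Submodule.sum_mem _ fun c hc => Submodule.smul_mem _ _ (h x c (hv hc))

theorem iSup_supported_deg (p : ℤ → Prop) :
    (⨆ i, ⨆ (_ : p i), Finsupp.supported ℂ ℂ {c : CupsOn μ | (c.1.deg μ : ℤ) = i}) =
      Finsupp.supported ℂ ℂ {c : CupsOn μ | p (c.1.deg μ)} := by
  have h : ∀ i, (⨆ (_ : p i), Finsupp.supported ℂ ℂ {c : CupsOn μ | (c.1.deg μ : ℤ) = i}) =
      Finsupp.supported ℂ ℂ (⋃ (_ : p i), {c : CupsOn μ | (c.1.deg μ : ℤ) = i}) :=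
    fun i => by by_cases hp : p i <;> simp [hp]
  rw [iSup_congr h, ← Finsupp.supported_iUnion]
  congr 1
  ext c
  simp

theorem iSup_supported_inter (s : Set (CupsOn μ)) : Finsupp.supported ℂ ℂ s =
    ⨆ i : ℤ, Finsupp.supported ℂ ℂ s ⊓
      Finsupp.supported ℂ ℂ {c : CupsOn μ | (c.1.deg μ : ℤ) = i} := by
  simp_rw [← Finsupp.supported_inter]
  rw [← Finsupp.supported_iUnion]
  congr 1
  ext c
  simp

theorem cellModule_isSubmodule {s : Set (CupsOn μ)}
    (h : ∀ x : CircleDiagram Λ, ∀ c ∈ s, cellAct hμ x c ∈ Finsupp.supported ℂ ℂ s) :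
    (cellModule μ hμ).IsSubmodule (Finsupp.supported ℂ ℂ s) :=
  ⟨cellModule_stable h, iSup_supported_inter s⟩

theorem cellModule_isGraded : (cellModule μ hμ).IsGraded := by
  refine ⟨?_, ?_⟩
  · refine (DirectSum.isInternal_submodule_iff_iSupIndep_and_iSup_eq_top
      fun i : ℤ => Finsupp.supported ℂ ℂ {c : CupsOn μ | (c.1.deg μ : ℤ) = i}).2 ⟨?_, ?_⟩
    · intro i
      rw [iSup_supported_deg]
      refine Finsupp.disjoint_supported_supported (Set.disjoint_left.2 fun c hc hc' => hc' hc)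
    · have := iSup_supported_inter (Set.univ : Set (CupsOn μ))
      rw [Finsupp.supported_univ] at this
      simp only [top_inf_eq] at this
      exact this.symm
  · intro i j x hx (v : CupsOn μ →₀ ℂ) hv
    change cellEnd hμ x v ∈ Finsupp.supported ℂ ℂ {c : CupsOn μ | (c.1.deg μ : ℤ) = i + j}
    rw [cellEnd_apply]
    refine Submodule.sum_mem _ fun y hy => Submodule.smul_mem _ _ ?_
    refine Submodule.sum_mem _ fun c hc => Submodule.smul_mem _ _ ?_
    intro a ha
    have h1 := (cellAct_apply_ne_zero (Finsupp.mem_support_iff.1 ha)).2.2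
    have h2 : (y.deg : ℤ) = i := hx hy
    have h3 : (c.1.deg μ : ℤ) = j := hv hc
    change (a.1.deg μ : ℤ) = i + j
    omega

theorem degreeFiltration_eq (j : ℤ) : (cellModule μ hμ).degreeFiltration j =
    Finsupp.supported ℂ ℂ {c : CupsOn μ | j ≤ c.1.deg μ} :=
  iSup_supported_deg fun i => i ≥ j

theorem cellAct_mem_of_le {j : ℤ} (x : CircleDiagram Λ) {c : CupsOn μ}
    (hc : j ≤ x.deg + c.1.deg μ) :
    cellAct hμ x c ∈ Finsupp.supported ℂ ℂ {c : CupsOn μ | j ≤ c.1.deg μ} := by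
  intro a ha
  have h1 := (cellAct_apply_ne_zero (Finsupp.mem_support_iff.1 ha)).2.2
  change j ≤ (a.1.deg μ : ℤ)
  omega

theorem isSubmodule_degreeFiltration (j : ℤ) :
    (cellModule μ hμ).IsSubmodule ((cellModule μ hμ).degreeFiltration j) := by
  rw [degreeFiltration_eq]
  refine cellModule_isSubmodule fun x c hc => cellAct_mem_of_le x ?_
  have : j ≤ (c.1.deg μ : ℤ) := hc
  omega

/-- Modulo higher degrees, only `e_l` acts nontrivially on `(l̲ μ|`. -/
theorem act_apply_of_le {j : ℤ} {l : Weight} (hl : l ∈ Λ.carrier) {c : CupsOn μ}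
    (hc : l.underline = c.1) (hcj : (c.1.deg μ : ℤ) = j) (x : K Λ) {v : CupsOn μ →₀ ℂ}
    (hv : v ∈ Finsupp.supported ℂ ℂ {c : CupsOn μ | j ≤ c.1.deg μ}) :
    cellEnd hμ x v c = x (idem l hl) * v c := by
  rw [cellEnd_apply, Finsupp.sum, Finsupp.finsetSum_apply,
    Finset.sum_eq_single (idem l hl)]
  · rw [Finsupp.smul_apply, smul_eq_mul]
    congr 1
    rw [Finsupp.sum, Finsupp.finsetSum_apply, Finset.sum_eq_single c]
    · rw [Finsupp.smul_apply, cellAct_idem hl hc, Finsupp.single_eq_same, smul_eq_mul, mul_one]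
    · intro b _ hb
      rw [cellAct_idem_of_ne, Finsupp.smul_apply, Finsupp.zero_apply, smul_zero]
      exact fun e => hb (Subtype.ext (e.symm.trans hc))
    · intro hc'
      rw [Finsupp.notMem_support_iff.1 hc', zero_smul, Finsupp.zero_apply]
  · intro y _ hy
    rw [Finsupp.smul_apply, Finsupp.sum, Finsupp.finsetSum_apply, Finset.sum_eq_zero, smul_zero]
    intro b hb
    rw [Finsupp.smul_apply, smul_eq_mul]
    by_contra hne
    have h1 := cellAct_apply_ne_zero (right_ne_zero_of_mul hne)
    have h2 : j ≤ (b.1.deg μ : ℤ) := hv hb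
    -- The diagram `b` has degree at least `j` and `c` has degree exactly `j`, so `y` has no degree
    -- to add and must be an idempotent.
    have h3 : y.deg = 0 := by omega
    have h4 := eq_idem_of_deg h3
    have h5 : y.wt.underline = l.underline := by
      have h6 : y.cup = y.wt.underline := congrArg CircleDiagram.cup h4
      rw [← h6, h1.2.1, hc]
    have h7 : y.wt = l := ArcDiagram.underline_injective (Block.linked y.wt_mem hl) h5
    refine hy (h4.trans ?_)
    subst h7
    rfl
  · intro hx
    rw [Finsupp.notMem_support_iff.1 hx, zero_smul, Finsupp.zero_apply]

/-- The vector $e_l$ projects onto a coordinate line. This detects composition factors even when the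
cell module is infinite dimensional. -/
theorem act_idem {l : Weight} (hl : l ∈ Λ.carrier) {c : CupsOn μ} (hc : l.underline = c.1)
    (v : CupsOn μ →₀ ℂ) :
    cellEnd hμ (Finsupp.single (idem l hl) 1) v = Finsupp.single c (v c) := by
  rw [cellEnd_apply, Finsupp.sum_single_index (by simp), one_smul, Finsupp.sum,
    Finset.sum_eq_single c]
  · rw [cellAct_idem hl hc, Finsupp.smul_single, smul_eq_mul, mul_one]
  · intro b _ hb
    rw [cellAct_idem_of_ne, smul_zero]
    exact fun e => hb (Subtype.ext (e.symm.trans hc))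
  · intro hc'
    rw [Finsupp.notMem_support_iff.1 hc', zero_smul]

theorem act_idem_of_not_oriented {l : Weight} (hl : l ∈ Λ.carrier)
    (h : ¬ l.underline.Oriented μ) (v : CupsOn μ →₀ ℂ) :
    cellEnd hμ (Finsupp.single (idem l hl) 1) v = 0 := by
  rw [cellEnd_apply, Finsupp.sum_single_index (by simp), one_smul, Finsupp.sum]
  refine Finset.sum_eq_zero fun b _ => ?_
  rw [cellAct_idem_of_ne, smul_zero]
  exact fun e => h (by rw [e]; exact b.2)

end Cell

/-! ## Subquotients -/

section Subquotient

variable {Λ : Block}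

/-- The first isomorphism theorem with gradings. The last hypothesis compares a homogeneous
component of the target with the homogeneous elements of `A` modulo `B`. -/
theorem Rep.subquotient_iso {M N : Rep Λ} {A B : Submodule ℂ M.carrier} (hA : M.Stable A)
    (hB : M.Stable B) (ψ : A →ₗ[ℂ] N.carrier) (hs : Function.Surjective ψ)
    (hk : ∀ a, ψ a = 0 ↔ (a : M.carrier) ∈ B)
    (he : ∀ x (a : A), ψ ⟨M.act x a, hA x a a.2⟩ = N.act x (ψ a))
    (hg : ∀ i (a : A), ψ a ∈ N.piece i ↔
      ∃ b ∈ A, b ∈ M.piece i ∧ (a : M.carrier) - b ∈ B) :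
    (M.subquotient A B hA hB).Iso N := by
  have hker : LinearMap.ker ψ = B.comap A.subtype := by
    ext a
    rw [LinearMap.mem_ker, hk]
    rfl
  refine ⟨(Submodule.quotEquivOfEq _ _ hker.symm).trans (ψ.quotKerEquivOfSurjective hs), ?_, ?_⟩
  · intro x q
    obtain ⟨a, rfl⟩ := (B.comap A.subtype).mkQ_surjective q
    exact he x a
  · intro i q
    obtain ⟨a, rfl⟩ := (B.comap A.subtype).mkQ_surjective q
    refine (hg i a).trans ⟨?_, ?_⟩
    · rintro ⟨b, hbA, hb, hab⟩
      refine ⟨⟨b, hbA⟩, hb, ?_⟩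
      refine ((Submodule.Quotient.eq _).2 ?_).symm
      exact hab
    · rintro ⟨⟨b, hbA⟩, hb, hab⟩
      refine ⟨b, hbA, hb, ?_⟩
      have := (Submodule.Quotient.eq _).1 hab.symm
      exact this

theorem mem_piece_shift_simple {w : Weight} (hw : w ∈ Λ.carrier) {i j : ℤ} {z : ℂ} :
    z ∈ (((simpleModule w hw).shift j).piece i : Submodule ℂ ℂ) ↔ (i = j ∨ z = 0) := by
  change z ∈ (if i - j = 0 then ⊤ else ⊥ : Submodule ℂ ℂ) ↔ _
  split_ifs with h
  · simp [sub_eq_zero.1 h]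
  · simp [sub_ne_zero.1 h]

/-- The generator `1` of the simple module lifts to a homogeneous vector of `A`, which $e_l$ fixes
modulo `B`. -/
theorem Rep.exists_of_subquotient_iso {M : Rep Λ} {l : Weight} {hl : l ∈ Λ.carrier} {j : ℤ}
    {A B : Submodule ℂ M.carrier} {hA : M.Stable A} {hB : M.Stable B}
    (h : (M.subquotient A B hA hB).Iso ((simpleModule l hl).shift j)) :
    ∃ a ∈ A, a ∈ M.piece j ∧ a ∉ B ∧ M.act (Finsupp.single (idem l hl) 1) a - a ∈ B := by
  obtain ⟨φ, hφ, hg⟩ := h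
  obtain ⟨q, hq⟩ := φ.surjective (1 : ℂ)
  have hqp := (hg j q).1 (by
    rw [hq]
    exact (mem_piece_shift_simple hl).2 (.inl rfl))
  obtain ⟨⟨a, haA⟩, hap, hqa⟩ := hqp
  refine ⟨a, haA, hap, fun haB => ?_, ?_⟩
  · have h0 : (B.comap A.subtype).mkQ ⟨a, haA⟩ = 0 := (Submodule.Quotient.mk_eq_zero _).2 haB
    have h1 : q = 0 := hqa.symm.trans h0
    rw [h1, map_zero] at hq
    exact zero_ne_one (α := ℂ) hq
  · have hL : ((simpleModule l hl).shift j).act (Finsupp.single (idem l hl) 1) (1 : ℂ) =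
        (1 : ℂ) := by
      change (Finsupp.single (idem l hl) (1 : ℂ) (idem l hl) • (1 : Module.End ℂ ℂ)) (1 : ℂ) = 1
      simp
    have hfix : (M.subquotient A B hA hB).act (Finsupp.single (idem l hl) 1) q = q := by
      refine φ.injective ?_
      rw [hφ, hq]
      exact hL
    subst hqa
    exact (Submodule.Quotient.eq (B.comap A.subtype)).1 hfix

variable {μ : Weight} {hμ : μ ∈ Λ.carrier}

/-- If `L(l)⟨j⟩` is a subquotient of the cell module, then it is generated by `(l̲ μ|`. -/
theorem of_subquotient_iso {l : Weight} {hl : l ∈ Λ.carrier} {j : ℤ}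
    {A B : Submodule ℂ (CupsOn μ →₀ ℂ)} {hA : (cellModule μ hμ).Stable A}
    {hB : (cellModule μ hμ).Stable B}
    (h : ((cellModule μ hμ).subquotient A B hA hB).Iso ((simpleModule l hl).shift j)) :
    ∃ c : CupsOn μ, l.underline = c.1 ∧ (c.1.deg μ : ℤ) = j ∧
      Finsupp.single c (1 : ℂ) ∈ A ∧ Finsupp.single c (1 : ℂ) ∉ B := by
  obtain ⟨a, haA, hap, haB, hdiff⟩ : ∃ a ∈ A,
      a ∈ Finsupp.supported ℂ ℂ {c : CupsOn μ | (c.1.deg μ : ℤ) = j} ∧ a ∉ B ∧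
      cellEnd hμ (Finsupp.single (idem l hl) 1) a - a ∈ B := Rep.exists_of_subquotient_iso h
  by_cases ho : l.underline.Oriented μ
  · obtain ⟨c, hlc⟩ : ∃ c : CupsOn μ, l.underline = c.1 := ⟨⟨_, ho⟩, rfl⟩
    have hstab : cellEnd hμ (Finsupp.single (idem l hl) 1) a ∈ A := hA _ _ haA
    have hc : cellEnd hμ (Finsupp.single (idem l hl) 1) a = a c • Finsupp.single c 1 := by
      rw [act_idem hl hlc, Finsupp.smul_single, smul_eq_mul, mul_one]
    rw [hc] at hdiff hstab
    -- The vector $e_l a = a(c)\,(c\mu|$ lies in `A` and agrees with `a` modulo `B`. As `a` is not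
    -- in `B`, the coefficient is nonzero; since `a` is homogeneous, this also fixes the degree of
    -- `c`.
    have hne : a c ≠ 0 := by
      intro h0
      rw [h0, zero_smul, zero_sub] at hdiff
      exact haB (by simpa using B.neg_mem hdiff)
    refine ⟨c, hlc, hap (Finsupp.mem_support_iff.2 hne), ?_, fun hcB => haB ?_⟩
    · have := A.smul_mem (a c)⁻¹ hstab
      rwa [smul_smul, inv_mul_cancel₀ hne, one_smul] at this
    · have := B.sub_mem (B.smul_mem (a c) hcB) hdiff
      rwa [sub_sub_cancel] at this
  · rw [act_idem_of_not_oriented hl ho, zero_sub] at hdiff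
    exact absurd (by simpa using B.neg_mem hdiff) haB

end Subquotient

/-! ## The layers of the degree filtration -/

section Layers

variable {Λ : Block} {μ : Weight} {hμ : μ ∈ Λ.carrier}

theorem degreeFiltration_zero : (cellModule μ hμ).degreeFiltration 0 = ⊤ := by
  rw [degreeFiltration_eq]
  have : {c : CupsOn μ | (0 : ℤ) ≤ c.1.deg μ} = Set.univ := by
    ext c
    simp
  rw [this]
  exact Finsupp.supported_univ

theorem degreeFiltration_antitone : Antitone (cellModule μ hμ).degreeFiltration := by
  intro i j hij
  rw [degreeFiltration_eq, degreeFiltration_eq]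
  exact Finsupp.supported_mono fun c (hc : j ≤ (c.1.deg μ : ℤ)) => hij.trans hc

theorem Weight.Sub.of_oriented {l : Weight} (hμ : μ ∈ Λ.carrier) (hl : l ∈ Λ.carrier)
    (h : l.underline.Oriented μ) : l.Sub μ := ⟨Block.linked hl hμ, h⟩

/-- The coordinates indexed by an injective family of basis vectors. -/
theorem exists_coordinates {ι κ : Type} (e : ι → κ) (he : Function.Injective e) :
    ∃ ψ : (κ →₀ ℂ) →ₗ[ℂ] ⨁ _ : ι, ℂ, (∀ v i, ψ v i = v (e i)) ∧
      ∀ z, ∃ v ∈ Finsupp.supported ℂ ℂ (Set.range e), ψ v = z := by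
  refine ⟨(finsuppLequivDFinsupp ℂ).toLinearMap ∘ₗ Finsupp.lcomapDomain e he, ?_, ?_⟩
  · intro v i
    rfl
  · intro z
    refine ⟨((finsuppLequivDFinsupp ℂ).symm z).mapDomain e, ?_, ?_⟩
    · intro c hc
      obtain ⟨i, -, hi⟩ := Finset.mem_image.1 (Finsupp.mapDomain_support hc)
      exact ⟨i, hi⟩
    · rw [LinearMap.comp_apply]
      have : Finsupp.lcomapDomain (R := ℂ) e he (((finsuppLequivDFinsupp ℂ).symm z).mapDomain e) =
          (finsuppLequivDFinsupp ℂ).symm z := Finsupp.comapDomain_mapDomain e he _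
      rw [this]
      exact (finsuppLequivDFinsupp ℂ).apply_symm_apply z

theorem Rep.mem_piece_directSum {ι : Type} {M : ι → Rep Λ} {k : ℤ}
    {z : ⨁ i, (M i).carrier} :
    z ∈ ((Rep.directSum M).piece k : Submodule ℂ (⨁ i, (M i).carrier)) ↔
      ∀ i, z i ∈ (M i).piece k :=
  Submodule.mem_iInf _

/-- The map reads off the coordinates at the basis vectors of degree exactly `j`, which
`ArcDiagram.source` indexes by weights. On $N(j)$ its kernel is $N(j+1)$, and `act_apply_of_le`
makes it equivariant. -/
theorem layer_iso (j : ℤ)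
    (hA : (cellModule μ hμ).Stable ((cellModule μ hμ).degreeFiltration j))
    (hB : (cellModule μ hμ).Stable ((cellModule μ hμ).degreeFiltration (j + 1))) :
    ((cellModule μ hμ).subquotient _ _ hA hB).Iso
      (Rep.directSum
        fun l : {l : Λ.carrier // l.1.Sub μ ∧ (l.1.underline.deg μ : ℤ) = j} =>
          (simpleModule l.1.1 l.1.2).shift j) := by
  let ι := {l : Λ.carrier // l.1.Sub μ ∧ (l.1.underline.deg μ : ℤ) = j}
  let e : ι → CupsOn μ := fun l => ⟨l.1.1.underline, l.2.1.2⟩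
  have he : Function.Injective e := fun l l' h => Subtype.ext (Subtype.ext
    (ArcDiagram.underline_injective (Block.linked l.1.2 l'.1.2) (congrArg Subtype.val h)))
  have hrange : ∀ c : CupsOn μ, (c.1.deg μ : ℤ) = j → ∃ l, e l = c := by
    intro c hc
    have hl : c.1.source μ c.2 ∈ Λ.carrier := Block.mem_of_linked hμ (ArcDiagram.linked_source c.2)
    have hu := ArcDiagram.underline_source c.2
    refine ⟨⟨⟨_, hl⟩, Weight.Sub.of_oriented hμ hl (hu.symm ▸ c.2), ?_⟩, Subtype.ext hu⟩
    simpa only [hu] using hc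
  obtain ⟨ψ, hψ, hψs⟩ := exists_coordinates e he
  have hAe := degreeFiltration_eq (hμ := hμ) j
  have hBe := degreeFiltration_eq (hμ := hμ) (j + 1)
  have hker : ∀ v : CupsOn μ →₀ ℂ, v ∈ Finsupp.supported ℂ ℂ {c : CupsOn μ | j ≤ c.1.deg μ} →
      (ψ v = 0 ↔ v ∈ Finsupp.supported ℂ ℂ {c : CupsOn μ | j + 1 ≤ c.1.deg μ}) := by
    intro v hv
    constructor
    · intro h0 c hc
      have h1 : j ≤ (c.1.deg μ : ℤ) := hv hc
      change j + 1 ≤ (c.1.deg μ : ℤ)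
      rcases h1.eq_or_lt with h2 | h2
      · obtain ⟨l, rfl⟩ := hrange c h2.symm
        have h3 := hψ v l
        rw [h0] at h3
        exact absurd h3.symm (Finsupp.mem_support_iff.1 hc)
      · omega
    · intro h
      refine DFinsupp.ext fun l => ?_
      refine (hψ v l).trans ?_
      by_contra hne
      have h1 : j + 1 ≤ ((e l).1.deg μ : ℤ) := h (Finsupp.mem_support_iff.2 hne)
      have h2 : ((e l).1.deg μ : ℤ) = j := l.2.2
      omega
  refine Rep.subquotient_iso hA hB
    (ψ ∘ₗ ((cellModule μ hμ).degreeFiltration j).subtype) ?_ ?_ ?_ ?_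
  · intro z
    obtain ⟨v, hv, hz⟩ := hψs z
    refine ⟨⟨v, ?_⟩, hz⟩
    rw [hAe]
    intro c hc
    obtain ⟨l, rfl⟩ := hv hc
    exact l.2.2.ge
  · rintro ⟨a, ha⟩
    rw [hAe] at ha
    rw [hBe]
    exact hker a ha
  · rintro x ⟨(a : CupsOn μ →₀ ℂ), ha⟩
    rw [hAe] at ha
    refine DFinsupp.ext fun l => ?_
    refine (hψ _ l).trans ?_
    refine (act_apply_of_le l.1.2 (c := e l) rfl l.2.2 x ha).trans ?_
    exact congrArg (x (idem l.1.1 l.1.2) * ·) (hψ a l).symm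
  · rintro i ⟨(a : CupsOn μ →₀ ℂ), ha⟩
    rw [hAe] at ha
    have hp : (ψ ∘ₗ ((cellModule μ hμ).degreeFiltration j).subtype) ⟨a, hAe ▸ ha⟩ ∈
        (Rep.directSum fun l : ι => (simpleModule l.1.1 l.1.2).shift j).piece i ↔
        ∀ l, i = j ∨ ψ a l = 0 := by
      refine Rep.mem_piece_directSum.trans ?_
      exact forall_congr' fun l => mem_piece_shift_simple l.1.2
    refine hp.trans ?_
    by_cases hij : i = j
    · subst hij
      refine ⟨fun _ => ?_, fun _ l => .inl rfl⟩
      -- The part of `a` in the lowest degree is a homogeneous representative of its class.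
      refine ⟨Finsupp.filter (fun c : CupsOn μ => (c.1.deg μ : ℤ) = i) a, ?_, ?_, ?_⟩
      · rw [hAe]
        intro c hc
        rw [Finsupp.support_filter, Finset.coe_filter] at hc
        exact hc.2.ge
      · intro c hc
        rw [Finsupp.support_filter, Finset.coe_filter] at hc
        exact hc.2
      · rw [hBe]
        change (a : CupsOn μ →₀ ℂ) - Finsupp.filter _ a ∈ Finsupp.supported ℂ ℂ _
        intro c hc
        rw [Finset.mem_coe, Finsupp.mem_support_iff, Finsupp.sub_apply, Finsupp.filter_apply] at hc
        split_ifs at hc with h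
        · exact absurd (sub_self _) hc
        · rw [sub_zero] at hc
          have h1 : i ≤ (c.1.deg μ : ℤ) := ha (Finsupp.mem_support_iff.2 hc)
          change i + 1 ≤ (c.1.deg μ : ℤ)
          omega
    · simp only [hij, false_or]
      have h0 : (∀ l, ψ a l = 0) ↔ ψ a = 0 := ⟨fun h => DFinsupp.ext h, fun h l => by rw [h]; rfl⟩
      rw [h0, hker a ha]
      constructor
      · intro h
        refine ⟨0, Submodule.zero_mem _, Submodule.zero_mem _, ?_⟩
        rw [hBe]
        exact (sub_zero (a : CupsOn μ →₀ ℂ)).symm ▸ h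
      · rintro ⟨(b : CupsOn μ →₀ ℂ), hbA, hb, hab⟩
        rw [hAe] at hbA
        rw [hBe] at hab
        change (a : CupsOn μ →₀ ℂ) - b ∈ Finsupp.supported ℂ ℂ _ at hab
        -- A vector of $N(j)$ that is homogeneous of degree $i \ne j$ already lies in $N(j+1)$, so
        -- the layer is concentrated in degree `j`.
        have hbB : (b : CupsOn μ →₀ ℂ) ∈
            Finsupp.supported ℂ ℂ {c : CupsOn μ | j + 1 ≤ c.1.deg μ} := by
          intro c hc
          have h1 : j ≤ (c.1.deg μ : ℤ) := hbA hc
          have h2 : (c.1.deg μ : ℤ) = i := hb hc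
          change j + 1 ≤ (c.1.deg μ : ℤ)
          omega
        have := Submodule.add_mem _ hab hbB
        rwa [sub_add_cancel] at this

end Layers

/-! ## Decomposition numbers -/

section Multiplicity

variable {Λ : Block} {μ : Weight} {hμ : μ ∈ Λ.carrier}

theorem multiplicity_eq_zero {l : Weight} (hl : l ∈ Λ.carrier) {j : ℤ}
    (h : ¬ (l.Sub μ ∧ (l.underline.deg μ : ℤ) = j)) :
    (cellModule μ hμ).multiplicity ((simpleModule l hl).shift j) = 0 := by
  rw [Rep.multiplicity]
  simp only [ENat.iSup_eq_zero, Set.encard_eq_zero]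
  intro n A _ hA
  refine Set.eq_empty_of_forall_notMem fun k hk => h ?_
  obtain ⟨c, hc, hd, -⟩ := of_subquotient_iso hk
  exact ⟨Weight.Sub.of_oriented hμ hl (hc ▸ c.2), hc ▸ hd⟩

/-- Each occurrence is a step of the chain at which the one vector $(\underline l\mu|$ enters. In a
monotone chain it enters at most once. -/
theorem multiplicity_le_one {l : Weight} (hl : l ∈ Λ.carrier) {j : ℤ} :
    (cellModule μ hμ).multiplicity ((simpleModule l hl).shift j) ≤ 1 := by
  refine iSup_le fun n => iSup_le fun A => iSup_le fun hm => iSup_le fun hA => ?_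
  rw [Set.encard_le_one_iff]
  have key : ∀ k k' : Fin n, k < k' →
      ((cellModule μ hμ).subquotient (A k.succ) (A k.castSucc) (hA _).1 (hA _).1).Iso
        ((simpleModule l hl).shift j) →
      ((cellModule μ hμ).subquotient (A k'.succ) (A k'.castSucc) (hA _).1 (hA _).1).Iso
        ((simpleModule l hl).shift j) → False := by
    intro k k' hlt hk hk'
    obtain ⟨c, hc, -, h1, -⟩ := of_subquotient_iso hk
    obtain ⟨c', hc', -, -, h2⟩ := of_subquotient_iso hk'
    obtain rfl : c = c' := Subtype.ext (hc.symm.trans hc')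
    exact h2 (hm (by
      rw [Fin.le_def, Fin.val_succ, Fin.val_castSucc]
      exact hlt) h1)
  intro k k' hk hk'
  by_contra hne
  rcases lt_or_gt_of_ne hne with h | h
  · exact key k k' h hk hk'
  · exact key k' k h hk' hk

/-- A chain of two submodules suffices: $N(j+1)$, and the same with $(\underline l\mu|$ adjoined.
The latter is stable because basis vectors of positive degree map this vector into $N(j+1)$, while
those of degree `0` kill or fix it. -/
theorem one_le_multiplicity {l : Weight} (hl : l ∈ Λ.carrier) {j : ℤ}
    (h : l.Sub μ ∧ (l.underline.deg μ : ℤ) = j) :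
    1 ≤ (cellModule μ hμ).multiplicity ((simpleModule l hl).shift j) := by
  obtain ⟨c, hlc⟩ : ∃ c : CupsOn μ, l.underline = c.1 := ⟨⟨_, h.1.2⟩, rfl⟩
  have hcj : (c.1.deg μ : ℤ) = j := hlc ▸ h.2
  let S : Set (CupsOn μ) := {d | j + 1 ≤ (d.1.deg μ : ℤ)}
  let T : Set (CupsOn μ) := {d | j + 1 ≤ (d.1.deg μ : ℤ) ∨ d = c}
  have hST : S ⊆ T := fun d hd => .inl hd
  have hcT : c ∈ T := .inr rfl
  have hTj : T ⊆ {d : CupsOn μ | j ≤ (d.1.deg μ : ℤ)} := by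
    rintro d (hd | rfl)
    · exact (by omega : j ≤ (d.1.deg μ : ℤ))
    · exact hcj.ge
  have hS : (cellModule μ hμ).IsSubmodule (Finsupp.supported ℂ ℂ S) :=
    cellModule_isSubmodule fun x d hd => cellAct_mem_of_le x (by
      have : j + 1 ≤ (d.1.deg μ : ℤ) := hd
      omega)
  have hT : (cellModule μ hμ).IsSubmodule (Finsupp.supported ℂ ℂ T) := by
    refine cellModule_isSubmodule fun x d hd => ?_
    by_cases hx : x.deg = 0
    · rcases cellAct_of_deg (hμ := hμ) hx d with h0 | h0
      · rw [h0]
        exact Submodule.zero_mem _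
      · rw [h0]
        exact Finsupp.single_mem_supported ℂ _ hd
    · have : j ≤ (d.1.deg μ : ℤ) := hTj hd
      exact Finsupp.supported_mono hST (cellAct_mem_of_le x (by omega))
  have hmem : ∀ v ∈ Finsupp.supported ℂ ℂ T, v c = 0 → v ∈ Finsupp.supported ℂ ℂ S := by
    intro v hv h0 d hd
    rcases hv hd with h1 | rfl
    · exact h1
    · exact absurd h0 (Finsupp.mem_support_iff.1 hd)
  have hcS : c ∉ S := by
    intro hc
    have : j + 1 ≤ (c.1.deg μ : ℤ) := hc
    omega
  have hmem' : ∀ v ∈ Finsupp.supported ℂ ℂ S, v c = 0 := by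
    intro v hv
    by_contra hne
    exact hcS (hv (Finsupp.mem_support_iff.2 hne))
  have hiso : ((cellModule μ hμ).subquotient (Finsupp.supported ℂ ℂ T)
      (Finsupp.supported ℂ ℂ S) hT.1 hS.1).Iso ((simpleModule l hl).shift j) := by
    let ψ : (Finsupp.supported ℂ ℂ T : Submodule ℂ (CupsOn μ →₀ ℂ)) →ₗ[ℂ] ℂ :=
      (Finsupp.lapply c : (CupsOn μ →₀ ℂ) →ₗ[ℂ] ℂ) ∘ₗ
        (Finsupp.supported ℂ ℂ T : Submodule ℂ (CupsOn μ →₀ ℂ)).subtype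
    refine Rep.subquotient_iso hT.1 hS.1
      (N := (simpleModule l hl).shift j)
      ψ ?_ ?_ ?_ ?_
    · intro (z : ℂ)
      exact ⟨⟨Finsupp.single c z, Finsupp.single_mem_supported ℂ _ hcT⟩,
        Finsupp.single_eq_same⟩
    · rintro ⟨a, ha⟩
      exact ⟨hmem a ha, hmem' a⟩
    · rintro x ⟨(a : CupsOn μ →₀ ℂ), ha⟩
      exact act_apply_of_le hl hlc hcj x (Finsupp.supported_mono hTj ha)
    · rintro i ⟨(a : CupsOn μ →₀ ℂ), ha⟩
      refine (mem_piece_shift_simple hl).trans ?_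
      change (i = j ∨ a c = 0) ↔ _
      constructor
      · rintro (rfl | h0)
        · refine ⟨Finsupp.single c (a c),
            Finsupp.single_mem_supported ℂ _ hcT, Finsupp.single_mem_supported ℂ _ hcj, ?_⟩
          refine hmem _ (Submodule.sub_mem _ ha (Finsupp.single_mem_supported ℂ _ hcT)) ?_
          change (a - Finsupp.single c (a c)) c = 0
          rw [Finsupp.sub_apply, Finsupp.single_eq_same, sub_self]
        · refine ⟨0, Submodule.zero_mem _, Submodule.zero_mem _, ?_⟩
          exact (sub_zero a).symm ▸ hmem a ha h0
      · rintro ⟨(b : CupsOn μ →₀ ℂ), -, hb, hab⟩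
        by_cases hij : i = j
        · exact .inl hij
        · right
          have h1 : (a - b) c = 0 := hmem' _ hab
          have h2 : b c = 0 := by
            by_contra hne
            have h3 : (c.1.deg μ : ℤ) = i := hb (Finsupp.mem_support_iff.2 hne)
            exact hij (h3.symm.trans hcj)
          rwa [Finsupp.sub_apply, h2, sub_zero] at h1
  let A : Fin 2 → Submodule ℂ (CupsOn μ →₀ ℂ) :=
    ![Finsupp.supported ℂ ℂ S, Finsupp.supported ℂ ℂ T]
  have hA : ∀ k, (cellModule μ hμ).IsSubmodule (A k) := by
    intro k
    fin_cases k
    · exact hS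
    · exact hT
  have hm : Monotone A := by
    rw [Fin.monotone_iff_le_succ]
    intro k
    fin_cases k
    exact Finsupp.supported_mono hST
  refine le_iSup_of_le 1 (le_iSup_of_le A (le_iSup_of_le hm (le_iSup_of_le hA ?_)))
  rw [Set.one_le_encard_iff_nonempty]
  exact ⟨0, hiso⟩

end Multiplicity

/-! ## Weights with infinitely many `∨` and infinitely many `∧` -/

theorem Joined.congr {f g : Labelling} {i j : ℤ} (h : Joined f i j)
    (hfg : ∀ k, i ≤ k → k ≤ j → f k = g k) : Joined g i j := by
  obtain ⟨h1, h2, h3, h4, h5⟩ := h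
  have hsum : ∀ k ≤ j, ∑ m ∈ Finset.Icc i k, sgn (g m) = ∑ m ∈ Finset.Icc i k, sgn (f m) := by
    refine fun k hk => Finset.sum_congr rfl fun m hm => ?_
    rw [Finset.mem_Icc] at hm
    rw [hfg m hm.1 (hm.2.trans hk)]
  refine ⟨h1, hfg i le_rfl h1.le ▸ h2, hfg j h1.le le_rfl ▸ h3, (hsum j le_rfl).trans h4, ?_⟩
  intro k hik hkj
  rw [hsum k hkj.le]
  exact h5 k hik hkj

/-- Exchange `∨` and `∧`. -/
def flip : Option Label → Option Label
  | some .down => some .up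
  | some .up => some .down
  | o => o

theorem sgn_flip (o : Option Label) : sgn (flip o) = -sgn o := by
  rcases o with _ | (_ | _ | _ | _) <;> rfl

theorem flip_eq_down {o : Option Label} : flip o = some .down ↔ o = some .up := by
  rcases o with _ | (_ | _ | _ | _) <;> simp [flip]

theorem flip_eq_up {o : Option Label} : flip o = some .up ↔ o = some .down := by
  rcases o with _ | (_ | _ | _ | _) <;> simp [flip]

theorem flip_active (o : Option Label) : o = flip o ∨ (Active o ∧ Active (flip o)) := by
  rcases o with _ | (_ | _ | _ | _) <;> simp [flip, Active]

namespace Weight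

/-- Exchange the labels `∨` and `∧` on an interval. -/
def flipOn (w : Weight) (l r : ℤ) : Weight where
  label i := if l ≤ i ∧ i ≤ r then flip (w.label i) else w.label i
  consecutive := by
    convert w.consecutive using 1
    ext i
    simp only [Set.mem_ofPred_eq]
    split_ifs
    · rcases flip_active (w.label i) with e | e
      · rw [← e]
      · exact iff_of_true e.2.ne_none e.1.ne_none
    · rfl
  almost_sorted := by
    obtain ⟨F, hF, h⟩ := w.almost_sorted
    refine ⟨F ∪ Set.Icc l r, hF.union (Set.finite_Icc l r), fun i j hi hj hij => ?_⟩
    rw [Set.mem_union, not_or, Set.mem_Icc] at hi hj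
    rw [if_neg hi.2, if_neg hj.2]
    exact h i j hi.1 hj.1 hij

variable {w : Weight} {l r : ℤ}

theorem flipOn_label (i : ℤ) : (w.flipOn l r).label i =
    if l ≤ i ∧ i ≤ r then flip (w.label i) else w.label i := rfl

theorem flipOn_active (i : ℤ) : w.label i = (w.flipOn l r).label i ∨
    (Active (w.label i) ∧ Active ((w.flipOn l r).label i)) := by
  rw [flipOn_label]
  split_ifs
  · exact flip_active _
  · exact .inl rfl

theorem linked_flipOn (h : ∑ m ∈ Finset.Icc l r, sgn (w.label m) = 0) :
    w.Linked (w.flipOn l r) := by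
  refine linked_of_count (Finset.Icc l r) (fun i hi => ?_) flipOn_active ?_
  · rw [Finset.mem_Icc] at hi
    rw [flipOn_label, if_neg hi]
  · rw [sum_sgn] at h
    have h1 : (Finset.Icc l r).filter (fun i => (w.flipOn l r).label i = some .up) =
        (Finset.Icc l r).filter fun i => w.label i = some .down := by
      refine Finset.filter_congr fun i hi => ?_
      rw [Finset.mem_Icc] at hi
      rw [flipOn_label, if_pos hi, flip_eq_up]
    rw [h1]
    omega

/-- If there are neither `∨`s to the left of `[l, r]` nor `∧`s to its right and the first cup of
the flipped weight spans this interval, then all cups of the flipped weight are clockwise. -/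
theorem flipOn_oriented (hj : Joined (fun i => flip (w.label i)) l r)
    (hl : ∀ i < l, w.label i ≠ some .down) (hr : ∀ i, r < i → w.label i ≠ some .up) :
    w.Linked (w.flipOn l r) ∧ (w.flipOn l r).underline.Oriented w ∧
      ∀ S : Finset ℤ, (∀ i ∈ S, l ≤ i ∧ i ≤ r ∧ w.label i = some .up) →
        S.card ≤ (w.flipOn l r).underline.deg w := by
  have hlink : w.Linked (w.flipOn l r) := by
    refine linked_flipOn ?_
    have := hj.2.2.2.1
    simp_rw [sgn_flip, Finset.sum_neg_distrib] at this
    omega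
  have hj' : Joined (w.flipOn l r).label l r :=
    hj.congr fun k h1 h2 => by rw [flipOn_label, if_pos ⟨h1, h2⟩]
  -- A cup leaving the interval would need a ∨ of `w` to the left of it or a ∧ of `w` to the right
  -- of it.
  have harcs : ∀ p ∈ (w.flipOn l r).underline.arcs,
      w.label p.1 = some .up ∧ w.label p.2 = some .down := by
    intro p hp
    obtain ⟨hlt, h1, h2, -, -⟩ := ArcDiagram.mem_underline_arcs.1 hp
    rw [flipOn_label] at h1 h2
    have h3 : p.2 ≤ r := by
      by_contra hc
      rw [if_neg (by omega)] at h2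
      exact hr _ (by omega) h2
    have h4 : l ≤ p.1 := by
      by_contra hc
      rw [if_neg (by omega)] at h1
      exact hl _ (by omega) h1
    rw [if_pos (by omega)] at h1 h2
    exact ⟨flip_eq_down.1 h1, flip_eq_up.1 h2⟩
  refine ⟨hlink, ⟨hlink.line_eq.symm, ?_, fun p hp => .inr (harcs p hp), ?_, ?_⟩, ?_⟩
  · intro i hi he hi'
    have h1 := (w.flipOn l r).underline_oriented.free i hi he hi'
    rcases flipOn_active (w := w) (l := l) (r := r) i with e | e
    · rwa [e]
    · rcases e.2 with h2 | h2 <;> rw [h2] at h1 <;> simp at h1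
  · intro i hi
    rcases flipOn_active (w := w) (l := l) (r := r) i with e | e
    · rw [e]
      exact hi.1
    · exact e.1
  · rintro i hi j - hij ⟨h1, h2⟩
    have h3 : l ≤ i := not_lt.1 fun hc => hl i hc h1
    -- Under the outermost cup there are no rays, so a ray labelled ∨ lies to the right of `r`,
    -- where no ∧ can follow it.
    have h4 : r < i := by
      by_contra hc
      obtain ⟨k, hk | hk⟩ := hj'.inside h3 (not_lt.1 hc) hi.1
      · exact (hi.2 k).1 hk
      · exact (hi.2 k).2 hk
    exact hr j (h4.trans hij) h2
  · intro S hS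
    refine (Finset.card_le_card (t := ((w.flipOn l r).underline.arcs.filter
      fun p => w.label p.1 = some .up).image Prod.fst) ?_).trans Finset.card_image_le
    intro i hi
    obtain ⟨h1, h2, h3⟩ := hS i hi
    -- Each ∧ of `w` in the interval becomes a ∨ under the outermost cup, hence the left end of a
    -- cup that is clockwise for `w`.
    have h4 : (w.flipOn l r).label i = some .down := by
      rw [flipOn_label, if_pos ⟨h1, h2⟩, flip_eq_down, h3]
    obtain ⟨k, hk | hk⟩ := hj'.inside h1 h2 (.inl h4)
    · exact Finset.mem_image.2 ⟨(i, k), Finset.mem_filter.2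
        ⟨ArcDiagram.mem_underline_arcs.2 hk, h3⟩, rfl⟩
    · have := hk.2.2.1
      rw [h4] at this
      simp at this

/-- Outside the exceptional set no ∨ precedes a ∧. One ∧ there bounds these ∨ from the left, and one
∨ bounds these ∧ from the right. -/
theorem exists_bounds (hU : {i | w.label i = some .up}.Infinite)
    (hD : {i | w.label i = some .down}.Infinite) :
    ∃ L R, (∀ i, w.label i = some .down → L ≤ i) ∧ ∀ i, w.label i = some .up → i ≤ R := by
  obtain ⟨F, hF, h⟩ := w.almost_sorted
  obtain ⟨u, hu, huF⟩ := hU.exists_notMem_finite hF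
  obtain ⟨d, hd, hdF⟩ := hD.exists_notMem_finite hF
  obtain ⟨a, ha⟩ := hF.bddBelow
  obtain ⟨b, hb⟩ := hF.bddAbove
  refine ⟨min a u, max b d, fun i hi => ?_, fun i hi => ?_⟩
  · by_cases hiF : i ∈ F
    · exact (min_le_left _ _).trans (ha hiF)
    · exact (min_le_right _ _).trans (not_lt.1 fun hc => h i u hiF huF hc ⟨hi, hu⟩)
  · by_cases hiF : i ∈ F
    · exact (hb hiF).trans (le_max_left _ _)
    · exact (not_lt.1 fun hc => h d i hdF hiF hc ⟨hd, hi⟩).trans (le_max_right _ _)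

/-- The ∧ are unbounded to the left and the ∨ to the right. Start at a ∧ far to the left, flip the
interval up to the point where ∧ and ∨ first balance, and apply `flipOn_oriented`. -/
theorem exists_deg_ge (hU : {i | w.label i = some .up}.Infinite)
    (hD : {i | w.label i = some .down}.Infinite) (n : ℕ) :
    ∃ v : Weight, w.Linked v ∧ v.underline.Oriented w ∧ n ≤ v.underline.deg w := by
  obtain ⟨L, R, hL, hR⟩ := exists_bounds hU hD
  have hU' : {i | w.label i = some .up ∧ i < L}.Infinite := by
    intro hfin
    refine hU ((hfin.union (Set.finite_Icc L R)).subset fun i hi => ?_)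
    by_cases hc : i < L
    · exact .inl ⟨hi, hc⟩
    · exact .inr ⟨not_lt.1 hc, hR i hi⟩
  -- Besides the `n` clockwise cups wanted, there are more ∧ than the interval `[L, R]` has
  -- vertices. The ∨ in `[L, R]` therefore cannot balance them, which forces `r` beyond `R`.
  obtain ⟨S, hS, hScard⟩ := hU'.exists_subset_card_eq (n + (R - L + 1).toNat + 1)
  have hSne : S.Nonempty := Finset.card_pos.1 (by omega)
  set l := S.min' hSne with hldef
  have hl := hS (S.min'_mem hSne)
  rw [← hldef] at hl
  -- There are only finitely many ∧ from `l` on. One more ∨ than that makes the flipped sum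
  -- negative, so the balance point `r` exists.
  obtain ⟨S', hS', hS'card⟩ :=
    hD.exists_subset_card_eq (((Finset.Icc l R).filter fun i => w.label i = some .up).card + 1)
  have hS'ne : S'.Nonempty := Finset.card_pos.1 (by omega)
  have hsum : ∀ k, ∑ m ∈ Finset.Icc l k, sgn (flip (w.label m)) =
      ((Finset.Icc l k).filter fun i => w.label i = some .up).card -
        ((Finset.Icc l k).filter fun i => w.label i = some .down).card := by
    intro k
    rw [Finset.sum_congr rfl fun m _ => sgn_flip _, Finset.sum_neg_distrib, sum_sgn]
    ring
  have hSl : ∀ i ∈ S, l ≤ i := fun i hi => S.min'_le i hi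
  obtain ⟨r, -, hr⟩ : ∃ r, r ≤ S'.max' hS'ne ∧ Joined (fun i => flip (w.label i)) l r := by
    have hm := hL _ (hS' (S'.max'_mem hS'ne))
    refine exists_joined_right (flip_eq_down.2 hl.1) (hl.2.le.trans hm) ?_
    rw [hsum]
    have h1 : S'.card ≤
        ((Finset.Icc l (S'.max' hS'ne)).filter fun i => w.label i = some .down).card := by
      refine Finset.card_le_card fun i hi => Finset.mem_filter.2 ⟨Finset.mem_Icc.2 ⟨?_, ?_⟩, hS' hi⟩
      · exact hl.2.le.trans (hL i (hS' hi))
      · exact S'.le_max' i hi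
    have h2 : ((Finset.Icc l (S'.max' hS'ne)).filter fun i => w.label i = some .up).card ≤
        ((Finset.Icc l R).filter fun i => w.label i = some .up).card := by
      refine Finset.card_le_card fun i hi => ?_
      rw [Finset.mem_filter, Finset.mem_Icc] at hi ⊢
      exact ⟨⟨hi.1.1, hR i hi.2⟩, hi.2⟩
    omega
  have hbal := hr.2.2.2.1
  rw [hsum] at hbal
  have hLr : L ≤ r := by
    by_contra hc
    have h1 : ((Finset.Icc l r).filter fun i => w.label i = some .down) = ∅ := by
      refine Finset.filter_eq_empty_iff.2 fun i hi hd => ?_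
      have := hL i hd
      rw [Finset.mem_Icc] at hi
      omega
    have h2 : 0 < ((Finset.Icc l r).filter fun i => w.label i = some .up).card :=
      Finset.card_pos.2 ⟨l, Finset.mem_filter.2 ⟨Finset.mem_Icc.2 ⟨le_rfl, hr.1.le⟩, hl.1⟩⟩
    rw [h1, Finset.card_empty] at hbal
    omega
  have hSr : ∀ i ∈ S, l ≤ i ∧ i ≤ r ∧ w.label i = some .up := fun i hi =>
    ⟨hSl i hi, (hS hi).2.le.trans hLr, (hS hi).1⟩
  have hRr : R ≤ r := by
    by_contra hc
    have h1 : S.card ≤ ((Finset.Icc l r).filter fun i => w.label i = some .up).card :=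
      Finset.card_le_card fun i hi => Finset.mem_filter.2
        ⟨Finset.mem_Icc.2 ⟨(hSr i hi).1, (hSr i hi).2.1⟩, (hSr i hi).2.2⟩
    have h2 : ((Finset.Icc l r).filter fun i => w.label i = some .down).card ≤
        (Finset.Icc L R).card := by
      refine Finset.card_le_card fun i hi => ?_
      rw [Finset.mem_filter, Finset.mem_Icc] at hi
      exact Finset.mem_Icc.2 ⟨hL i hi.2, by omega⟩
    rw [Int.card_Icc] at h2
    omega
  obtain ⟨h1, h2, h3⟩ := flipOn_oriented hr
    (fun i hi hd => by
      have := hL i hd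
      have := hl.2
      omega)
    (fun i hi hu => by
      have := hR i hu
      omega)
  exact ⟨_, h1, h2, le_trans (by omega) (h3 S hSr)⟩

end Weight

/-! ## Weights with finitely many `∨` or finitely many `∧` -/

namespace ArcDiagram.Oriented

variable {a : ArcDiagram} {w : Weight} {o : Option Label}

theorem end_mem (h : a.Oriented w) (ho : Active o) {A : Finset ℤ} (hA : ∀ i, w.label i = o → i ∈ A)
    {p : ℤ × ℤ} (hp : p ∈ a.arcs) : p.1 ∈ A ∨ p.2 ∈ A := by
  rcases ho with rfl | rfl <;> rcases h.arcs p hp with e | e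
  · exact .inl (hA _ e.1)
  · exact .inr (hA _ e.2)
  · exact .inr (hA _ e.2)
  · exact .inl (hA _ e.1)

/-- Every arc has an end labelled `o`, hence one in `A`, and distinct arcs share no end. -/
theorem card_arcs_le (h : a.Oriented w) (ho : Active o) {A : Finset ℤ}
    (hA : ∀ i, w.label i = o → i ∈ A) : a.arcs.card ≤ A.card := by
  refine Finset.card_le_card_of_injOn (fun p => if p.1 ∈ A then p.1 else p.2) ?_ ?_
  · intro p hp
    dsimp only
    split_ifs with h1
    · exact h1
    · exact (h.end_mem ho hA hp).resolve_left h1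
  · intro p hp q hq hpq
    dsimp only at hpq
    refine a.nonCrossing.eq_of_end hp hq (i := if p.1 ∈ A then p.1 else p.2) ?_ ?_
    · split_ifs
      · exact .inl rfl
      · exact .inr rfl
    · rw [hpq]
      split_ifs
      · exact .inl rfl
      · exact .inr rfl

/-- No ray lies under an arc, so all vertices there labelled ∨ or ∧ are ends of arcs. This bounds
how far an arc can reach. -/
theorem card_inside_le (h : a.Oriented w) {p : ℤ × ℤ} (hp : p ∈ a.arcs) :
    ((Finset.Icc p.1 p.2).filter fun i => Active (w.label i)).card ≤ 2 * a.arcs.card := by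
  refine (Finset.card_le_card (t := a.arcs.image Prod.fst ∪ a.arcs.image Prod.snd) ?_).trans ?_
  · intro i hi
    rw [Finset.mem_filter, Finset.mem_Icc] at hi
    have he : IsEnd a.arcs i := by
      by_contra hne
      have := a.arc_ray p hp i (h.mem_rays hne hi.2)
      omega
    obtain ⟨q, hq, rfl | rfl⟩ := he
    · exact Finset.mem_union_left _ (Finset.mem_image_of_mem _ hq)
    · exact Finset.mem_union_right _ (Finset.mem_image_of_mem _ hq)
  · refine (Finset.card_union_le _ _).trans ?_
    have h1 : (a.arcs.image Prod.fst).card ≤ a.arcs.card := Finset.card_image_le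
    have h2 : (a.arcs.image Prod.snd).card ≤ a.arcs.card := Finset.card_image_le
    omega

theorem rays_eq (h : a.Oriented w) : a.rays = {i | Active (w.label i) ∧ ¬ IsEnd a.arcs i} :=
  Set.ext fun i => ⟨fun hi => ⟨h.rays i hi, not_isEnd_of_mem_rays hi⟩, fun hi => h.mem_rays hi.2 hi.1⟩

end ArcDiagram.Oriented

/-- Only finitely many elements of a set of integers can be reached from `a` by passing a bounded
number of elements. -/
theorem finite_near (s : Set ℤ) (a : ℤ) (n : ℕ) :
    {b | b ∈ s ∧ ((Finset.Icc (min a b) (max a b)).filter (· ∈ s)).card ≤ n}.Finite := by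
  by_contra hinf
  -- Among `2 * n + 1` such elements, more than `n` lie on one side of `a`, and then the farthest of
  -- them is separated from `a` by too many.
  obtain ⟨S, hS, hcard⟩ := Set.Infinite.exists_subset_card_eq hinf (2 * n + 1)
  have hsplit := Finset.card_filter_add_card_filter_not (s := S) (fun b => a ≤ b)
  have key : ∀ (P : Finset ℤ), P ⊆ S → ∀ m ∈ P,
      (∀ b ∈ P, min a m ≤ b ∧ b ≤ max a m) → P.card ≤ n := by
    intro P hP m hm hb
    refine (Finset.card_le_card fun b hbP => ?_).trans (hS (hP hm)).2
    exact Finset.mem_filter.2 ⟨Finset.mem_Icc.2 (hb b hbP), (hS (hP hbP)).1⟩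
  have h1 : (S.filter fun b => a ≤ b).card ≤ n := by
    rcases (S.filter fun b => a ≤ b).eq_empty_or_nonempty with h0 | h0
    · rw [h0]
      exact Nat.zero_le _
    · refine key _ (Finset.filter_subset _ _) _ (Finset.max'_mem _ h0) fun b hb => ⟨?_, ?_⟩
      · exact (min_le_left _ _).trans (Finset.mem_filter.1 hb).2
      · exact (Finset.le_max' _ _ hb).trans (le_max_right _ _)
  have h2 : (S.filter fun b => ¬ a ≤ b).card ≤ n := by
    rcases (S.filter fun b => ¬ a ≤ b).eq_empty_or_nonempty with h0 | h0
    · rw [h0]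
      exact Nat.zero_le _
    · refine key _ (Finset.filter_subset _ _) _ (Finset.min'_mem _ h0) fun b hb => ⟨?_, ?_⟩
      · exact (min_le_right _ _).trans (Finset.min'_le _ _ hb)
      · exact (not_le.1 (Finset.mem_filter.1 hb).2).le.trans (le_max_left _ _)
  omega

/-- Every arc has an end in the finite set `A`, and its other end is near that one in the sense of
`finite_near`. So finitely many arcs are possible, and the arcs determine the rays. -/
theorem CupsOn.finite {w : Weight} {o : Option Label} (ho : Active o)
    (hfin : {i | w.label i = o}.Finite) : Finite (CupsOn w) := by
  set A := hfin.toFinset with hAdef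
  have hA : ∀ i, w.label i = o → i ∈ A := fun i hi => hfin.mem_toFinset.2 hi
  let s : Set ℤ := {i | Active (w.label i)}
  let G : Set ℤ := ⋃ a ∈ A,
    {b | b ∈ s ∧ ((Finset.Icc (min a b) (max a b)).filter (· ∈ s)).card ≤ 2 * A.card}
  have hG : G.Finite := A.finite_toSet.biUnion fun a _ => finite_near s a _
  let H := ((hG.union A.finite_toSet).prod (hG.union A.finite_toSet)).toFinset
  have harcs : ∀ c : CupsOn w, c.1.arcs ∈ H.powerset := by
    intro c
    refine Finset.mem_powerset.2 fun p hp => ?_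
    have h1 := (c.2.card_inside_le hp).trans (Nat.mul_le_mul_left 2 (c.2.card_arcs_le ho hA))
    have hlt := c.1.arc_lt p hp
    have hact : p.1 ∈ s ∧ p.2 ∈ s :=
      ⟨c.2.alternates.active ⟨p, hp, .inl rfl⟩, c.2.alternates.active ⟨p, hp, .inr rfl⟩⟩
    rw [Set.Finite.mem_toFinset, Set.mem_prod]
    rcases c.2.end_mem ho hA hp with h2 | h2
    · refine ⟨.inr h2, .inl (Set.mem_biUnion h2 ⟨hact.2, ?_⟩)⟩
      rwa [min_eq_left hlt.le, max_eq_right hlt.le]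
    · refine ⟨.inl (Set.mem_biUnion h2 ⟨hact.1, ?_⟩), .inr h2⟩
      rwa [min_eq_right hlt.le, max_eq_left hlt.le]
  refine Finite.of_injective (β := H.powerset) (fun c => ⟨c.1.arcs, harcs c⟩) fun c c' h => ?_
  have h' : c.1.arcs = c'.1.arcs := congrArg Subtype.val h
  refine Subtype.ext (ArcDiagram.ext (c.2.line_eq.trans c'.2.line_eq.symm) h' ?_)
  rw [c.2.rays_eq, c'.2.rays_eq, h']

theorem Weight.Linked.exists_finset {w v : Weight} (h : w.Linked v) {o : Option Label}
    {A : Finset ℤ} (hA : ∀ i, w.label i = o ↔ i ∈ A) :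
    ∃ B : Finset ℤ, B.card = A.card ∧ ∀ i, v.label i = o → i ∈ B := by
  obtain ⟨S, hS, hc⟩ := h.exists_count
  refine ⟨(S ∪ A).filter fun i => v.label i = o, ?_, fun i hi => ?_⟩
  · rw [← hc _ Finset.subset_union_left]
    congr 1
    ext i
    rw [Finset.mem_filter, hA, Finset.mem_union]
    tauto
  · refine Finset.mem_filter.2 ⟨?_, hi⟩
    by_cases hiS : i ∈ S
    · exact Finset.mem_union_left _ hiS
    · exact Finset.mem_union_right _ ((hA i).1 ((hS i hiS).trans hi))

/-! ## Finiteness of the cell modules and the defect -/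

section Defect

variable {Λ : Block} {μ : Weight} {hμ : μ ∈ Λ.carrier}

theorem degreeFiltration_eq_bot_iff (j : ℤ) :
    (cellModule μ hμ).degreeFiltration j = ⊥ ↔ ∀ c : CupsOn μ, (c.1.deg μ : ℤ) < j := by
  rw [degreeFiltration_eq]
  constructor
  · intro h c
    by_contra hc
    have h1 : Finsupp.single c (1 : ℂ) ∈
        Finsupp.supported ℂ ℂ {c : CupsOn μ | j ≤ (c.1.deg μ : ℤ)} :=
      Finsupp.single_mem_supported ℂ _ (not_lt.1 hc)
    have h2 : Finsupp.single c (1 : ℂ) = 0 := (Submodule.mem_bot ℂ).1 (h ▸ h1)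
    exact one_ne_zero (Finsupp.single_eq_zero.1 h2)
  · intro h
    have : {c : CupsOn μ | j ≤ (c.1.deg μ : ℤ)} = ∅ :=
      Set.eq_empty_of_forall_notMem fun c hc => (h c).not_ge hc
    rw [this]
    exact Finsupp.supported_empty

theorem finiteDimensional_iff_finite_cups :
    FiniteDimensional ℂ (cellModule μ hμ).carrier ↔ Finite (CupsOn μ) := by
  change Module.Finite ℂ (CupsOn μ →₀ ℂ) ↔ _
  exact ⟨fun _ => Module.Finite.finite_basis (Finsupp.basisSingleOne (R := ℂ)),
    fun _ => inferInstance⟩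

theorem Block.defect_lt_top {o : Option Label} (hμ : μ ∈ Λ.carrier) (ho : Active o)
    (hfin : {i | μ.label i = o}.Finite) : Λ.defect < ⊤ := by
  refine lt_of_le_of_lt (b := (hfin.toFinset.card : ℕ∞)) ?_ (ENat.natCast_lt_top _)
  refine iSup₂_le fun w hw => ?_
  obtain ⟨B, hB, hmem⟩ := (Block.linked hμ hw).exists_finset (o := o) (A := hfin.toFinset)
    fun i => hfin.mem_toFinset.symm
  rw [← hB]
  exact_mod_cast w.underline_oriented.card_arcs_le ho hmem

theorem Block.defect_eq_top (hμ : μ ∈ Λ.carrier)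
    (h : ∀ n : ℕ, ∃ v : Weight, μ.Linked v ∧ v.underline.Oriented μ ∧ n ≤ v.underline.deg μ) :
    Λ.defect = ⊤ := by
  refine ENat.eq_top_iff_forall_ge.2 fun n => ?_
  obtain ⟨v, hv, -, hn⟩ := h n
  refine le_iSup₂_of_le v (Block.mem_of_linked hμ hv) ?_
  exact_mod_cast hn.trans (Finset.card_filter_le _ _)

/-- The dichotomy is whether one of the labels ∨, ∧ occurs only finitely often in `μ`. If so, all
three quantities are finite; if not, `exists_deg_ge` makes all three infinite, because a diagram has
at least as many cups as clockwise cups. -/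
theorem finiteness_iff_defect :
    ((∃ J, ∀ j ≥ J, (cellModule μ hμ).degreeFiltration j = ⊥) ↔ Λ.defect < ⊤) ∧
      (FiniteDimensional ℂ (cellModule μ hμ).carrier ↔ Λ.defect < ⊤) := by
  rw [finiteDimensional_iff_finite_cups]
  simp only [degreeFiltration_eq_bot_iff]
  by_cases hfin : ∃ o, Active o ∧ {i | μ.label i = o}.Finite
  · obtain ⟨o, ho, hfin⟩ := hfin
    have hd := Block.defect_lt_top hμ ho hfin
    have hc := CupsOn.finite ho hfin
    refine ⟨iff_of_true ?_ hd, iff_of_true hc hd⟩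
    obtain ⟨b, hb⟩ := (Set.finite_range fun c : CupsOn μ => (c.1.deg μ : ℤ)).bddAbove
    refine ⟨b + 1, fun j hj c => ?_⟩
    have : (c.1.deg μ : ℤ) ≤ b := hb ⟨c, rfl⟩
    omega
  · push Not at hfin
    have hlarge := Weight.exists_deg_ge (hfin _ (.inr rfl)) (hfin _ (.inl rfl))
    have hd : ¬ Λ.defect < ⊤ := by
      rw [Block.defect_eq_top hμ hlarge]
      exact lt_irrefl _
    have hno : ∀ J : ℤ, ∃ c : CupsOn μ, J ≤ c.1.deg μ := by
      intro J
      obtain ⟨v, -, hv, hn⟩ := hlarge J.toNat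
      exact ⟨⟨_, hv⟩, by dsimp only; omega⟩
    refine ⟨iff_of_false ?_ hd, iff_of_false ?_ hd⟩
    · rintro ⟨J, hJ⟩
      obtain ⟨c, hc⟩ := hno J
      exact (hJ J le_rfl c).not_ge hc
    · intro hc
      obtain ⟨b, hb⟩ := (Set.finite_range fun c : CupsOn μ => (c.1.deg μ : ℤ)).bddAbove
      obtain ⟨c, hc⟩ := hno (b + 1)
      have : (c.1.deg μ : ℤ) ≤ b := hb ⟨c, rfl⟩
      omega

end Defect

end KhovanovArc

end

theorem theorem5p2 (Λ : KhovanovArc.Block) (μ : KhovanovArc.Weight) (hμ : μ ∈ Λ.carrier) :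
    -- `V` is the cell module `V(μ)`, `N` its degree filtration
    let V : KhovanovArc.Rep Λ := KhovanovArc.cellModule μ hμ
    let N : ℤ → Submodule ℂ V.carrier := V.degreeFiltration
    V.IsGraded ∧
    N 0 = ⊤ ∧ Antitone N ∧
    (∃ hN : ∀ j, V.IsSubmodule (N j), ∀ j ≥ 0,
      (V.subquotient (N j) (N (j + 1)) (hN j).1 (hN (j + 1)).1).Iso
        (KhovanovArc.Rep.directSum
          fun l : {l : Λ.carrier // l.1.Sub μ ∧ (l.1.underline.deg μ : ℤ) = j} =>
            (KhovanovArc.simpleModule l.1.1 l.1.2).shift j)) ∧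
    -- the `q`-decomposition numbers: the coefficient of `q ^ j` is the multiplicity of `L(l)⟨j⟩`
    (∀ (l : KhovanovArc.Weight) (hl : l ∈ Λ.carrier) (j : ℤ),
      (l.Sub μ ∧ (l.underline.deg μ : ℤ) = j →
        V.multiplicity ((KhovanovArc.simpleModule l hl).shift j) = 1) ∧
      (¬ (l.Sub μ ∧ (l.underline.deg μ : ℤ) = j) →
        V.multiplicity ((KhovanovArc.simpleModule l hl).shift j) = 0)) ∧
    ((∃ J, ∀ j ≥ J, N j = ⊥) ↔ Λ.defect < ⊤) ∧
    (FiniteDimensional ℂ V.carrier ↔ Λ.defect < ⊤) :=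
  ⟨KhovanovArc.cellModule_isGraded, KhovanovArc.degreeFiltration_zero,
    KhovanovArc.degreeFiltration_antitone,
    ⟨KhovanovArc.isSubmodule_degreeFiltration, fun j _ => KhovanovArc.layer_iso j _ _⟩,
    fun _ hl _ => ⟨fun h => le_antisymm (KhovanovArc.multiplicity_le_one hl)
      (KhovanovArc.one_le_multiplicity hl h), KhovanovArc.multiplicity_eq_zero hl⟩,
    KhovanovArc.finiteness_iff_defect⟩
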